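/- Let $\mathbb{F}$ be a finite field, $D\ge 1$, $n_0\ge\dots\ge n_{D-1}$, and $T\in\mathbb{F}^{n_0\times\dots\times n_{D-1}}$. For $R\ge 0$, a rank-$R$ canonical polyadic decomposition (CPD) of $T$ is a list of matrices $A_d\in\mathbb{F}^{n_d\times R}$, $0\le d<D$, such that $T_{i_0,\dots,i_{D-1}}=\sum_{0\le r<R}\prod_{0\le d<D}(A_d)_{i_d,r}$ for all indices. Call $T$ concise if, for every axis $d$, the $n_d$ slices of $T$ obtained by fixing the index of axis $d$ are linearly independent over $\mathbb{F}$. Theorem. There is an algorithm that, given a finite field $\mathbb{F}$ (through its operation tables), a concise tensor $T\in\mathbb{F}^{n_0\times\dots\times n_{D-1}}$ with $n_0\ge\dots\ge n_{D-1}$, and an integer $R\ge 0$, returns a rank-$R$ CPD of $T$ if one exists, and otherwise reports that none exists. It runs in time \[O^*\!\left(|\mathbb{F}|^{\min\{R,\ \sum_{d\ge 2}n_d\}+\max\{R-n_0,\,0\}\cdot\sum_{d\ne 0}n_d}\right)\] and in $O^*(1)$ space. Here $O^*$ hides a factor that is bounded by a fixed polynomial in $|\mathbb{F}|$, $R$,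 $D$ and the number $\prod_d n_d$ of entries of $T$; the algorithm and the polynomials do not depend on $\mathbb{F}$, $D$, the shape, $T$ or $R$. Time is the number of elementary steps of a random access machine, and space is its peak memory use in bits, including the input. -/

import Mathlib

/-! ### Tensors, canonical polyadic decompositions, conciseness -/

namespace TensorCPD

/-- A tensor of shape `n 0 × ⋯ × n (D - 1)` with entries in `F`. -/
abbrev Tensor (F : Type*) {D : ℕ} (n : Fin D → ℕ) : Type _ :=
  (∀ d : Fin D, Fin (n d)) → F

/-- The tensor `⟦A 0, …, A (D - 1)⟧ = ∑ r, ⨂ d, (A d)_{:, r}` of a list of factor matrices. -/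
def cpdEval {F : Type*} [Field F] {D : ℕ} {n : Fin D → ℕ} {R : ℕ}
    (A : ∀ d : Fin D, Matrix (Fin (n d)) (Fin R) F) : Tensor F n :=
  fun i => ∑ r : Fin R, ∏ d : Fin D, A d (i d) r

/-- The slice of `T` whose index along axis `d` is fixed to be `j`; a tensor on the other axes. -/
def slice {F : Type*} {m : ℕ} {n : Fin (m + 1) → ℕ} (T : Tensor F n) (d : Fin (m + 1))
    (j : Fin (n d)) : Tensor F (fun k : Fin m => n (d.succAbove k)) :=
  fun i => T (d.insertNth (α := fun k => Fin (n k)) j i)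

/-- `T` is concise: along every axis, its slices are linearly independent. -/
def Concise {F : Type*} [Field F] {m : ℕ} {n : Fin (m + 1) → ℕ} (T : Tensor F n) : Prop :=
  ∀ d : Fin (m + 1), LinearIndependent F (slice T d)

/-! ### The machine model

A random access machine working on natural numbers. The memory consists of arrays, each with
cells numbered by `ℕ`; a (fixed, finite) program names the finitely many arrays that it uses.
Programs are while programs with indirect addressing. Each arithmetic operation, memory access,
assignment and test takes one unit of time, and space is the peak number of bits needed to write
down the nonzero cells together with their indices (so a number whose size is not polynomially
bounded is paid for, and an elementary operation takes time polynomial in the space on a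
Turing machine). -/

/-- Memory contents: `M a i` is the content of cell `i` of array `a`. -/
abbrev Mem : Type := ℕ → ℕ → ℕ

/-- Overwrite cell `i` of array `a` by `v`. -/
def Mem.set (M : Mem) (a i v : ℕ) : Mem :=
  Function.update M a (Function.update (M a) i v)

/-- The nonzero cells of `M` together with their indices can be written down with `s` bits. -/
def Mem.FitsIn (M : Mem) (s : ℕ) : Prop :=
  ∃ S : Finset (ℕ × ℕ), (∀ a i, M a i ≠ 0 → (a, i) ∈ S) ∧
    ∑ c ∈ S, (1 + Nat.size c.2 + Nat.size (M c.1 c.2)) ≤ s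

/-- Arithmetic expressions: constants, reading a cell of an array, and the usual operations of
natural numbers (truncated subtraction, division rounded down, remainder). -/
inductive Expr : Type
  | lit (k : ℕ)
  | load (a : ℕ) (i : Expr)
  | add (x y : Expr)
  | sub (x y : Expr)
  | mul (x y : Expr)
  | div (x y : Expr)
  | mod (x y : Expr)

/-- The value of an expression. -/
def Expr.eval (M : Mem) : Expr → ℕ
  | lit k => k
  | load a i => M a (i.eval M)
  | add x y => x.eval M + y.eval M
  | sub x y => x.eval M - y.eval M
  | mul x y => x.eval M * y.eval M
  | div x y => x.eval M / y.eval M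
  | mod x y => x.eval M % y.eval M

/-- The number of elementary steps needed to evaluate an expression. -/
def Expr.cost : Expr → ℕ
  | lit _ => 1
  | load _ i => i.cost + 1
  | add x y => x.cost + y.cost + 1
  | sub x y => x.cost + y.cost + 1
  | mul x y => x.cost + y.cost + 1
  | div x y => x.cost + y.cost + 1
  | mod x y => x.cost + y.cost + 1

/-- Programs. A test succeeds when the value of its expression is nonzero. -/
inductive Prog : Type
  | skip
  | assign (a : ℕ) (i e : Expr)
  | seq (p q : Prog)
  | cond (b : Expr) (p q : Prog)
  | loop (b : Expr) (p : Prog)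

/-- `Exec s p M M' t`: started on memory `M`, the program `p` halts after exactly `t` steps with
memory `M'`, and every memory on the way fits in `s` bits. -/
inductive Exec (s : ℕ) : Prog → Mem → Mem → ℕ → Prop
  | skip {M : Mem} (h : M.FitsIn s) : Exec s Prog.skip M M 1
  | assign {M : Mem} {a : ℕ} {i e : Expr} (h : M.FitsIn s)
      (h' : (M.set a (i.eval M) (e.eval M)).FitsIn s) :
      Exec s (Prog.assign a i e) M (M.set a (i.eval M) (e.eval M)) (i.cost + e.cost + 1)
  | seq {p q : Prog} {M M' M'' : Mem} {t t' : ℕ} (h : Exec s p M M' t)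
      (h' : Exec s q M' M'' t') : Exec s (Prog.seq p q) M M'' (t + t')
  | condTrue {b : Expr} {p q : Prog} {M M' : Mem} {t : ℕ} (hb : b.eval M ≠ 0)
      (h : Exec s p M M' t) : Exec s (Prog.cond b p q) M M' (b.cost + 1 + t)
  | condFalse {b : Expr} {p q : Prog} {M M' : Mem} {t : ℕ} (hb : b.eval M = 0)
      (h : Exec s q M M' t) : Exec s (Prog.cond b p q) M M' (b.cost + 1 + t)
  | loopDone {b : Expr} {p : Prog} {M : Mem} (hb : b.eval M = 0) (h : M.FitsIn s) :
      Exec s (Prog.loop b p) M M (b.cost + 1)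
  | loopStep {b : Expr} {p : Prog} {M M' M'' : Mem} {t t' : ℕ} (hb : b.eval M ≠ 0)
      (h : Exec s p M M' t) (h' : Exec s (Prog.loop b p) M' M'' t') :
      Exec s (Prog.loop b p) M M'' (b.cost + 1 + t + t')

/-! ### Input and output

Field elements are written as numbers below `q = |F|` through an arbitrary bijection
`e : F ≃ Fin q`; the field is presented by the tables of its operations. -/

/-- The array with contents `f 0, …, f (N - 1)`, followed by zeros. -/
def table {N : ℕ} (f : Fin N → ℕ) : ℕ → ℕ :=
  fun k => if h : k < N then f ⟨k, h⟩ else 0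

/-- The initial memory on input `(F, T, R)`. Array 0 holds the order of `T`, the number `R`,
the cardinality of `F` and the codes of `0, 1 : F`; array 1 holds the shape; arrays 2, 3, 4, 5
hold the tables of addition, multiplication, negation and inversion; array 6 holds the entries of
`T`, flattened. All other arrays are zero. -/
def inputMem {F : Type*} [Field F] {q : ℕ} (e : F ≃ Fin q) {D : ℕ} {n : Fin D → ℕ}
    (T : Tensor F n) (R : ℕ) : Mem
  | 0 => table ![D, R, q, (e 0 : ℕ), (e 1 : ℕ)]
  | 1 => table n
  | 2 => table fun k : Fin (q * q) =>
      (e (e.symm (finProdFinEquiv.symm k).1 + e.symm (finProdFinEquiv.symm k).2) : ℕ)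
  | 3 => table fun k : Fin (q * q) =>
      (e (e.symm (finProdFinEquiv.symm k).1 * e.symm (finProdFinEquiv.symm k).2) : ℕ)
  | 4 => table fun k : Fin q => (e (-e.symm k) : ℕ)
  | 5 => table fun k : Fin q => (e (e.symm k)⁻¹ : ℕ)
  | 6 => table fun k : Fin (∏ d, n d) => (e (T (finPiFinEquiv.symm k)) : ℕ)
  | _ => fun _ => 0

/-- The final memory says "no decomposition": cell 0 of array 7 is `0`. -/
def OutputsNone (M : Mem) : Prop :=
  M 7 0 = 0

/-- The final memory returns the factor matrices `A`: cell 0 of array 7 is `1`, and array 8 holds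
the matrices `A 0, …, A (D - 1)`, one after the other, each of them row by row. -/
def OutputsCPD {F : Type*} {q : ℕ} (e : F ≃ Fin q) {D : ℕ} {n : Fin D → ℕ} {R : ℕ}
    (A : ∀ d : Fin D, Matrix (Fin (n d)) (Fin R) F) (M : Mem) : Prop :=
  M 7 0 = 1 ∧ ∀ (d : Fin D) (i : Fin (n d)) (r : Fin R),
    M 8 ((finSigmaFinEquiv ⟨d, i⟩ : ℕ) * R + r) = (e (A d i r) : ℕ)

end TensorCPD

/-! Suppose that T = ⟦A_0, …, A_{D-1}⟧ is concise. A linear map sends row i of A_0 to slice i of T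
along axis 0, so the rows of A_0 are independent (`Concise.linearIndependent_rows`). Hence R ≥ n_0,
and some n_0 columns of A_0 form an invertible matrix (`exists_columns`). For the other k = R - n_0
columns, all values of the factors along the axes d ≠ 0 are tried. This accounts for |F|^(k ·
∑_{d≠0} n_d) guesses; each one fixes rank one tensors u_1, …, u_k on the axes d ≠ 0.

Let T_l be the slices along axis 0. If V is the inverse of the invertible submatrix and the guess is
right, then for each row v of V the tensor ∑ v_l T_l is a combination of the u_r plus one product
tensor. Conversely, n_0 independent vectors v with this property give a decomposition, by inverting
the matrix that they form (`Valid.isCPD`). It therefore suffices to decide, for each guess, whether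
such vectors span F^(n_0). This is done greedily: every v that is found is inserted into a basis by
Steinitz exchange (`IsDual.exchange`), and `Killed` expresses membership in the span of the vectors
inserted so far.

Once the factors of the product tensor along the axes d ≥ 2 are fixed, the condition is linear in v,
in the coefficients x of the u_r and in the factor along axis 1. Elimination gives generators of the
solutions (`IsKernel.step`), and only these need to be inserted. The factors along the axes d ≥ 2
matter only up to scalars and are enumerated in the cheaper of two ways (`exists_candidate`). Either
all of them are listed, |F|^(∑_{d≥2} n_d) in number, or all |F|^R coefficient vectors (v, -x) are
listed together with a column: if the combination is a nonzero product tensor, its fibers through a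
nonzero entry are its factors up to scalars. The choice of the column costs only a polynomial
factor. `exists_succeeds` shows that the right guess leads to a full basis.

The remaining work is a program logic. `Runs` records time, space, the arrays that may change and a
postcondition. Only the loops over guesses and candidates are exponentially long; all others have
polynomial length and are measured by `Prog.tm`. Exponentially large numbers do occur, as counters
and powers of |F|, but they have polynomially many bits. -/

set_option linter.unusedSectionVars false

/-! ### A program logic with time, space and frame conditions. -/

namespace TensorCPD

/-! ### Expression macros -/

namespace Expr

/-- The content of cell `0` of an array used as a variable. -/
def var (a : ℕ) : Expr := load a (lit 0)

/-- `1` if `x < y` and `0` otherwise. -/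
def lt (x y : Expr) : Expr := sub (lit 1) (sub (lit 1) (sub y x))

/-- `u` if `x < y` and `v` otherwise. -/
def selLt (x y u v : Expr) : Expr :=
  add (mul (lt x y) u) (mul (sub (lit 1) (lt x y)) v)

/-- `u` if `x = y` and `v` otherwise. -/
def selEq (x y u v : Expr) : Expr := selLt x y v (selLt y x v u)

@[simp] theorem eval_var (M : Mem) (a : ℕ) : (var a).eval M = M a 0 := rfl

@[simp] theorem eval_lt (M : Mem) (x y : Expr) :
    (lt x y).eval M = if x.eval M < y.eval M then 1 else 0 := by
  simp only [lt, eval]; split_ifs <;> omega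

@[simp] theorem eval_selLt (M : Mem) (x y u v : Expr) :
    (selLt x y u v).eval M = if x.eval M < y.eval M then u.eval M else v.eval M := by
  simp only [selLt, eval, eval_lt]; split_ifs <;> simp

@[simp] theorem eval_selEq (M : Mem) (x y u v : Expr) :
    (selEq x y u v).eval M = if x.eval M = y.eval M then u.eval M else v.eval M := by
  simp only [selEq, eval_selLt]; split_ifs <;> first | rfl | omega

end Expr

/-! ### Memory -/

theorem Mem.set_of_ne (M : Mem) {a b : ℕ} (h : b ≠ a) (i v : ℕ) : M.set a i v b = M b := by
  simp [Mem.set, Function.update_of_ne h]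

@[simp] theorem Mem.set_self (M : Mem) (a i v : ℕ) : M.set a i v a i = v := by
  simp [Mem.set]

theorem Mem.set_cell_of_ne (M : Mem) (a : ℕ) {i j : ℕ} (h : j ≠ i) (v : ℕ) :
    M.set a i v a j = M a j := by
  simp [Mem.set, Function.update_of_ne h]

/-- Only the cells below `B` of the first forty arrays are in use, with contents below `V`. -/
def Mem.Ok (B V : ℕ) (M : Mem) : Prop :=
  ∀ a i, M a i ≠ 0 → a < 40 ∧ i < B ∧ M a i < V

/-- A bound for the number of bits of a memory that satisfies `Mem.Ok B V`. -/
def space (B V : ℕ) : ℕ := 40 * B * (1 + B.size + V.size)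

/-- At most 40 · B cells can be nonzero, and each takes at most 1 + size B + size V bits. -/
theorem Mem.Ok.fits {B V : ℕ} {M : Mem} (h : M.Ok B V) : M.FitsIn (space B V) := by
  by_cases hV : V = 0
  · refine ⟨∅, fun a i hai => ?_, by simp⟩
    have := (h a i hai).2.2
    omega
  refine ⟨Finset.range 40 ×ˢ Finset.range B, fun a i hai => ?_, ?_⟩
  · have := h a i hai
    simp only [Finset.mem_product, Finset.mem_range]
    exact ⟨this.1, this.2.1⟩
  · refine (Finset.sum_le_card_nsmul _ _ (1 + B.size + V.size) fun c hc => ?_).trans ?_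
    · simp only [Finset.mem_product, Finset.mem_range] at hc
      have h1 : Nat.size c.2 ≤ B.size := Nat.size_le_size hc.2.le
      have h2 : Nat.size (M c.1 c.2) ≤ V.size := by
        apply Nat.size_le_size
        by_cases h0 : M c.1 c.2 = 0
        · omega
        · exact (h _ _ h0).2.2.le
      omega
    · simp [space]

theorem Mem.Ok.lt {B V : ℕ} {M : Mem} (h : M.Ok B V) (hV : 0 < V) (a i : ℕ) : M a i < V := by
  by_cases h0 : M a i = 0
  · omega
  · exact (h _ _ h0).2.2

theorem Mem.Ok.set {B V : ℕ} {M : Mem} (h : M.Ok B V) {a i v : ℕ} (ha : a < 40) (hi : i < B)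
    (hv : v < V) : (M.set a i v).Ok B V := by
  intro b j hbj
  by_cases hb : b = a
  · subst hb
    by_cases hj : j = i
    · subst hj
      simpa using ⟨ha, hi, hv⟩
    · rw [Mem.set_cell_of_ne _ _ hj] at hbj ⊢
      exact h _ _ hbj
  · rw [Mem.set_of_ne _ hb] at hbj ⊢
    exact h _ _ hbj

/-! ### Execution with postconditions -/

/-- The arrays that a program may modify. -/
def Prog.mods : Prog → List ℕ
  | skip => []
  | assign a _ _ => [a]
  | seq p q => p.mods ++ q.mods
  | cond _ p q => p.mods ++ q.mods
  | loop _ p => p.mods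

/-- An upper bound for the running time if every loop makes at most `X` iterations. -/
def Prog.tm (X : ℕ) : Prog → ℕ
  | skip => 1
  | assign _ i e => i.cost + e.cost + 1
  | seq p q => p.tm X + q.tm X
  | cond b p q => b.cost + 1 + (p.tm X + q.tm X)
  | loop b p => b.cost + 1 + X * (b.cost + 1 + p.tm X)

/-- `Prog.tm` as a polynomial. -/
noncomputable def Prog.tmPoly : Prog → Polynomial ℕ
  | skip => 1
  | assign _ i e => Polynomial.C (i.cost + e.cost + 1)
  | seq p q => p.tmPoly + q.tmPoly
  | cond b p q => Polynomial.C (b.cost + 1) + (p.tmPoly + q.tmPoly)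
  | loop b p =>
    Polynomial.C (b.cost + 1) + Polynomial.X * (Polynomial.C (b.cost + 1) + p.tmPoly)

/-- The polynomial depends on the program alone, so a loop bound polynomial in the input size yields
a uniform polynomial running time. -/
theorem Prog.eval_tmPoly (X : ℕ) (p : Prog) : p.tmPoly.eval X = p.tm X := by
  induction p <;> simp_all [tmPoly, tm]

/-- Two memories agree on all arrays outside of `l`. -/
def Mem.EqOff (l : List ℕ) (M' M : Mem) : Prop := ∀ a, a ∉ l → M' a = M a

theorem Mem.EqOff.trans {l l' l'' : List ℕ} {M M' M'' : Mem} (h : M''.EqOff l' M')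
    (h' : M'.EqOff l M) (hl : ∀ a ∈ l, a ∈ l'') (hl' : ∀ a ∈ l', a ∈ l'') : M''.EqOff l'' M :=
  fun a ha => (h a fun h1 => ha (hl' a h1)).trans (h' a fun h1 => ha (hl a h1))

theorem Mem.EqOff.mono {l l' : List ℕ} {M M' : Mem} (h : M'.EqOff l M)
    (hl : ∀ a ∈ l, a ∈ l') : M'.EqOff l' M :=
  fun a ha => h a fun h1 => ha (hl a h1)

/-- Started on `M`, the program `p` halts within `t` steps in a memory satisfying `Q`, stays within
the space bound and modifies only the arrays in `p.mods`. -/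
def Runs (B V : ℕ) (p : Prog) (t : ℕ) (M : Mem) (Q : Mem → Prop) : Prop :=
  ∃ M' t', Exec (space B V) p M M' t' ∧ t' ≤ t ∧ M'.Ok B V ∧ M'.EqOff p.mods M ∧ Q M'

section Rules

variable {B V : ℕ} {M : Mem} {Q Q' : Mem → Prop} {p p' : Prog} {t t' T : ℕ}

theorem Runs.mono (h : Runs B V p t M Q) (ht : t ≤ T)
    (hQ : ∀ M', M'.Ok B V → M'.EqOff p.mods M → Q M' → Q' M') : Runs B V p T M Q' := by
  obtain ⟨M', t', h1, h2, h3, h4, h5⟩ := h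
  exact ⟨M', t', h1, h2.trans ht, h3, h4, hQ M' h3 h4 h5⟩

theorem Runs.skip (hM : M.Ok B V) (hQ : Q M) (ht : 1 ≤ t) : Runs B V Prog.skip t M Q :=
  ⟨M, 1, Exec.skip hM.fits, ht, hM, fun _ _ => rfl, hQ⟩

theorem Runs.assign {a : ℕ} {i e : Expr} (hM : M.Ok B V) (ha : a < 40) (hi : i.eval M < B)
    (he : e.eval M < V) (hQ : Q (M.set a (i.eval M) (e.eval M))) (ht : i.cost + e.cost + 1 ≤ t) :
    Runs B V (Prog.assign a i e) t M Q :=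
  have h := hM.set ha hi he
  ⟨_, _, Exec.assign hM.fits h.fits, ht, h,
    fun b hb => Mem.set_of_ne _ (by simpa [Prog.mods] using hb) _ _, hQ⟩

theorem Runs.seq (h : Runs B V p t M fun M' => Runs B V p' t' M' Q) (ht : t + t' ≤ T) :
    Runs B V (Prog.seq p p') T M Q := by
  obtain ⟨M', s, h1, h2, -, h4, M'', s', h1', h2', h3', h4', h5'⟩ := h
  exact ⟨M'', s + s', Exec.seq h1 h1', by omega, h3',
    h4'.trans h4 (by simp +contextual [Prog.mods]) (by simp +contextual [Prog.mods]), h5'⟩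

/-- Besides `Q'`, the second program may rely on all arrays that the first one does not modify. -/
theorem Runs.andThen (h : Runs B V p t M Q')
    (h' : ∀ M', M'.Ok B V → M'.EqOff p.mods M → Q' M' → Runs B V p' t' M' Q) (ht : t + t' ≤ T) :
    Runs B V (Prog.seq p p') T M Q :=
  Runs.seq (h.mono le_rfl h') ht

theorem Runs.cond {b : Expr} (h1 : b.eval M ≠ 0 → Runs B V p t M Q)
    (h2 : b.eval M = 0 → Runs B V p' t' M Q) (ht : b.cost + 1 + t ≤ T)
    (ht' : b.cost + 1 + t' ≤ T) : Runs B V (Prog.cond b p p') T M Q := by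
  by_cases hb : b.eval M = 0
  · obtain ⟨M', s, h1, h2, h3, h4, h5⟩ := h2 hb
    exact ⟨M', _, Exec.condFalse hb h1, by omega, h3, h4.mono (by simp +contextual [Prog.mods]), h5⟩
  · obtain ⟨M', s, h1, h2, h3, h4, h5⟩ := h1 hb
    exact ⟨M', _, Exec.condTrue hb h1, by omega, h3, h4.mono (by simp +contextual [Prog.mods]), h5⟩

end Rules

open TensorCPD.Expr

/-- `for i < N do p`, with the counter in cell `0` of array `i`. -/
def forLoop (i : ℕ) (N : Expr) (p : Prog) : Prog :=
  .seq (.assign i (lit 0) (lit 0))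
    (.loop (Expr.lt (var i) N) (.seq p (.assign i (lit 0) (add (var i) (lit 1)))))

theorem mods_forLoop (i : ℕ) (N : Expr) (p : Prog) :
    (forLoop i N p).mods = i :: (p.mods ++ [i]) := rfl

/-- The invariant is demanded for every memory that agrees off array `i`, so it survives the reset
and the increment of the counter. The bound `N` is evaluated anew at each test, and `hN` keeps it
constant. In `hT`, resetting the counter costs 3 steps and incrementing it costs 6. -/
theorem runs_forLoop {B V : ℕ} {M : Mem} {i cnt t T : ℕ} {N : Expr} {p : Prog}
    (I : ℕ → Mem → Prop) (hM : M.Ok B V) (hi : i < 40) (hip : i ∉ p.mods) (hB : 0 < B)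
    (hV : cnt < V)
    (hN : ∀ M' : Mem, M'.EqOff (i :: p.mods) M → N.eval M' = cnt)
    (h0 : ∀ M' : Mem, M'.EqOff [i] M → I 0 M')
    (hs : ∀ j < cnt, ∀ M' : Mem, M'.Ok B V → M'.EqOff (i :: p.mods) M → M' i 0 = j → I j M' →
      Runs B V p t M' fun M'' => ∀ M₃ : Mem, M₃.EqOff [i] M'' → I (j + 1) M₃)
    (hT : 3 + (Expr.lt (var i) N).cost + 1 + cnt * ((Expr.lt (var i) N).cost + 1 + (t + 6)) ≤ T) :
    Runs B V (forLoop i N p) T M (I cnt) := by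
  set c := (Expr.lt (var i) N).cost with hc
  -- Induction on the number `r` of iterations that remain.
  have key : ∀ r j, j + r = cnt → ∀ M' : Mem, M'.Ok B V → M'.EqOff (i :: p.mods) M → M' i 0 = j →
      I j M' → ∃ M'' t'', Exec (space B V) (.loop (Expr.lt (var i) N)
        (.seq p (.assign i (lit 0) (add (var i) (lit 1))))) M' M'' t'' ∧
        t'' ≤ c + 1 + r * (c + 1 + (t + 6)) ∧ M''.Ok B V ∧ M''.EqOff (i :: p.mods) M ∧
        I cnt M'' := by
    intro r
    induction r with
    | zero =>
      intro j hj M' hok hoff hij hI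
      obtain rfl : j = cnt := by omega
      refine ⟨M', c + 1, Exec.loopDone ?_ hok.fits, by omega, hok, hoff, hI⟩
      rw [eval_lt, hN M' hoff, eval_var, hij]; simp
    | succ r ih =>
      intro j hj M' hok hoff hij hI
      obtain ⟨M₁, s₁, e₁, l₁, ok₁, off₁, q₁⟩ := hs j (by omega) M' hok hoff hij hI
      have hij₁ : M₁ i 0 = j := by rw [off₁ i hip, hij]
      set M₂ := M₁.set i 0 (j + 1) with hM₂
      have ok₂ : M₂.Ok B V := ok₁.set hi hB (by omega)
      have off₂ : M₂.EqOff [i] M₁ := fun a ha => Mem.set_of_ne _ (by simpa using ha) _ _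
      have e₂ : Exec (space B V) (.assign i (lit 0) (add (var i) (lit 1))) M₁ M₂ 6 := by
        have := Exec.assign (s := space B V) (M := M₁) (a := i) (i := lit 0)
          (e := add (var i) (lit 1)) ok₁.fits
          (by simpa [Expr.eval, hij₁] using ok₂.fits)
        simpa [Expr.eval, hij₁, Expr.cost, Expr.var] using this
      obtain ⟨M₃, s₃, e₃, l₃, ok₃, off₃, q₃⟩ := ih (j + 1) (by omega) M₂ ok₂
        (off₂.trans (off₁.trans hoff (l'' := i :: p.mods) (by simp) (by simp +contextual))
          (by simp) (by simp)) (by simp [hM₂]) (q₁ M₂ off₂)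
      refine ⟨M₃, _, Exec.loopStep ?_ (Exec.seq e₁ e₂) e₃, ?_, ok₃, off₃, q₃⟩
      · rw [eval_lt, hN M' hoff, eval_var, hij, if_pos (by omega)]; simp
      · rw [add_mul, one_mul]; omega
  set M₀ := M.set i 0 0 with hM₀
  have ok₀ : M₀.Ok B V := hM.set hi hB (by omega)
  have off₀ : M₀.EqOff [i] M := fun a ha => Mem.set_of_ne _ (by simpa using ha) _ _
  obtain ⟨M', s, e₁, l₁, ok₁, off₁, q₁⟩ := key cnt 0 (by omega) M₀ ok₀
    (off₀.mono (by simp)) (by simp [hM₀]) (h0 M₀ off₀)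
  refine ⟨M', _, Exec.seq (Exec.assign hM.fits (by simpa [Expr.eval] using ok₀.fits)) e₁, ?_, ok₁,
    off₁.mono (by simp +contextual [mods_forLoop]), q₁⟩
  simp only [Expr.cost]
  omega

/-- `for i < N do a[i] := e`. -/
def mapLoop (a i : ℕ) (N e : Expr) : Prog := forLoop i N (.assign a (var i) e)

/-- The expression may read the cells of `a` from `j` on, which still have their old contents; this
allows arrays to be updated in place. -/
theorem runs_mapLoop {B V : ℕ} {M : Mem} {a i cnt X : ℕ} {N e : Expr} (f : ℕ → ℕ)
    (hM : M.Ok B V) (ha : a < 40) (hi : i < 40) (hai : a ≠ i) (hX : cnt ≤ X) (hB : cnt ≤ B)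
    (hB' : 0 < B) (hV : B < V)
    (hN : ∀ M' : Mem, M'.EqOff [a, i] M → N.eval M' = cnt)
    (he : ∀ j < cnt, ∀ M' : Mem, M'.Ok B V → M'.EqOff [a, i] M → M' i 0 = j →
      (∀ y, j ≤ y → M' a y = M a y) → e.eval M' = f j)
    (hf : ∀ j < cnt, f j < V) :
    Runs B V (mapLoop a i N e) ((mapLoop a i N e).tm X) M fun M' =>
      (∀ j < cnt, M' a j = f j) ∧ ∀ j, cnt ≤ j → M' a j = M a j := by
  refine runs_forLoop (t := (var i).cost + e.cost + 1)
    (fun c M' => (∀ j < c, M' a j = f j) ∧ ∀ j, c ≤ j → M' a j = M a j)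
    hM hi (by simpa [Prog.mods] using hai.symm) hB' (by omega)
    (fun M' h => hN M' (h.mono (by simp [Prog.mods]))) ?_ ?_ ?_
  · intro M' h
    refine ⟨by simp, fun j _ => by rw [h a (by simpa using hai)]⟩
  · intro j hj M' hok hoff hij hI
    have hev := he j hj M' hok (hoff.mono (by simp [Prog.mods])) hij hI.2
    refine Runs.assign hok ha (by simp [hij]; omega) (hev ▸ hf j hj) ?_ le_rfl
    intro M₃ h₃
    rw [hev, eval_var, hij] at h₃
    rw [h₃ a (by simpa using hai)]
    refine ⟨fun y hy => ?_, fun y hy => ?_⟩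
    · rcases Nat.lt_succ_iff_lt_or_eq.1 hy with h | rfl
      · rw [Mem.set_cell_of_ne _ _ h.ne]; exact hI.1 y h
      · simp
    · rw [Mem.set_cell_of_ne _ _ (by omega)]; exact hI.2 y (by omega)
  · have := Nat.mul_le_mul_right ((Expr.lt (var i) N).cost + 1 + ((var i).cost + e.cost + 1 + 6)) hX
    simp only [mapLoop, forLoop, Prog.tm, Expr.cost, Expr.var, Nat.reduceAdd] at this ⊢
    omega

/-- `for i < N do (acc := init; for l < K do acc := step; a[i] := acc)`. -/
def foldLoop (a i l acc : ℕ) (N K init step : Expr) : Prog :=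
  forLoop i N (.seq (.assign acc (lit 0) init)
    (.seq (forLoop l K (.assign acc (lit 0) step)) (.assign a (var i) (var acc))))

/-- `f j y` is the accumulator for entry `j` after `y` inner steps. Sums, products and pivot
searches are all instances. -/
theorem runs_foldLoop {B V : ℕ} {M : Mem} {a i l acc cnt X : ℕ} {N K init step : Expr}
    (kc : ℕ → ℕ) (f : ℕ → ℕ → ℕ) (hM : M.Ok B V) (ha : a < 40) (hi : i < 40) (hl : l < 40)
    (hacc : acc < 40) (hd : [a, i, l, acc].Nodup) (hX : cnt ≤ X) (hB : cnt ≤ B) (hB' : 0 < B)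
    (hV : B < V) (hkX : ∀ j < cnt, kc j ≤ X) (hkB : ∀ j < cnt, kc j ≤ B)
    (hN : ∀ M' : Mem, M'.EqOff [a, i, l, acc] M → N.eval M' = cnt)
    (hK : ∀ j < cnt, ∀ M' : Mem, M'.EqOff [a, i, l, acc] M → M' i 0 = j → K.eval M' = kc j)
    (hinit : ∀ j < cnt, ∀ M' : Mem, M'.EqOff [a, i, l, acc] M → M' i 0 = j →
      init.eval M' = f j 0)
    (hstep : ∀ j < cnt, ∀ y < kc j, ∀ M' : Mem, M'.Ok B V → M'.EqOff [a, i, l, acc] M →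
      M' i 0 = j → M' l 0 = y → M' acc 0 = f j y → step.eval M' = f j (y + 1))
    (hf : ∀ j < cnt, ∀ y ≤ kc j, f j y < V) :
    Runs B V (foldLoop a i l acc N K init step) ((foldLoop a i l acc N K init step).tm X) M
      fun M' => (∀ j < cnt, M' a j = f j (kc j)) := by
  simp only [List.nodup_cons, List.mem_cons, List.not_mem_nil, or_false, not_or, not_false_eq_true,
    List.nodup_nil, and_true] at hd
  obtain ⟨⟨hai, hal, haacc⟩, ⟨hil, hiacc⟩, hlacc⟩ := hd
  set inner := forLoop l K (.assign acc (lit 0) step) with hinner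
  set body := Prog.seq (.assign acc (lit 0) init) (.seq inner (.assign a (var i) (var acc)))
    with hbody
  have hmods : ∀ x ∈ i :: body.mods, x ∈ [a, i, l, acc] := by
    intro x hx
    simp only [hbody, hinner, Prog.mods, mods_forLoop] at hx
    simp only [List.cons_append, List.nil_append, List.mem_cons, List.not_mem_nil, or_false] at hx ⊢
    tauto
  refine runs_forLoop (t := body.tm X)
    (fun c M' => ∀ j < c, M' a j = f j (kc j))
    hM hi (by simp [Prog.mods, mods_forLoop, hiacc, hil, Ne.symm hai]) hB' (by omega)
    (fun M' h => hN M' (h.mono hmods)) (by simp) ?_ ?_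
  · intro j hj M₁ hok₁ hoff₁ hij₁ hI
    have hoff₁' := hoff₁.mono hmods
    have hev := hinit j hj M₁ hoff₁' hij₁
    refine Runs.seq (t := _) (t' := _) (Runs.assign hok₁ hacc hB'
      (by rw [hev]; exact hf j hj 0 (by omega)) ?_ le_rfl) (by
        simp only [hbody, Prog.tm]; exact le_rfl)
    rw [hev]
    simp only [Expr.eval]
    set M₂ := M₁.set acc 0 (f j 0) with hM₂
    have hok₂ : M₂.Ok B V := hok₁.set hacc hB' (hf j hj 0 (by omega))
    have hoff₂ : M₂.EqOff [acc] M₁ := fun a ha => Mem.set_of_ne _ (by simpa using ha) _ _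
    have hoff₂' : M₂.EqOff [a, i, l, acc] M := hoff₂.trans hoff₁' (by simp) (by simp)
    have hij₂ : M₂ i 0 = j := by rw [hoff₂ i (by simpa using hiacc), hij₁]
    refine Runs.andThen (t := inner.tm X) (t' := (Prog.assign a (var i) (var acc)).tm X)
      (Q' := fun M' => M' acc 0 = f j (kc j))
      (runs_forLoop (t := 1 + step.cost + 1) (fun c M' => M' acc 0 = f j c) hok₂ hl
        (by simpa [Prog.mods] using hlacc) hB' (by have := hkB j hj; omega) (cnt := kc j)
        ?_ ?_ ?_ ?_) ?_ le_rfl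
    · intro M₃ h₃
      have := h₃.trans (l'' := [a, i, l, acc]) hoff₂' (by simp) (by simp [Prog.mods])
      exact hK j hj M₃ this (by
        rw [h₃ i (by simpa [Prog.mods] using ⟨hil, hiacc⟩), hij₂])
    · intro M₃ h₃
      rw [h₃ acc (by simpa using Ne.symm hlacc)]
      simp [hM₂]
    · intro y hy M₃ hok₃ hoff₃ hly hacc₃
      have hoff₃' := hoff₃.trans (l'' := [a, i, l, acc]) hoff₂' (by simp) (by simp [Prog.mods])
      have hev := hstep j hj y hy M₃ hok₃ hoff₃' (by
        rw [hoff₃ i (by simpa [Prog.mods] using ⟨hil, hiacc⟩), hij₂]) hly hacc₃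
      refine Runs.assign hok₃ hacc hB' (by rw [hev]; exact hf j hj _ hy) ?_ (by simp [Expr.cost])
      intro M₄ h₄
      rw [h₄ acc (by simpa using Ne.symm hlacc), hev]
      simp [Expr.eval]
    · have := Nat.mul_le_mul_right ((Expr.lt (var l) K).cost + 1 + (1 + step.cost + 1 + 6))
        (hkX j hj)
      simp only [hinner, forLoop, Prog.tm, Expr.cost, Expr.var, Nat.reduceAdd] at this ⊢
      omega
    · intro M₃ hok₃ hoff₃ hacc₃
      have hoff₃' : M₃.EqOff [l, acc] M₂ := hoff₃.mono (by
        simp [mods_forLoop, Prog.mods])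
      have hij₃ : M₃ i 0 = j := by
        rw [hoff₃' i (by simpa using ⟨hil, hiacc⟩), hij₂]
      have ha₃ : M₃ a = M₁ a := by
        rw [hoff₃' a (by simpa using ⟨hal, haacc⟩), hoff₂ a (by simpa using haacc)]
      refine Runs.assign hok₃ ha (by simp [hij₃]; omega)
        (by simp [hacc₃, hf j hj _ le_rfl]) ?_ le_rfl
      intro M₄ h₄ y hy
      rw [h₄ a (by simpa using hai), eval_var, eval_var, hij₃, hacc₃]
      rcases Nat.lt_succ_iff_lt_or_eq.1 hy with h | rfl
      · rw [Mem.set_cell_of_ne _ _ h.ne, ha₃]; exact hI y h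
      · simp
  · have := Nat.mul_le_mul_right ((Expr.lt (var i) N).cost + 1 + (body.tm X + 6)) hX
    simp only [foldLoop, forLoop, Prog.tm, Expr.cost, Expr.var, hbody,
      hinner, Nat.reduceAdd] at this ⊢
    omega

end TensorCPD

/-! ### Instances indexed by ℕ, field arithmetic by table lookup, and precomputed tables. -/

namespace TensorCPD
open TensorCPD.Expr

/-! ### Matrix versions of the loop rules -/

theorem mul_add_lt_mul {i j r s : ℕ} (hi : i < r) (hj : j < s) : i * s + j < r * s := by
  calc i * s + j < i * s + s := by omega
    _ = (i + 1) * s := by ring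
    _ ≤ r * s := Nat.mul_le_mul_right _ hi

theorem mul_add_div_right' {i j s : ℕ} (hj : j < s) : (i * s + j) / s = i := by
  rw [add_comm, Nat.add_mul_div_right _ _ (by omega), Nat.div_eq_of_lt hj, zero_add]

theorem mul_add_mod_right' {i j s : ℕ} (hj : j < s) : (i * s + j) % s = j := by
  rw [add_comm, Nat.add_mul_mod_self_right, Nat.mod_eq_of_lt hj]

theorem div_lt_and_mod_lt {x r s : ℕ} (h : x < r * s) : x / s < r ∧ x % s < s := by
  have hs : 0 < s := Nat.pos_of_ne_zero (by rintro rfl; simp at h)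
  exact ⟨(Nat.div_lt_iff_lt_mul hs).2 h, Nat.mod_lt _ hs⟩

/-- Matrices with `s` columns are stored row by row; division with remainder by `s` recovers row and
column from the counter. -/
theorem runs_mapMat {B V : ℕ} {M : Mem} {a i r s X : ℕ} {N e : Expr} (f : ℕ → ℕ → ℕ)
    (hM : M.Ok B V) (ha : a < 40) (hi : i < 40) (hai : a ≠ i) (hX : r * s ≤ X) (hB : r * s ≤ B)
    (hB' : 0 < B) (hV : B < V)
    (hN : ∀ M' : Mem, M'.EqOff [a, i] M → N.eval M' = r * s)
    (he : ∀ x < r, ∀ y < s, ∀ M' : Mem, M'.Ok B V → M'.EqOff [a, i] M → M' i 0 = x * s + y →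
      M' i 0 / s = x → M' i 0 % s = y → M' a (x * s + y) = M a (x * s + y) → e.eval M' = f x y)
    (hf : ∀ x < r, ∀ y < s, f x y < V) :
    Runs B V (mapLoop a i N e) ((mapLoop a i N e).tm X) M fun M' =>
      ∀ x < r, ∀ y < s, M' a (x * s + y) = f x y := by
  refine (runs_mapLoop (fun z => f (z / s) (z % s)) hM ha hi hai hX hB hB' hV hN ?_ ?_).mono le_rfl
    ?_
  · intro z hz M' hok hoff hiz hself
    obtain ⟨h1, h2⟩ := div_lt_and_mod_lt hz
    have h3 : z / s * s + z % s = z := Nat.div_add_mod' z s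
    refine he _ h1 _ h2 M' hok hoff (by rw [h3, hiz]) (by rw [hiz]) (by rw [hiz]) ?_
    rw [h3]; exact hself z le_rfl
  · intro z hz
    obtain ⟨h1, h2⟩ := div_lt_and_mod_lt hz
    exact hf _ h1 _ h2
  · intro M' _ _ h x hx y hy
    rw [h.1 _ (mul_add_lt_mul hx hy), mul_add_div_right' hy, mul_add_mod_right' hy]

theorem runs_foldMat {B V : ℕ} {M : Mem} {a i l acc r s X : ℕ} {N K init step : Expr}
    (kc : ℕ) (f : ℕ → ℕ → ℕ → ℕ) (hM : M.Ok B V) (ha : a < 40) (hi : i < 40) (hl : l < 40)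
    (hacc : acc < 40) (hd : [a, i, l, acc].Nodup) (hX : r * s ≤ X) (hB : r * s ≤ B) (hB' : 0 < B)
    (hV : B < V) (hkX : kc ≤ X) (hkB : kc ≤ B)
    (hN : ∀ M' : Mem, M'.EqOff [a, i, l, acc] M → N.eval M' = r * s)
    (hK : ∀ M' : Mem, M'.EqOff [a, i, l, acc] M → K.eval M' = kc)
    (hinit : ∀ x < r, ∀ y < s, ∀ M' : Mem, M'.EqOff [a, i, l, acc] M →
      M' i 0 / s = x → M' i 0 % s = y → init.eval M' = f x y 0)
    (hstep : ∀ x < r, ∀ y < s, ∀ z < kc, ∀ M' : Mem, M'.Ok B V → M'.EqOff [a, i, l, acc] M →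
      M' i 0 / s = x → M' i 0 % s = y → M' l 0 = z → M' acc 0 = f x y z →
      step.eval M' = f x y (z + 1))
    (hf : ∀ x < r, ∀ y < s, ∀ z ≤ kc, f x y z < V) :
    Runs B V (foldLoop a i l acc N K init step) ((foldLoop a i l acc N K init step).tm X) M
      fun M' => ∀ x < r, ∀ y < s, M' a (x * s + y) = f x y kc := by
  refine (runs_foldLoop (fun _ => kc) (fun z => f (z / s) (z % s)) hM ha hi hl hacc hd hX hB hB' hV
    (fun _ _ => hkX) (fun _ _ => hkB) hN (fun _ _ M' h _ => hK M' h) ?_ ?_ ?_).mono le_rfl ?_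
  · intro z hz M' hoff hiz
    obtain ⟨h1, h2⟩ := div_lt_and_mod_lt hz
    exact hinit _ h1 _ h2 M' hoff (by rw [hiz]) (by rw [hiz])
  · intro z hz y hy M' hok hoff hiz hly hac
    obtain ⟨h1, h2⟩ := div_lt_and_mod_lt hz
    exact hstep _ h1 _ h2 y hy M' hok hoff (by rw [hiz]) (by rw [hiz]) hly hac
  · intro z hz
    obtain ⟨h1, h2⟩ := div_lt_and_mod_lt hz
    exact hf _ h1 _ h2
  · intro M' _ _ h x hx y hy
    rw [h _ (mul_add_lt_mul hx hy), mul_add_div_right' hy, mul_add_mod_right' hy]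

theorem Mem.EqOff.cell {l : List ℕ} {M M' : Mem} (h : M'.EqOff l M) (a i : ℕ)
    (ha : a ∉ l := by decide) : M' a i = M a i := by rw [h a ha]

/-! ### Instances -/

/-- An instance of the decomposition problem, with indices in `ℕ`: the order `D`, the rank `R`, the
shape `n` and the unfolding `T l j` of the tensor along axis `0`. -/
structure Inst (F : Type*) where
  D : ℕ
  R : ℕ
  n : ℕ → ℕ
  T : ℕ → ℕ → F

namespace Inst

variable {F : Type*} (I : Inst F)

/-- The first packed row index of axis `d`. -/
def off (d : ℕ) : ℕ := ∑ x ∈ Finset.range d, I.n x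

/-- The stride of axis `d`. -/
def str (d : ℕ) : ℕ := ∏ x ∈ Finset.range d, I.n x

/-- The total number of rows of the factor matrices. -/
def L : ℕ := I.off I.D

/-- The number of columns of the unfolding along axis `0`. -/
def N : ℕ := I.str I.D / I.n 0

/-- The number of columns of the factor matrices that are guessed. -/
def k : ℕ := I.R - I.n 0

/-- The number of unknowns of the linear system of a candidate. -/
def m : ℕ := I.R + I.n 1

/-- The number of rows of the factor matrices except the first one. -/
def S₁ : ℕ := I.L - I.n 0

/-- The number of rows of the factor matrices except the first two. -/
def S₂ : ℕ := I.L - I.off 2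

/-- The axis of a packed row index. -/
def axis (ℓ : ℕ) : ℕ := ∑ x ∈ Finset.range I.D, if ℓ < I.off (x + 1) then 0 else 1

/-- The index along axis `d` of column `j` of the unfolding. -/
def dig (d j : ℕ) : ℕ := I.n 0 * j / I.str d % I.n d

variable [Field F]

/-- The entry `j` of the product of the factors of a packed column for the axes from `s` on. -/
def prodFrom (s : ℕ) (col : ℕ → F) (j : ℕ) : F :=
  ∏ x ∈ Finset.range (I.D - s), col (I.off (s + x) + I.dig (s + x) j)

/-- Row `j` of the unfolding, followed by the rank one tensors given by the packed columns `u`. -/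
def base (u : ℕ → ℕ → F) (j l : ℕ) : F :=
  if l < I.n 0 then I.T l j else I.prodFrom 1 (fun ℓ => u ℓ (l - I.n 0)) j

/-- The linear system of a candidate `w` for the factors of a rank one tensor. -/
def coef (u : ℕ → ℕ → F) (w : ℕ → F) (j l : ℕ) : F :=
  if l < I.R then I.base u j l else if I.dig 1 j = l - I.R then I.prodFrom 2 w j else 0

end Inst

/-! ### Field arithmetic in programs -/

namespace Expr

/-- The order. -/
def D : Expr := load 0 (lit 0)
/-- The rank. -/
def R : Expr := load 0 (lit 1)
/-- The cardinality of the field. -/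
def q : Expr := load 0 (lit 2)
/-- The code of `0`. -/
def zero : Expr := load 0 (lit 3)
/-- The code of `1`. -/
def one : Expr := load 0 (lit 4)
/-- The first dimension. -/
def n₀ : Expr := load 1 (lit 0)
/-- Field addition. -/
def fadd (x y : Expr) : Expr := load 2 (add (mul x q) y)
/-- Field multiplication. -/
def fmul (x y : Expr) : Expr := load 3 (add (mul x q) y)
/-- Field negation. -/
def fneg (x : Expr) : Expr := load 4 x
/-- Field inversion. -/
def finv (x : Expr) : Expr := load 5 x
/-- The total number of rows. -/
def L : Expr := load 10 D
/-- The number of columns of the unfolding. -/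
def N : Expr := div (load 9 D) n₀
/-- The number of guessed columns. -/
def k : Expr := sub R n₀
/-- The number of unknowns. -/
def m : Expr := add R (load 1 (lit 1))
/-- See `Inst.S₁`. -/
def S₁ : Expr := sub L n₀
/-- See `Inst.S₂`. -/
def S₂ : Expr := sub L (load 10 (lit 2))
/-- See `Inst.dig`. -/
def dig (d j : Expr) : Expr := mod (div (mul n₀ j) (load 9 d)) (load 1 d)

end Expr

variable {F : Type*} {qq : ℕ}

/-- The numbers `B` and `V` are large enough for the instance `I`. -/
structure Fits (qq : ℕ) (I : Inst F) (B V : ℕ) : Prop where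
  BV : B < V
  q : qq ≤ B
  D : I.D + 1 ≤ B
  n0 : I.n 0 * I.n 0 ≤ B
  RL : (I.R + 1) * (I.L + 1) ≤ B
  N : I.N * (I.R + 1) ≤ B
  m : I.m * I.m ≤ B
  nL : I.n 0 * (I.L + 1) ≤ B
  str : ∀ d ≤ I.D, I.str d < V
  off : ∀ d ≤ I.D, I.off d < V
  pow : ∀ t < (I.R + 1) * (I.L + 1), qq ^ t < V
  cand : qq ^ I.R * I.N < V

theorem Fits.pos {I : Inst F} {B V : ℕ} (h : Fits qq I B V) : 0 < B := by have := h.D; omega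

theorem Fits.code {I : Inst F} {B V : ℕ} (h : Fits qq I B V) (e : F ≃ Fin qq) (a : F) : (e a : ℕ) < V := by
  have := (e a).2; have := h.q; have := h.BV; omega

/-- Applied to numbers of field elements written as digits: the powers needed to extract the digits
are in the table, and the digits fit into one array. -/
theorem Fits.exponent {I : Inst F} {B V : ℕ} (h : Fits qq I B V) {r : ℕ} (hr : r ≤ I.R)
    {l : ℕ} (hl : l ≤ I.L) : r * l < (I.R + 1) * (I.L + 1) ∧ r * l ≤ B := by
  have h1 := Nat.mul_le_mul hr hl
  have h2 := h.RL
  have h3 : (I.R + 1) * (I.L + 1) = I.R * I.L + I.R + I.L + 1 := by ring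
  omega

theorem Fits.D_le {I : Inst F} {B V : ℕ} (h : Fits qq I B V) : I.D ≤ B := by
  have := h.D; omega

variable [Field F]

/-- The memory contains the instance `I`. -/
structure Input (e : F ≃ Fin qq) (I : Inst F) (M : Mem) : Prop where
  D : M 0 0 = I.D
  R : M 0 1 = I.R
  q : M 0 2 = qq
  zero : M 0 3 = e 0
  one : M 0 4 = e 1
  n : ∀ d < I.D, M 1 d = I.n d
  add : ∀ a b, M 2 (e a * qq + e b) = e (a + b)
  mul : ∀ a b, M 3 (e a * qq + e b) = e (a * b)
  neg : ∀ a, M 4 (e a) = e (-a)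
  inv : ∀ a, M 5 (e a) = e a⁻¹
  T : ∀ l < I.n 0, ∀ j < I.N, M 6 (l + I.n 0 * j) = e (I.T l j)

/-- The memory contains the instance `I` and the tables computed from it. -/
structure Ready (e : F ≃ Fin qq) (I : Inst F) (M : Mem) : Prop extends Input e I M where
  str : ∀ d ≤ I.D, M 9 d = I.str d
  off : ∀ d ≤ I.D, M 10 d = I.off d
  axis : ∀ ℓ < I.L, M 11 ℓ = I.axis ℓ
  pow : ∀ t < (I.R + 1) * (I.L + 1), M 12 t = qq ^ t

section

variable {e : F ≃ Fin qq} {I : Inst F} {B V : ℕ} {M M' : Mem}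

/-- The algorithm never writes to the arrays `0, …, 6`; the side condition is left to `decide`. -/
theorem Input.congr (h : Input e I M) {l : List ℕ} (ho : M'.EqOff l M)
    (hl : ∀ a ∈ List.range 7, a ∉ l := by decide) : Input e I M' := by
  have H : ∀ a < 7, M' a = M a := fun a ha => ho a (hl a (List.mem_range.2 ha))
  constructor <;> simp only [H _ (show 0 < 7 by norm_num), H _ (show 1 < 7 by norm_num),
    H _ (show 2 < 7 by norm_num), H _ (show 3 < 7 by norm_num), H _ (show 4 < 7 by norm_num),
    H _ (show 5 < 7 by norm_num), H _ (show 6 < 7 by norm_num)]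
  exacts [h.D, h.R, h.q, h.zero, h.one, h.n, h.add, h.mul, h.neg, h.inv, h.T]

theorem Ready.congr (h : Ready e I M) {l : List ℕ} (ho : M'.EqOff l M)
    (hl : ∀ a ∈ [0, 1, 2, 3, 4, 5, 6, 9, 10, 11, 12], a ∉ l := by decide) : Ready e I M' where
  toInput := h.toInput.congr ho fun a ha => hl a (by
    have := List.mem_range.1 ha; interval_cases a <;> simp)
  str d hd := by rw [ho 9 (hl 9 (by simp)), h.str d hd]
  off d hd := by rw [ho 10 (hl 10 (by simp)), h.off d hd]
  axis d hd := by rw [ho 11 (hl 11 (by simp)), h.axis d hd]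
  pow d hd := by rw [ho 12 (hl 12 (by simp)), h.pow d hd]

namespace Input

@[simp] theorem eval_D (h : Input e I M) : Expr.D.eval M = I.D := h.D
@[simp] theorem eval_R (h : Input e I M) : Expr.R.eval M = I.R := h.R
@[simp] theorem eval_q (h : Input e I M) : Expr.q.eval M = qq := h.q
@[simp] theorem eval_zero (h : Input e I M) : Expr.zero.eval M = e 0 := h.zero
@[simp] theorem eval_one (h : Input e I M) : Expr.one.eval M = e 1 := h.one
theorem eval_n₀ (h : Input e I M) (hD : 0 < I.D) : Expr.n₀.eval M = I.n 0 := h.n 0 hD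

theorem eval_fadd (h : Input e I M) {x y : Expr} {a b : F} (hx : x.eval M = e a)
    (hy : y.eval M = e b) : (fadd x y).eval M = e (a + b) := by
  simp only [fadd, eval, hx, hy, h.eval_q, h.add]

theorem eval_fmul (h : Input e I M) {x y : Expr} {a b : F} (hx : x.eval M = e a)
    (hy : y.eval M = e b) : (fmul x y).eval M = e (a * b) := by
  simp only [fmul, eval, hx, hy, h.eval_q, h.mul]

theorem eval_fneg (h : Input e I M) {x : Expr} {a : F} (hx : x.eval M = e a) :
    (fneg x).eval M = e (-a) := by
  simp only [fneg, eval, hx, h.neg]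

theorem eval_finv (h : Input e I M) {x : Expr} {a : F} (hx : x.eval M = e a) :
    (finv x).eval M = e a⁻¹ := by
  simp only [finv, eval, hx, h.inv]

theorem eval_k (h : Input e I M) (hD : 0 < I.D) : Expr.k.eval M = I.k := by
  simp only [Expr.k, eval, h.eval_R, h.eval_n₀ hD, Inst.k]

theorem eval_m (h : Input e I M) (hD : 1 < I.D) : Expr.m.eval M = I.m := by
  simp only [Expr.m, eval, h.eval_R, h.n 1 hD, Inst.m]

end Input

namespace Ready

theorem eval_L (h : Ready e I M) : Expr.L.eval M = I.L := by
  simp only [Expr.L, eval, h.eval_D, h.off _ le_rfl, Inst.L]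

theorem eval_N (h : Ready e I M) (hD : 0 < I.D) : Expr.N.eval M = I.N := by
  simp only [Expr.N, eval, h.eval_D, h.str _ le_rfl, Inst.N, h.eval_n₀ hD]

theorem eval_S₁ (h : Ready e I M) (hD : 0 < I.D) : Expr.S₁.eval M = I.S₁ := by
  simp only [Expr.S₁, eval, h.eval_L, h.eval_n₀ hD, Inst.S₁]

theorem eval_S₂ (h : Ready e I M) (hD : 1 < I.D) : Expr.S₂.eval M = I.S₂ := by
  simp only [Expr.S₂, eval, h.eval_L, h.off 2 hD, Inst.S₂]

theorem eval_dig (h : Ready e I M) (hD : 0 < I.D) {d j : Expr} (hd : d.eval M < I.D) :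
    (Expr.dig d j).eval M = I.dig (d.eval M) (j.eval M) := by
  simp only [Expr.dig, eval, h.eval_n₀ hD, h.str _ hd.le, h.n _ hd, Inst.dig]

end Ready

end

/-! ### Tables -/

/-- The program computing the tables. -/
def tablesProg : Prog :=
  .seq (foldLoop 9 37 38 39 (add D (lit 1)) (var 37) (lit 1) (mul (var 39) (load 1 (var 38))))
  (.seq (foldLoop 10 37 38 39 (add D (lit 1)) (var 37) (lit 0) (add (var 39) (load 1 (var 38))))
  (.seq (foldLoop 11 37 38 39 L D (lit 0)
      (add (var 39) (selLt (var 37) (load 10 (add (var 38) (lit 1))) (lit 0) (lit 1))))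
    (foldLoop 12 37 38 39 (mul (add R (lit 1)) (add L (lit 1))) (var 37) (lit 1)
      (mul (var 39) q))))

/-- Every entry is recomputed from scratch by an inner loop. This costs only a polynomial factor and
lets one loop rule serve all four tables. -/
theorem runs_tablesProg {e : F ≃ Fin qq} {I : Inst F} {B V : ℕ} {M : Mem} (hM : M.Ok B V)
    (hI : Input e I M) (hF : Fits qq I B V) :
    Runs B V tablesProg (tablesProg.tm B) M (Ready e I) := by
  have hB := hF.pos
  have hBV := hF.BV
  have hLB : I.L ≤ B := by have := hF.RL; nlinarith
  refine Runs.andThen (t := Prog.tm B _) (t' := Prog.tm B _)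
    (runs_foldLoop (cnt := I.D + 1) (fun j => j) (fun _ y => I.str y) hM (by decide)
    (by decide) (by decide) (by decide) (by decide) hF.D hF.D hB hBV
    (fun j hj => by have := hF.D; omega) (fun j hj => by have := hF.D; omega) ?_ ?_ ?_ ?_ ?_) ?_ le_rfl
  · intro M' ho
    simp only [eval, (hI.congr ho).eval_D]
  · intro j _ M' _ hj
    exact hj
  · intro j _ M' _ _
    simp [eval, Inst.str]
  · intro j hj y hy M' _ ho _ hly hac
    simp only [eval, eval_var, hly, hac, (hI.congr ho).n y (by omega)]
    rw [Inst.str, Inst.str, Finset.prod_range_succ]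
  · intro j hj y hy; exact hF.str y (by omega)
  intro M₁ ok₁ off₁ post₁
  have off₁' : M₁.EqOff [9, 37, 38, 39] M := off₁.mono (by decide)
  have hI₁ := hI.congr off₁'
  refine Runs.andThen (t := Prog.tm B _) (t' := Prog.tm B _)
    (runs_foldLoop (cnt := I.D + 1) (fun j => j) (fun _ y => I.off y) ok₁ (by decide)
    (by decide) (by decide) (by decide) (by decide) hF.D hF.D hB hBV
    (fun j hj => by have := hF.D; omega) (fun j hj => by have := hF.D; omega) ?_ ?_ ?_ ?_ ?_) ?_ le_rfl
  · intro M' ho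
    simp only [eval, (hI₁.congr ho).eval_D]
  · intro j _ M' _ hj
    exact hj
  · intro j _ M' _ _
    simp [eval, Inst.off]
  · intro j hj y hy M' _ ho _ hly hac
    simp only [eval, eval_var, hly, hac, (hI₁.congr ho).n y (by omega)]
    rw [Inst.off, Inst.off, Finset.sum_range_succ]
  · intro j hj y hy; exact hF.off y (by omega)
  intro M₂ ok₂ off₂ post₂
  have off₂' : M₂.EqOff [10, 37, 38, 39] M₁ := off₂.mono (by decide)
  have hI₂ := hI₁.congr off₂'
  have evL : ∀ M' : Mem, M'.EqOff [11, 12, 37, 38, 39] M₂ → Expr.L.eval M' = I.L := by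
    intro M' ho
    simp only [Expr.L, eval, (hI₂.congr ho).eval_D, ho.cell 10, post₂ I.D (by omega), Inst.L]
  refine Runs.andThen (t := Prog.tm B _) (t' := Prog.tm B _)
    (runs_foldLoop (cnt := I.L) (fun _ => I.D)
      (fun ℓ y => ∑ x ∈ Finset.range y, if ℓ < I.off (x + 1) then 0 else 1) ok₂ (by decide)
    (by decide) (by decide) (by decide) (by decide) hLB hLB hB hBV
    (fun j hj => by have := hF.D; omega) (fun j hj => by have := hF.D; omega) ?_ ?_ ?_ ?_ ?_) ?_ le_rfl
  · intro M' ho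
    exact evL M' (ho.mono (by decide))
  · intro j _ M' ho hj
    exact (hI₂.congr ho).eval_D
  · intro j _ M' _ _
    simp [eval]
  · intro j hj y hy M' _ ho hij hly hac
    simp only [eval, eval_var, eval_selLt, hij, hly, hac, ho.cell 10, post₂ (y + 1) (by omega)]
    rw [Finset.sum_range_succ]
  · intro j hj y hy
    refine (Finset.sum_le_card_nsmul _ _ 1 fun x _ => by split_ifs <;> simp).trans_lt ?_
    have := hF.D
    simp; omega
  intro M₃ ok₃ off₃ post₃
  have off₃' : M₃.EqOff [11, 37, 38, 39] M₂ := off₃.mono (by decide)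
  have hI₃ := hI₂.congr off₃'
  have off₃'' : M₃.EqOff [11, 12, 37, 38, 39] M₂ := off₃.mono (by decide)
  refine (runs_foldLoop (cnt := (I.R + 1) * (I.L + 1)) (fun j => j)
      (fun _ y => qq ^ y) ok₃ (by decide)
    (by decide) (by decide) (by decide) (by decide) hF.RL hF.RL hB hBV
    (fun j hj => by have := hF.RL; omega) (fun j hj => by have := hF.RL; omega)
    ?_ ?_ ?_ ?_ ?_).mono le_rfl ?_
  · intro M' ho
    simp only [eval, (hI₃.congr ho).eval_R,
      evL M' ((ho.mono (by decide)).trans off₃'' (by simp) fun _ h => h)]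
  · intro j _ M' ho hj
    exact hj
  · intro j _ M' _ _
    simp [eval]
  · intro j hj y hy M' _ ho hij hly hac
    simp only [eval, eval_var, hac, (hI₃.congr ho).eval_q, pow_succ]
  · intro j hj y hy
    exact hF.pow y (by omega)
  intro M₄ ok₄ off₄ post₄
  have off₄' : M₄.EqOff [12, 37, 38, 39] M₃ := off₄.mono (by decide)
  exact
    { toInput := hI₃.congr off₄'
      str := fun d hd => by
        rw [off₄'.cell 9, off₃'.cell 9, off₂'.cell 9, post₁ d (by omega)]
      off := fun d hd => by
        rw [off₄'.cell 10, off₃'.cell 10, post₂ d (by omega)]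
      axis := fun ℓ hℓ => by
        rw [off₄'.cell 11, post₃ ℓ hℓ, Inst.axis]
      pow := fun t ht => post₄ t ht }

end TensorCPD

/-! ### Packed row indices, and the state of the search at the start of a guess. -/

namespace TensorCPD
open TensorCPD.Expr

/-! ### Packed indices -/

namespace Inst

variable {F : Type*} (I : Inst F)

theorem off_succ (d : ℕ) : I.off (d + 1) = I.off d + I.n d := Finset.sum_range_succ _ _

theorem off_one : I.off 1 = I.n 0 := by simp [off]

theorem off_two : I.off 2 = I.n 0 + I.n 1 := by rw [off_succ, off_one]

theorem off_mono {d d' : ℕ} (h : d ≤ d') : I.off d ≤ I.off d' :=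
  Finset.sum_le_sum_of_subset (by simpa using h)

theorem off_add_lt_L {d i : ℕ} (hd : d < I.D) (hi : i < I.n d) : I.off d + i < I.L := by
  have := I.off_mono (d := d + 1) (d' := I.D) hd
  rw [off_succ] at this
  unfold L; omega

/-- `N` is a quotient of the product of all dimensions and vanishes as soon as one of them does. -/
theorem n_pos (hN : 0 < I.N) {d : ℕ} (hd : d < I.D) : 0 < I.n d := by
  have h : I.str I.D ≠ 0 := by
    intro h; simp [N, h] at hN
  rw [str, Finset.prod_ne_zero_iff] at h
  exact Nat.pos_of_ne_zero (h d (by simpa using hd))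

theorem dig_lt (hN : 0 < I.N) {d : ℕ} (hd : d < I.D) (j : ℕ) : I.dig d j < I.n d :=
  Nat.mod_lt _ (I.n_pos hN hd)

theorem off_add_dig_lt (hN : 0 < I.N) {d : ℕ} (hd : d < I.D) (j : ℕ) :
    I.off d + I.dig d j < I.L :=
  I.off_add_lt_L hd (I.dig_lt hN hd j)

theorem n_zero_le_off {d : ℕ} (hd : 1 ≤ d) : I.n 0 ≤ I.off d := by
  rw [← off_one]; exact I.off_mono hd

/-- `axis` counts the axes whose block of rows ends at or before the given row, which are exactly
the axes below `d`. -/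
theorem axis_eq {d i : ℕ} (hd : d < I.D) (hi : i < I.n d) : I.axis (I.off d + i) = d := by
  rw [axis]
  have : ∀ x ∈ Finset.range I.D, (if I.off d + i < I.off (x + 1) then 0 else 1)
      = if x < d then 1 else 0 := by
    intro x _
    by_cases hx : x < d
    · have := I.off_mono (d := x + 1) (d' := d) hx
      rw [if_neg (by omega), if_pos hx]
    · have h1 := I.off_mono (d := d + 1) (d' := x + 1) (by omega)
      have h2 := I.off_succ d
      rw [if_pos (by omega), if_neg hx]
  rw [Finset.sum_congr rfl this, Finset.sum_ite, Finset.sum_const_zero, add_zero,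
    Finset.sum_const, smul_eq_mul, mul_one]
  have : (Finset.range I.D).filter (· < d) = Finset.range d := by
    ext x; simp; omega
  rw [this, Finset.card_range]

theorem exists_off_add {ℓ D : ℕ} (h : ℓ < I.off D) : ∃ d < D, ∃ i < I.n d, ℓ = I.off d + i := by
  induction D with
  | zero => simp [off] at h
  | succ D ih =>
    by_cases h' : ℓ < I.off D
    · obtain ⟨d, hd, i, hi⟩ := ih h'
      exact ⟨d, by omega, i, hi⟩
    · rw [off_succ] at h
      exact ⟨D, by omega, ℓ - I.off D, by omega, by omega⟩

end Inst

variable {F : Type*} [Field F] {qq : ℕ}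

/-- The field element with a given code. -/
def decode (e : F ≃ Fin qq) (x : ℕ) : F := if h : x < qq then e.symm ⟨x, h⟩ else 0

/-- Digit `t` of `g` in base `qq`, as a field element. -/
def digit (e : F ≃ Fin qq) (g t : ℕ) : F := decode e (g / qq ^ t % qq)

theorem code_decode (e : F ≃ Fin qq) {x : ℕ} (h : x < qq) : (e (decode e x) : ℕ) = x := by
  simp [decode, h]

theorem card_pos (e : F ≃ Fin qq) : 0 < qq := (e 0).pos

theorem code_digit (e : F ≃ Fin qq) (g t : ℕ) : (e (digit e g t) : ℕ) = g / qq ^ t % qq :=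
  code_decode e (Nat.mod_lt _ (card_pos e))

/-- The packed columns encoded by `g`. -/
def guess (e : F ≃ Fin qq) (I : Inst F) (g ℓ r : ℕ) : F := digit e g ((ℓ - I.n 0) * I.k + r)

/-! ### Initialization for a guess -/

/-- The memory contains the guessed packed columns `u` and the corresponding part of the linear
systems. -/
structure Guessed (e : F ≃ Fin qq) (I : Inst F) (u : ℕ → ℕ → F) (M : Mem) : Prop
    extends Ready e I M where
  guess : ∀ ℓ < I.L, I.n 0 ≤ ℓ → ∀ r < I.k, M 14 ((ℓ - I.n 0) * I.k + r) = e (u ℓ r)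
  base : ∀ j < I.N, ∀ l < I.R, M 15 (j * I.R + l) = e (I.base u j l)

/-- The memory contains the matrix `K`, the flags `fil`, and, for the flagged indices `p`, the
coefficients `X p` and the packed column `W p`. -/
structure HasBasis (e : F ≃ Fin qq) (I : Inst F) (K : ℕ → ℕ → F) (fil : ℕ → ℕ)
    (X W : ℕ → ℕ → F) (M : Mem) : Prop where
  rows : ∀ p < I.n 0, ∀ l < I.n 0, M 16 (p * I.n 0 + l) = e (K p l)
  flag : ∀ p < I.n 0, M 17 p = fil p
  coeff : ∀ p < I.n 0, fil p ≠ 0 → ∀ r < I.k, M 18 (p * I.k + r) = e (X p r)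
  cols : ∀ p < I.n 0, fil p ≠ 0 → ∀ ℓ < I.L, I.n 0 ≤ ℓ → M 19 (p * I.L + ℓ) = e (W p ℓ)

theorem Guessed.congr {e : F ≃ Fin qq} {I : Inst F} {u : ℕ → ℕ → F} {M M' : Mem}
    (h : Guessed e I u M) {l : List ℕ} (ho : M'.EqOff l M)
    (hl : ∀ a ∈ [0, 1, 2, 3, 4, 5, 6, 9, 10, 11, 12, 14, 15], a ∉ l := by decide) :
    Guessed e I u M' where
  toReady := h.toReady.congr ho fun a ha => hl a (by
    simp only [List.mem_cons, List.not_mem_nil, or_false] at ha ⊢; tauto)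
  guess ℓ hℓ hℓ' r hr := by rw [ho 14 (hl 14 (by simp)), h.guess ℓ hℓ hℓ' r hr]
  base j hj l hl' := by rw [ho 15 (hl 15 (by simp)), h.base j hj l hl']

theorem HasBasis.congr {e : F ≃ Fin qq} {I : Inst F} {K X W : ℕ → ℕ → F} {fil : ℕ → ℕ}
    {M M' : Mem} (h : HasBasis e I K fil X W M) {l : List ℕ} (ho : M'.EqOff l M)
    (hl : ∀ a ∈ [16, 17, 18, 19], a ∉ l := by decide) : HasBasis e I K fil X W M' where
  rows p hp i hi := by rw [ho 16 (hl 16 (by simp)), h.rows p hp i hi]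
  flag p hp := by rw [ho 17 (hl 17 (by simp)), h.flag p hp]
  coeff p hp hf r hr := by rw [ho 18 (hl 18 (by simp)), h.coeff p hp hf r hr]
  cols p hp hf r hr hr' := by rw [ho 19 (hl 19 (by simp)), h.cols p hp hf r hr hr']

/-- The program preparing the search for a guess, whose number is in array 13. -/
def guessProg : Prog :=
  .seq (mapLoop 14 37 (mul S₁ k) (mod (div (var 13) (load 12 (var 37))) q))
  (.seq (foldLoop 15 37 38 39 (mul N R) (sub D (lit 1))
    (selLt (mod (var 37) R) n₀ (load 6 (add (mod (var 37) R) (mul n₀ (div (var 37) R)))) one)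
    (selLt (mod (var 37) R) n₀ (var 39)
      (fmul (var 39) (load 14 (add (mul (sub (add (load 10 (add (lit 1) (var 38)))
        (dig (add (lit 1) (var 38)) (div (var 37) R))) n₀) k) (sub (mod (var 37) R) n₀))))))
  (.seq (mapLoop 16 37 (mul n₀ n₀) (selEq (div (var 37) n₀) (mod (var 37) n₀) one zero))
    (mapLoop 17 37 n₀ (lit 0))))

/-- The search starts from the standard basis with no row flagged. Arrays 18 and 19 may hold remains
of an earlier guess, since `HasBasis` constrains them only at flagged rows. -/
theorem runs_guessProg {e : F ≃ Fin qq} {I : Inst F} {B V : ℕ} {M : Mem} (hM : M.Ok B V)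
    (hI : Ready e I M) (hF : Fits qq I B V) (hD : 1 < I.D) {g : ℕ} (hg : M 13 0 = g) :
    Runs B V guessProg (guessProg.tm B) M fun M' => Guessed e I (guess e I g) M' ∧
      HasBasis e I (fun p l => if p = l then 1 else 0) (fun _ => 0) 0 0 M' := by
  have hB := hF.pos
  have hBV := hF.BV
  have hD0 : 0 < I.D := by omega
  have hk : I.k ≤ I.R := Nat.sub_le _ _
  have hS₁ : I.S₁ ≤ I.L := Nat.sub_le _ _
  have hNR : I.N * I.R ≤ B := by have := hF.N; nlinarith
  have hn0 : I.n 0 ≤ B := by have := hF.n0; nlinarith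
  have hexp := hF.exponent hk hS₁
  rw [mul_comm] at hexp
  refine Runs.andThen (t := Prog.tm B _) (t' := Prog.tm B _)
    (runs_mapMat (r := I.S₁) (s := I.k) (fun x y => e (guess e I g (x + I.n 0) y)) hM (by decide)
      (by decide) (by decide) hexp.2 hexp.2 hB hBV ?_ ?_ (fun _ _ _ _ => hF.code e _)) ?_ le_rfl
  · intro M' ho
    have h := hI.congr ho
    simp only [eval, h.eval_S₁ hD0, h.eval_k hD0]
  · intro x hx y hy M' _ ho hv _ _ _
    have h := hI.congr ho
    simp only [eval, eval_var, h.eval_q, hv, ho.cell 13, hg, guess, code_digit,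
      Nat.add_sub_cancel]
    rw [h.pow _ ((mul_add_lt_mul hx hy).trans hexp.1)]
  intro M₁ ok₁ off₁ post₁
  have off₁' : M₁.EqOff [14, 37] M := off₁.mono (by decide)
  have hI₁ := hI.congr off₁'
  have hguess : ∀ ℓ < I.L, I.n 0 ≤ ℓ → ∀ r < I.k,
      M₁ 14 ((ℓ - I.n 0) * I.k + r) = e (guess e I g ℓ r) := by
    intro ℓ hℓ hℓ' r hr
    rw [post₁ (ℓ - I.n 0) (by unfold Inst.S₁; omega) r hr, Nat.sub_add_cancel hℓ']
  refine Runs.andThen (t := Prog.tm B _) (t' := Prog.tm B _)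
    (runs_foldMat (r := I.N) (s := I.R) (I.D - 1) (fun x y z => e (if y < I.n 0 then I.T y x else
      ∏ d ∈ Finset.range z, guess e I g (I.off (1 + d) + I.dig (1 + d) x) (y - I.n 0)))
      ok₁ (by decide) (by decide) (by decide) (by decide) (by decide) hNR hNR hB hBV
      (by have := hF.D; omega) (by have := hF.D; omega) ?_ ?_ ?_ ?_
      (fun _ _ _ _ _ _ => hF.code e _)) ?_ le_rfl
  · intro M' ho
    have h := hI₁.congr ho
    simp only [eval, h.eval_N hD0, h.eval_R]
  · intro M' ho
    have h := hI₁.congr ho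
    simp only [eval, h.eval_D]
  · intro x hx y hy M' ho hx' hy'
    have h := hI₁.congr ho
    simp only [eval, eval_var, eval_selLt, h.eval_R, h.eval_n₀ hD0, hx', hy', h.eval_one,
      Finset.range_zero, Finset.prod_empty]
    split_ifs with hyn
    · exact h.T y hyn x hx
    · rfl
  · intro x hx y hy z hz M' _ ho hx' hy' hz' hac
    have h := hI₁.congr ho
    simp only [eval_selLt, eval, eval_var, h.eval_R, h.eval_n₀ hD0, hy']
    split_ifs with hyn
    · rw [hac, if_pos hyn]
    · rw [Finset.prod_range_succ]
      refine h.eval_fmul (by simp [hac, hyn]) ?_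
      have hN : 0 < I.N := by omega
      have hev : (dig (add (lit 1) (var 38)) (div (var 37) R)).eval M' = I.dig (1 + z) x := by
        rw [h.eval_dig hD0 (by simp only [eval, eval_var, hz']; omega)]
        simp only [eval, eval_var, hz', h.eval_R, hx']
      simp only [eval, eval_var, hz', h.off _ (show 1 + z ≤ I.D by omega), hev, h.eval_n₀ hD0,
        h.eval_k hD0, h.eval_R, hy', ho.cell 14]
      refine hguess _ (I.off_add_dig_lt hN (by omega) x)
        ((I.n_zero_le_off (by omega)).trans (Nat.le_add_right _ _)) _ (by unfold Inst.k; omega)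
  intro M₂ ok₂ off₂ post₂
  have off₂' : M₂.EqOff [15, 37, 38, 39] M₁ := off₂.mono (by decide)
  have hI₂ : Guessed e I (guess e I g) M₂ :=
    { toReady := hI₁.congr off₂'
      guess := fun ℓ hℓ hℓ' r hr => by rw [off₂'.cell 14, hguess ℓ hℓ hℓ' r hr]
      base := fun j hj l hl => by
        rw [post₂ j hj l hl]; rfl }
  refine Runs.andThen (t := Prog.tm B _) (t' := Prog.tm B _)
    (runs_mapMat (r := I.n 0) (s := I.n 0) (fun x y => e (if x = y then (1 : F) else 0)) ok₂
      (by decide) (by decide) (by decide) hF.n0 hF.n0 hB hBV ?_ ?_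
      (fun _ _ _ _ => hF.code e _)) ?_ le_rfl
  · intro M' ho
    have h := hI₂.congr ho
    simp only [eval, h.eval_n₀ hD0]
  · intro x hx y hy M' _ ho _ hx' hy' _
    have h := hI₂.congr ho
    simp only [eval_selEq, eval, eval_var, h.eval_n₀ hD0, hx', hy', h.eval_one, h.eval_zero]
    split_ifs <;> rfl
  intro M₃ ok₃ off₃ post₃
  have off₃' : M₃.EqOff [16, 37] M₂ := off₃.mono (by decide)
  have hI₃ := hI₂.congr off₃'
  refine (runs_mapLoop (cnt := I.n 0) (fun _ => 0) ok₃
      (by decide) (by decide) (by decide) hn0 hn0 hB hBV ?_ ?_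
      (fun _ _ => by omega)).mono le_rfl ?_
  · intro M' ho
    exact (hI₃.congr ho).eval_n₀ hD0
  · intro j _ M' _ _ _ _
    rfl
  intro M₄ ok₄ off₄ post₄
  have off₄' : M₄.EqOff [17, 37] M₃ := off₄.mono (by decide)
  exact ⟨hI₃.congr off₄', ⟨fun p hp l hl => by rw [off₄'.cell 16, post₃ p hp l hl],
    fun p hp => post₄.1 p hp, fun _ _ h => absurd rfl h, fun _ _ h => absurd rfl h⟩⟩

end TensorCPD

/-! ### Digits of column indices, and candidates for the factors along the axes from 2 on. -/

namespace TensorCPD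
open TensorCPD.Expr

/-! ### Mixed radix digits -/

namespace Inst

variable {F : Type*} (I : Inst F)

theorem str_succ (d : ℕ) : I.str (d + 1) = I.str d * I.n d := Finset.prod_range_succ _ _

theorem str_zero : I.str 0 = 1 := rfl

theorem mod_str (J D : ℕ) :
    J % I.str D = ∑ d ∈ Finset.range D, J / I.str d % I.n d * I.str d := by
  induction D with
  | zero => simp [str_zero, Nat.mod_one]
  | succ D ih => rw [str_succ, Nat.mod_mul, ih, Finset.sum_range_succ, mul_comm (I.str D)]

theorem sum_mul_str_lt {a : ℕ → ℕ} {D : ℕ} (h : ∀ d < D, a d < I.n d) :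
    ∑ d ∈ Finset.range D, a d * I.str d < I.str D := by
  induction D with
  | zero => simp [str_zero]
  | succ D ih =>
    have h1 := ih fun d hd => h d (by omega)
    have h2 := h D (by omega)
    rw [Finset.sum_range_succ, str_succ, mul_comm (I.str D), add_comm]
    exact mul_add_lt_mul h2 h1

/-- The places below `d` sum to less than `str d` and disappear in the quotient; the places above
`d` contribute multiples of `n d` to it. -/
theorem sum_mul_str_div_mod {a : ℕ → ℕ} {D : ℕ} (h : ∀ d < D, a d < I.n d) {d : ℕ} (hd : d < D) :
    (∑ x ∈ Finset.range D, a x * I.str x) / I.str d % I.n d = a d := by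
  induction D, hd using Nat.le_induction with
  | base =>
    rw [Finset.sum_range_succ, add_comm, mul_add_div_right'
      (I.sum_mul_str_lt fun x hx => h x (by omega)), Nat.mod_eq_of_lt (h d (by omega))]
  | succ D hd ih =>
    have h1 := ih fun x hx => h x (by omega)
    have h0 : 0 < I.str d := Nat.pos_of_ne_zero (Finset.prod_ne_zero_iff.2 fun x hx => by
      have := h x (by simp at hx; omega); omega)
    obtain ⟨c, hc⟩ : I.str (d + 1) ∣ I.str D :=
      Finset.prod_dvd_prod_of_subset _ _ _ (by simpa using hd)
    rw [Finset.sum_range_succ, hc, str_succ, show a D * (I.str d * I.n d * c)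
      = I.n d * (a D * c) * I.str d by ring, Nat.add_mul_div_right _ _ h0, Nat.add_mul_mod_self_left,
      h1]

theorem str_dvd {d D : ℕ} (h : d ≤ D) : I.str d ∣ I.str D :=
  Finset.prod_dvd_prod_of_subset _ _ _ (by simpa using h)

theorem str_one : I.str 1 = I.n 0 := by simp [str]

theorem mul_N (hD : 0 < I.D) : I.n 0 * I.N = I.str I.D :=
  Nat.mul_div_cancel' (by rw [← str_one]; exact I.str_dvd hD)

/-- `n 0 * j` is the flat index of the entry of column `j` whose index along axis `0` is `0`; axis
`0` varies fastest. -/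
theorem dig_zero (j : ℕ) : I.dig 0 j = 0 := by simp [dig, str_zero]

theorem sum_dig {j : ℕ} (hj : j < I.N) (hD : 0 < I.D) :
    ∑ d ∈ Finset.range I.D, I.dig d j * I.str d = I.n 0 * j := by
  unfold dig
  rw [← mod_str, Nat.mod_eq_of_lt]
  rw [← I.mul_N hD]
  exact Nat.mul_lt_mul_of_pos_left hj (I.n_pos (by omega) hD)

/-- The column of the unfolding with given indices along the axes other than axis `0`. -/
theorem exists_column (hN : 0 < I.N) (hD : 0 < I.D) {a : ℕ → ℕ} (h : ∀ d < I.D, a d < I.n d)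
    (h0 : a 0 = 0) : ∃ j < I.N, I.n 0 * j = ∑ d ∈ Finset.range I.D, a d * I.str d ∧
      ∀ d < I.D, I.dig d j = a d := by
  have hn0 := I.n_pos hN hD
  have h1 := I.sum_mul_str_lt h
  -- The summand of axis `0` is zero, and all further strides are multiples of `n 0`.
  obtain ⟨j, hj⟩ : I.n 0 ∣ ∑ d ∈ Finset.range I.D, a d * I.str d := by
    refine Finset.dvd_sum fun d _ => ?_
    rcases Nat.eq_zero_or_pos d with rfl | hd
    · simp [h0]
    · exact Dvd.dvd.mul_left (by rw [← str_one]; exact I.str_dvd hd) _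
  refine ⟨j, ?_, hj.symm, fun d hd => ?_⟩
  · rw [hj, ← I.mul_N hD] at h1
    exact Nat.lt_of_mul_lt_mul_left h1
  · rw [dig, ← hj, I.sum_mul_str_div_mod h hd]

/-- The column obtained from column `j` by changing the index along the axis of `ℓ` to the one
of `ℓ`. -/
def move (ℓ j : ℕ) : ℕ :=
  (I.n 0 * j - I.dig (I.axis ℓ) j * I.str (I.axis ℓ)
    + (ℓ - I.off (I.axis ℓ)) * I.str (I.axis ℓ)) / I.n 0

/-- `move` trades the summand of axis `d` in the mixed radix expansion of `n 0 * j` for that of `i`.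
The truncated subtraction is exact, because what it removes is a summand of the expansion. -/
theorem move_spec {d i j : ℕ} (hd : d < I.D) (hd0 : 0 < d) (hi : i < I.n d) (hj : j < I.N) :
    I.move (I.off d + i) j < I.N ∧
      ∀ x < I.D, I.dig x (I.move (I.off d + i) j) = if x = d then i else I.dig x j := by
  have hN : 0 < I.N := by omega
  have hD : 0 < I.D := by omega
  obtain ⟨j', hj', h1, h2⟩ := I.exists_column hN hD (a := fun x => if x = d then i else I.dig x j)
    (fun x hx => by
      split_ifs with h
      · rw [h]; exact hi
      · exact I.dig_lt hN hx j)
    (by rw [if_neg (by omega), dig_zero])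
  have hd' : d ∈ Finset.range I.D := by simpa using hd
  have key : I.move (I.off d + i) j = j' := by
    rw [move, I.axis_eq hd hi, Nat.add_sub_cancel_left, ← I.sum_dig hj hD,
      ← Finset.add_sum_erase _ _ hd', Nat.add_sub_cancel_left]
    rw [← Finset.add_sum_erase _ _ hd', if_pos rfl, Finset.sum_congr rfl
      (g := fun x => I.dig x j * I.str x)
      (fun x hx => by rw [if_neg (Finset.ne_of_mem_erase hx)])] at h1
    rw [add_comm, ← h1, Nat.mul_div_cancel_left _ (I.n_pos hN hD)]
  rw [key]
  exact ⟨hj', h2⟩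

/-- Axis `0` is included because the program evaluates a candidate at every packed row; there the
division by `n 0` just returns `j`. -/
theorem move_lt {ℓ j : ℕ} (hℓ : ℓ < I.L) (hj : j < I.N) : I.move ℓ j < I.N := by
  obtain ⟨d, hd, i, hi, rfl⟩ := I.exists_off_add hℓ
  rcases Nat.eq_zero_or_pos d with rfl | hd0
  · have hn0 := I.n_pos (by omega) hd
    rw [move, I.axis_eq hd hi, dig_zero, str_zero]
    simp only [Nat.sub_zero, mul_one, Nat.add_sub_cancel_left]
    rwa [add_comm, Nat.add_mul_div_left _ _ hn0, Nat.div_eq_of_lt hi, zero_add]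
  · exact (I.move_spec hd hd0 hi hj).1

end Inst

/-! ### Candidates for the factors of a rank one tensor -/

variable {F : Type*} [Field F] {qq : ℕ}

/-- The candidate with number `c` for the factors along the axes from `2` on: if this is cheaper, we
enumerate these factors, and otherwise we enumerate pairs of a linear combination of the rows given
by `Inst.base` and a column, and take the fibers of the combination through this column. -/
def cand (e : F ≃ Fin qq) (I : Inst F) (u : ℕ → ℕ → F) (c ℓ : ℕ) : F :=
  if I.S₂ < I.R then if ℓ < I.off 2 then 0 else digit e c (ℓ - I.off 2)
  else ∑ l ∈ Finset.range I.R, digit e (c / I.N) l * I.base u (I.move ℓ (c % I.N)) l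

/-- The number of candidates. -/
def candCount (qq : ℕ) (I : Inst F) : ℕ := if I.S₂ < I.R then qq ^ I.S₂ else qq ^ I.R * I.N

/-- The memory contains the packed column `w` and the products of its entries. -/
structure HasCand (e : F ≃ Fin qq) (I : Inst F) (w : ℕ → F) (M : Mem) : Prop where
  entry : ∀ ℓ < I.L, M 23 ℓ = e (w ℓ)
  prod : ∀ j < I.N, M 24 j = e (I.prodFrom 2 w j)

theorem HasCand.congr {e : F ≃ Fin qq} {I : Inst F} {w : ℕ → F} {M M' : Mem}
    (h : HasCand e I w M) {l : List ℕ} (ho : M'.EqOff l M)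
    (hl : ∀ a ∈ [23, 24], a ∉ l := by decide) : HasCand e I w M' where
  entry ℓ hℓ := by rw [ho 23 (hl 23 (by simp)), h.entry ℓ hℓ]
  prod j hj := by rw [ho 24 (hl 24 (by simp)), h.prod j hj]

/-- The candidate as a list of factors. -/
def factorProg : Prog :=
  .seq (mapLoop 21 37 S₂ (mod (div (var 20) (load 12 (var 37))) q))
    (mapLoop 23 37 L
      (selLt (var 37) (load 10 (lit 2)) zero (load 21 (sub (var 37) (load 10 (lit 2))))))

/-- The candidate as fibers of a linear combination. -/
def fiberProg : Prog :=
  .seq (mapLoop 21 37 R (mod (div (div (var 20) N) (load 12 (var 37))) q))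
  (.seq (foldLoop 22 37 38 39 N R zero
      (fadd (var 39) (fmul (load 21 (var 38)) (load 15 (add (mul (var 37) R) (var 38))))))
    (mapLoop 23 37 L (load 22 (div (add (sub (mul n₀ (mod (var 20) N))
      (mul (dig (load 11 (var 37)) (mod (var 20) N)) (load 9 (load 11 (var 37)))))
      (mul (sub (var 37) (load 10 (load 11 (var 37)))) (load 9 (load 11 (var 37))))) n₀))))

/-- The program computing the candidate whose number is in array 20. -/
def candProg : Prog :=
  .seq (.cond (Expr.lt S₂ R) factorProg fiberProg)
    (foldLoop 24 37 38 39 N (sub D (lit 2)) one (fmul (var 39)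
      (load 23 (add (load 10 (add (lit 2) (var 38))) (dig (add (lit 2) (var 38)) (var 37))))))

section

variable {e : F ≃ Fin qq} {I : Inst F} {B V : ℕ} {M : Mem} {u : ℕ → ℕ → F}

theorem runs_factorProg (hM : M.Ok B V) (hI : Guessed e I u M) (hF : Fits qq I B V)
    (hD : 1 < I.D) {c : ℕ} (hc : M 20 0 = c) (hmode : I.S₂ < I.R) :
    Runs B V factorProg (factorProg.tm B) M fun M' => ∀ ℓ < I.L, M' 23 ℓ = e (cand e I u c ℓ) := by
  have hB := hF.pos
  have hBV := hF.BV
  have hLB : I.L ≤ B := by have := hF.RL; nlinarith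
  have hS₂ : I.S₂ ≤ I.L := Nat.sub_le _ _
  refine Runs.andThen (t := Prog.tm B _) (t' := Prog.tm B _)
    (runs_mapLoop (cnt := I.S₂) (fun t => e (digit e c t)) hM (by decide) (by decide) (by decide)
      (hS₂.trans hLB) (hS₂.trans hLB) hB hBV ?_ ?_ (fun _ _ => hF.code e _)) ?_ le_rfl
  · intro M' ho
    exact (hI.congr ho).eval_S₂ hD
  · intro t ht M' _ ho hv _
    have h := hI.congr ho
    simp only [eval, eval_var, h.eval_q, hv, ho.cell 20, hc, code_digit]
    rw [h.pow _ (by nlinarith)]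
  intro M₁ ok₁ off₁ post₁
  have off₁' : M₁.EqOff [21, 37] M := off₁.mono (by decide)
  have hI₁ := hI.congr off₁'
  refine (runs_mapLoop (cnt := I.L) (fun ℓ => e (cand e I u c ℓ)) ok₁ (by decide) (by decide)
    (by decide) hLB hLB hB hBV ?_ ?_ (fun _ _ => hF.code e _)).mono le_rfl
    fun M' _ _ h => h.1
  · intro M' ho
    exact (hI₁.congr ho).eval_L
  · intro ℓ hℓ M' _ ho hv _
    have h := hI₁.congr ho
    simp only [eval_selLt, eval, eval_var, hv, h.off 2 hD, h.eval_zero, ho.cell 21, cand,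
      if_pos hmode]
    split_ifs with h2
    · rfl
    · exact post₁.1 _ (by unfold Inst.S₂; omega)

/-- The number `c` splits into the coefficients, which are the base `qq` digits of `c / N`, and the
column `c % N`. -/
theorem runs_fiberProg (hM : M.Ok B V) (hI : Guessed e I u M) (hF : Fits qq I B V)
    (hD : 1 < I.D) {c : ℕ} (hc : M 20 0 = c) (hcN : c < candCount qq I) (hmode : ¬ I.S₂ < I.R) :
    Runs B V fiberProg (fiberProg.tm B) M fun M' => ∀ ℓ < I.L, M' 23 ℓ = e (cand e I u c ℓ) := by
  have hB := hF.pos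
  have hBV := hF.BV
  have hD0 : 0 < I.D := by omega
  have hLB : I.L ≤ B := by have := hF.RL; nlinarith
  have hRB : I.R ≤ B := by have := hF.RL; nlinarith
  have hNB : I.N ≤ B := by have := hF.N; nlinarith
  have hN : 0 < I.N := by
    rw [candCount, if_neg hmode] at hcN
    exact Nat.pos_of_ne_zero fun h => by simp [h] at hcN
  refine Runs.andThen (t := Prog.tm B _) (t' := Prog.tm B _)
    (runs_mapLoop (cnt := I.R) (fun t => e (digit e (c / I.N) t)) hM (by decide) (by decide)
      (by decide) hRB hRB hB hBV ?_ ?_ (fun _ _ => hF.code e _)) ?_ le_rfl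
  · intro M' ho
    exact (hI.congr ho).eval_R
  · intro t ht M' _ ho hv _
    have h := hI.congr ho
    simp only [eval, eval_var, h.eval_q, hv, ho.cell 20, hc, code_digit, h.eval_N hD0]
    rw [h.pow _ (by nlinarith)]
  intro M₁ ok₁ off₁ post₁
  have off₁' : M₁.EqOff [21, 37] M := off₁.mono (by decide)
  have hI₁ := hI.congr off₁'
  refine Runs.andThen (t := Prog.tm B _) (t' := Prog.tm B _)
    (runs_foldLoop (cnt := I.N) (fun _ => I.R)
      (fun j y => e (∑ l ∈ Finset.range y, digit e (c / I.N) l * I.base u j l)) ok₁ (by decide)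
    (by decide) (by decide) (by decide) (by decide) hNB hNB hB hBV
    (fun j hj => hRB) (fun j hj => hRB) ?_ ?_ ?_ ?_ (fun _ _ _ _ => hF.code e _)) ?_ le_rfl
  · intro M' ho
    exact (hI₁.congr ho).eval_N hD0
  · intro j _ M' ho hj
    exact (hI₁.congr ho).eval_R
  · intro j _ M' ho _
    simpa using (hI₁.congr ho).eval_zero
  · intro j hj y hy M' _ ho hij hly hac
    have h := hI₁.congr ho
    rw [Finset.sum_range_succ]
    refine h.eval_fadd hac (h.eval_fmul ?_ ?_)
    · simp only [eval, eval_var, hly, ho.cell 21, post₁.1 y hy]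
    · simp only [eval, eval_var, hly, hij, h.eval_R, h.base j hj y hy]
  intro M₂ ok₂ off₂ post₂
  have off₂' : M₂.EqOff [22, 37, 38, 39] M₁ := off₂.mono (by decide)
  have hI₂ := hI₁.congr off₂'
  have hc₂ : M₂ 20 0 = c := by rw [off₂'.cell 20, off₁'.cell 20, hc]
  refine (runs_mapLoop (cnt := I.L) (fun ℓ => e (cand e I u c ℓ)) ok₂ (by decide) (by decide)
    (by decide) hLB hLB hB hBV ?_ ?_ (fun _ _ => hF.code e _)).mono le_rfl
    fun M' _ _ h => h.1
  · intro M' ho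
    exact (hI₂.congr ho).eval_L
  · intro ℓ hℓ M' _ ho hv _
    have h := hI₂.congr ho
    obtain ⟨d, hd, i, hi, hdi⟩ := I.exists_off_add hℓ
    have hax : I.axis ℓ = d := by rw [hdi, I.axis_eq hd hi]
    have hj : (mod (var 20) N).eval M' = c % I.N := by
      simp only [eval, eval_var, ho.cell 20, hc₂, h.eval_N hD0]
    have hd' : (load 11 (var 37)).eval M' = d := by
      simp only [eval, eval_var, hv, h.axis ℓ hℓ, hax]
    have hdig := h.eval_dig hD0 (d := load 11 (var 37)) (j := mod (var 20) N) (by rw [hd']; exact hd)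
    rw [hd', hj] at hdig
    have hidx : (div (add (sub (mul n₀ (mod (var 20) N))
      (mul (dig (load 11 (var 37)) (mod (var 20) N)) (load 9 (load 11 (var 37)))))
      (mul (sub (var 37) (load 10 (load 11 (var 37)))) (load 9 (load 11 (var 37))))) n₀).eval M'
        = I.move ℓ (c % I.N) := by
      rw [Inst.move, hax]
      simp only [eval, eval_var] at hd' hj ⊢
      rw [hdig, hd', hj, hv, h.eval_n₀ hD0, h.str d hd.le, h.off d hd.le]
    rw [eval, hidx, ho.cell 22, post₂ _ (I.move_lt hℓ (Nat.mod_lt _ hN)), cand, if_neg hmode]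

theorem runs_candProg (hM : M.Ok B V) (hI : Guessed e I u M) (hF : Fits qq I B V)
    (hD : 1 < I.D) {c : ℕ} (hc : M 20 0 = c) (hcN : c < candCount qq I) :
    Runs B V candProg (candProg.tm B) M (HasCand e I (cand e I u c)) := by
  have hB := hF.pos
  have hBV := hF.BV
  have hD0 : 0 < I.D := by omega
  have hNB : I.N ≤ B := by have := hF.N; nlinarith
  have hDB := hF.D_le
  have hb : (Expr.lt S₂ R).eval M = if I.S₂ < I.R then 1 else 0 := by
    rw [eval_lt, hI.eval_S₂ hD, hI.eval_R]
  refine Runs.andThen (t := Prog.tm B (.cond _ _ _)) (t' := Prog.tm B _)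
    (Runs.cond (t := Prog.tm B _) (t' := Prog.tm B _)
      (fun h => runs_factorProg hM hI hF hD hc (by rw [hb] at h; by_contra hn; simp [hn] at h))
      (fun h => runs_fiberProg hM hI hF hD hc hcN (by rw [hb] at h; intro hn; simp [hn] at h))
      (by simp only [Prog.tm]; omega) (by simp only [Prog.tm]; omega)) ?_ le_rfl
  intro M₁ ok₁ off₁ post₁
  have off₁' : M₁.EqOff [21, 22, 23, 37, 38, 39] M := off₁.mono (by decide)
  have hI₁ := hI.congr off₁'
  refine (runs_foldLoop (cnt := I.N) (fun _ => I.D - 2)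
      (fun j y => e (∏ x ∈ Finset.range y, cand e I u c (I.off (2 + x) + I.dig (2 + x) j))) ok₁
    (by decide) (by decide) (by decide) (by decide) (by decide) hNB hNB hB hBV
    (fun j hj => by omega) (fun j hj => by omega) ?_ ?_ ?_ ?_
    (fun _ _ _ _ => hF.code e _)).mono le_rfl ?_
  · intro M' ho
    exact (hI₁.congr ho).eval_N hD0
  · intro j _ M' ho hj
    simp only [eval, (hI₁.congr ho).eval_D]
  · intro j _ M' ho _
    simpa using (hI₁.congr ho).eval_one
  · intro j hj y hy M' _ ho hij hly hac
    have h := hI₁.congr ho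
    rw [Finset.prod_range_succ]
    refine h.eval_fmul hac ?_
    have hev := h.eval_dig hD0 (d := add (lit 2) (var 38)) (j := var 37)
      (by simp only [eval, eval_var, hly]; omega)
    simp only [eval, eval_var, hly, hij] at hev
    simp only [eval, eval_var, hly, h.off _ (show 2 + y ≤ I.D by omega), hev, ho.cell 23]
    exact post₁ _ (I.off_add_dig_lt (by omega) (by omega) j)
  · intro M₂ _ off₂ post₂
    have off₂' : M₂.EqOff [24, 37, 38, 39] M₁ := off₂.mono (by decide)
    exact ⟨fun ℓ hℓ => by rw [off₂'.cell 23, post₁ ℓ hℓ], fun j hj => post₂ j hj⟩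

end

end TensorCPD

/-! ### Gaussian elimination, one equation at a time. -/

namespace TensorCPD
open TensorCPD.Expr

/-! ### Kernels of linear systems -/

section

variable {F : Type*} [Field F]

open Classical in
/-- The last index below `y` with nonzero value, or `0`. -/
noncomputable def lastNonzero (s : ℕ → F) : ℕ → ℕ
  | 0 => 0
  | y + 1 => if s y = 0 then lastNonzero s y else y

/-- The default `0` keeps the pivot a legal row index when all values vanish. -/
theorem lastNonzero_le (s : ℕ → F) (y : ℕ) : lastNonzero s y ≤ y - 1 := by
  induction y with
  | zero => rfl
  | succ y ih => rw [lastNonzero]; split_ifs <;> omega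

theorem lastNonzero_spec (s : ℕ → F) {y i : ℕ} (hi : i < y) (h : s i ≠ 0) :
    s (lastNonzero s y) ≠ 0 := by
  induction y with
  | zero => omega
  | succ y ih =>
    rw [lastNonzero]
    split_ifs with h0
    · refine ih ?_
      rcases Nat.lt_succ_iff_lt_or_eq.1 hi with h1 | rfl
      · exact h1
      · exact absurd h0 h
    · exact h0

/-- The first `m` rows of `Z` generate the solutions of the first `J` equations of the linear system
`a`. -/
structure IsKernel (m J : ℕ) (a Z : ℕ → ℕ → F) : Prop where
  sound : ∀ i < m, ∀ j < J, ∑ l ∈ Finset.range m, a j l * Z i l = 0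
  complete : ∀ z : ℕ → F, (∀ j < J, ∑ l ∈ Finset.range m, a j l * z l = 0) →
    ∃ c : ℕ → F, ∀ l < m, z l = ∑ i ∈ Finset.range m, c i * Z i l

theorem IsKernel.one (m : ℕ) (a : ℕ → ℕ → F) :
    IsKernel m 0 a fun i l => if i = l then 1 else 0 where
  sound := by simp
  complete z _ := ⟨z, fun l hl => by simp [hl]⟩

/-- From each generator one subtracts the multiple of the pivot `Z p` that makes equation `J` hold.
A genuine pivot row becomes zero and is kept, so there are always `m` generators; if all `s i`
vanish, nothing changes. A solution keeps its coefficients `c`, because evaluating equation `J` at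
it gives `∑ c i * s i = 0`. -/
theorem IsKernel.step {m J : ℕ} {a Z : ℕ → ℕ → F} (h : IsKernel m J a Z) {s : ℕ → F}
    (hs : ∀ i, s i = ∑ l ∈ Finset.range m, a J l * Z i l) {p : ℕ} (hp : 0 < m → p < m)
    (hp' : ∀ i < m, s i ≠ 0 → s p ≠ 0) :
    IsKernel m (J + 1) a fun i l => Z i l + -(s i * (Z p l * (s p)⁻¹)) where
  sound i hi j hj := by
    have hlin : ∑ l ∈ Finset.range m, a j l * (Z i l + -(s i * (Z p l * (s p)⁻¹)))
        = ∑ l ∈ Finset.range m, a j l * Z i l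
          - s i * (s p)⁻¹ * ∑ l ∈ Finset.range m, a j l * Z p l := by
      rw [Finset.mul_sum, ← Finset.sum_sub_distrib]
      exact Finset.sum_congr rfl fun l _ => by ring
    rw [hlin]
    rcases Nat.lt_succ_iff_lt_or_eq.1 hj with hj | rfl
    · rw [h.sound i hi j hj, h.sound p (hp (by omega)) j hj]; simp
    · rw [← hs, ← hs]
      by_cases h0 : s i = 0
      · simp [h0]
      · have := hp' i hi h0
        field_simp
        ring
  complete z hz := by
    obtain ⟨c, hc⟩ := h.complete z fun j hj => hz j (by omega)
    refine ⟨c, fun l hl => ?_⟩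
    have h1 : ∑ i ∈ Finset.range m, c i * s i = 0 := by
      rw [← hz J (by omega)]
      calc ∑ i ∈ Finset.range m, c i * s i
          = ∑ i ∈ Finset.range m, ∑ l ∈ Finset.range m, a J l * (c i * Z i l) := by
            refine Finset.sum_congr rfl fun i _ => ?_
            rw [hs, Finset.mul_sum]
            exact Finset.sum_congr rfl fun l _ => by ring
        _ = ∑ l ∈ Finset.range m, a J l * z l := by
            rw [Finset.sum_comm]
            refine Finset.sum_congr rfl fun l hl => ?_
            rw [hc l (by simpa using hl), Finset.mul_sum]
    -- The subtracted term is zero by `h1`; distributing it over the generators turns `Z i` into the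
    -- new ones.
    calc z l = ∑ i ∈ Finset.range m, c i * Z i l
          - (∑ i ∈ Finset.range m, c i * s i) * (Z p l * (s p)⁻¹) := by rw [h1, ← hc l hl]; ring
      _ = _ := by
        rw [Finset.sum_mul, ← Finset.sum_sub_distrib]
        exact Finset.sum_congr rfl fun i _ => by ring

end

variable {F : Type*} [Field F] {qq : ℕ}

theorem code_eq_code_iff (e : F ≃ Fin qq) {a b : F} : (e a : ℕ) = e b ↔ a = b := by
  rw [← Fin.ext_iff, e.apply_eq_iff_eq]

/-- The coefficient of the linear system of a candidate; the equation is in array 26 and the unknown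
in array 38. -/
def coefExpr : Expr :=
  selLt (var 38) R (load 15 (add (mul (var 26) R) (var 38)))
    (selEq (dig (lit 1) (var 26)) (sub (var 38) R) (load 24 (var 26)) zero)

/-- Imposing the equation whose number is in array 26. -/
def equationProg : Prog :=
  .seq (foldLoop 27 37 38 39 m m zero
    (fadd (var 39) (fmul coefExpr (load 25 (add (mul (var 37) m) (var 38))))))
  (.seq (foldLoop 28 37 38 39 (lit 1) m (lit 0)
    (selEq (load 27 (var 38)) zero (var 39) (var 38)))
  (.seq (mapLoop 29 37 m
      (fmul (load 25 (add (mul (var 28) m) (var 37))) (finv (load 27 (var 28)))))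
    (mapLoop 25 37 (mul m m) (fadd (load 25 (var 37))
      (fneg (fmul (load 27 (div (var 37) m)) (load 29 (mod (var 37) m))))))))

/-- The program solving the linear system of a candidate. -/
def kernelProg : Prog :=
  .seq (mapLoop 25 37 (mul m m) (selEq (div (var 37) m) (mod (var 37) m) one zero))
    (forLoop 26 N equationProg)

/-- Array 25 contains the generators `Z`. -/
def HasGens (e : F ≃ Fin qq) (I : Inst F) (Z : ℕ → ℕ → F) (M : Mem) : Prop :=
  ∀ i < I.m, ∀ l < I.m, M 25 (i * I.m + l) = e (Z i l)

section

variable {e : F ≃ Fin qq} {I : Inst F} {B V : ℕ} {M : Mem} {u : ℕ → ℕ → F} {w : ℕ → F}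

theorem Fits.m_le (h : Fits qq I B V) : I.m ≤ B := by have := h.m; nlinarith

theorem eval_coefExpr (hI : Guessed e I u M) (hw : HasCand e I w M) (hD : 1 < I.D) {j l : ℕ}
    (hj : j < I.N) (hjv : M 26 0 = j) (hlv : M 38 0 = l) :
    coefExpr.eval M = e (I.coef u w j l) := by
  have hdig := hI.eval_dig (d := lit 1) (j := var 26) (by omega) (by simpa [eval] using hD)
  simp only [eval, eval_var, hjv] at hdig
  simp only [coefExpr, eval_selLt, eval_selEq, eval, eval_var, hlv, hjv, hI.eval_R, hdig,
    hI.eval_zero, hw.prod j hj, Inst.coef]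
  split_ifs with h1 h2
  · exact hI.base j hj l h1
  · rfl
  · rfl

theorem runs_equationProg (hM : M.Ok B V) (hI : Guessed e I u M) (hw : HasCand e I w M)
    (hF : Fits qq I B V) (hD : 1 < I.D) {j : ℕ} (hj : j < I.N) (hjv : M 26 0 = j)
    {Z : ℕ → ℕ → F} (hZ : HasGens e I Z M) (hK : IsKernel I.m j (I.coef u w) Z) :
    Runs B V equationProg (equationProg.tm B) M fun M' =>
      ∃ Z', HasGens e I Z' M' ∧ IsKernel I.m (j + 1) (I.coef u w) Z' := by
  have hB := hF.pos
  have hBV := hF.BV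
  have hm := hF.m_le
  set s : ℕ → F := fun i => ∑ l ∈ Finset.range I.m, I.coef u w j l * Z i l with hs
  refine Runs.andThen (t := Prog.tm B _) (t' := Prog.tm B _)
    (runs_foldLoop (cnt := I.m) (fun _ => I.m)
      (fun i y => e (∑ l ∈ Finset.range y, I.coef u w j l * Z i l)) hM (by decide)
    (by decide) (by decide) (by decide) (by decide) hm hm hB hBV
    (fun _ _ => hm) (fun _ _ => hm) ?_ ?_ ?_ ?_ (fun _ _ _ _ => hF.code e _)) ?_ le_rfl
  · intro M' ho
    exact (hI.congr ho).eval_m hD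
  · intro i _ M' ho _
    exact (hI.congr ho).eval_m hD
  · intro i _ M' ho _
    simpa using (hI.congr ho).eval_zero
  · intro i hi y hy M' _ ho hiv hyv hac
    have h := hI.congr ho
    rw [Finset.sum_range_succ]
    refine h.eval_fadd hac (h.eval_fmul
      (eval_coefExpr h (hw.congr ho) hD hj (by rw [ho.cell 26, hjv]) hyv) ?_)
    simp only [eval, eval_var, hiv, hyv, h.eval_m hD, ho.cell 25, hZ i hi y hy]
  intro M₁ ok₁ off₁ post₁
  have off₁' : M₁.EqOff [27, 37, 38, 39] M := off₁.mono (by decide)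
  have hI₁ := hI.congr off₁'
  -- A fold with a single entry serves as the search for the pivot.
  refine Runs.andThen (t := Prog.tm B _) (t' := Prog.tm B _)
    (runs_foldLoop (cnt := 1) (fun _ => I.m)
      (fun _ y => lastNonzero s y) ok₁ (by decide)
    (by decide) (by decide) (by decide) (by decide) hB hB hB hBV
    (fun _ _ => hm) (fun _ _ => hm) (fun _ _ => rfl) ?_ (fun _ _ _ _ _ => rfl) ?_
    (fun _ _ y hy => by have := lastNonzero_le s y; omega)) ?_ le_rfl
  · intro i _ M' ho _
    exact (hI₁.congr ho).eval_m hD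
  · intro i hi y hy M' _ ho hiv hyv hac
    have h := hI₁.congr ho
    have hiff : (load 27 (var 38)).eval M' = zero.eval M' ↔ s y = 0 := by
      rw [h.eval_zero, ← code_eq_code_iff e]
      simp only [eval, eval_var, hyv, ho.cell 27, post₁ y hy, hs]
    rw [eval_selEq, eval_var, eval_var, hac, hyv, lastNonzero]
    by_cases hsy : s y = 0
    · rw [if_pos (hiff.2 hsy), if_pos hsy]
    · rw [if_neg (mt hiff.1 hsy), if_neg hsy]
  intro M₂ ok₂ off₂ post₂
  have off₂' : M₂.EqOff [28, 37, 38, 39] M₁ := off₂.mono (by decide)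
  have hI₂ := hI₁.congr off₂'
  have hp : M₂ 28 0 = lastNonzero s I.m := post₂ 0 (by omega)
  have hpm : 0 < I.m → lastNonzero s I.m < I.m := fun h => by
    have := lastNonzero_le s I.m; omega
  set p := lastNonzero s I.m
  have hZ₂ : HasGens e I Z M₂ := fun i hi l hl => by
    rw [off₂'.cell 25, off₁'.cell 25, hZ i hi l hl]
  have hs₂ : ∀ i < I.m, M₂ 27 i = e (s i) := fun i hi => by
    rw [off₂'.cell 27, post₁ i hi]
  -- The scaled pivot row is saved first, since the update of array 25 in place destroys it.
  refine Runs.andThen (t := Prog.tm B _) (t' := Prog.tm B _)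
    (runs_mapLoop (cnt := I.m) (fun l => e (Z p l * (s p)⁻¹)) ok₂ (by decide)
    (by decide) (by decide) hm hm hB hBV ?_ ?_ (fun _ _ => hF.code e _)) ?_ le_rfl
  · intro M' ho
    exact (hI₂.congr ho).eval_m hD
  · intro l hl M' _ ho hlv _
    have h := hI₂.congr ho
    refine h.eval_fmul ?_ (h.eval_finv ?_)
    · simp only [eval, eval_var, hlv, ho.cell 28, hp, h.eval_m hD, ho.cell 25,
        hZ₂ p (hpm (by omega)) l hl]
    · simp only [eval, eval_var, ho.cell 28, hp, ho.cell 27, hs₂ p (hpm (by omega))]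
  intro M₃ ok₃ off₃ post₃
  have off₃' : M₃.EqOff [29, 37] M₂ := off₃.mono (by decide)
  have hI₃ := hI₂.congr off₃'
  refine (runs_mapMat (r := I.m) (s := I.m)
      (fun i l => e (Z i l + -(s i * (Z p l * (s p)⁻¹)))) ok₃ (by decide)
    (by decide) (by decide) hF.m hF.m hB hBV ?_ ?_ (fun _ _ _ _ => hF.code e _)).mono le_rfl ?_
  · intro M' ho
    have h := hI₃.congr ho
    simp only [eval, h.eval_m hD]
  · intro i hi l hl M' _ ho hv hdiv hmod hself
    have h := hI₃.congr ho
    refine h.eval_fadd ?_ (h.eval_fneg (h.eval_fmul ?_ ?_))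
    · simp only [eval, eval_var, hv, hself, off₃'.cell 25, hZ₂ i hi l hl]
    · simp only [eval, eval_var, h.eval_m hD, hdiv, ho.cell 27, off₃'.cell 27, hs₂ i hi]
    · simp only [eval, eval_var, h.eval_m hD, hmod, ho.cell 29, post₃.1 l hl]
  · intro M₄ _ _ post₄
    exact ⟨_, post₄, hK.step (fun _ => rfl) hpm fun i hi h => lastNonzero_spec s hi h⟩

theorem runs_kernelProg (hM : M.Ok B V) (hI : Guessed e I u M) (hw : HasCand e I w M)
    (hF : Fits qq I B V) (hD : 1 < I.D) :
    Runs B V kernelProg (kernelProg.tm B) M fun M' =>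
      ∃ Z, HasGens e I Z M' ∧ IsKernel I.m I.N (I.coef u w) Z := by
  have hB := hF.pos
  have hBV := hF.BV
  have hNB : I.N ≤ B := by have := hF.N; nlinarith
  refine Runs.andThen (t := Prog.tm B _) (t' := Prog.tm B _)
    (runs_mapMat (r := I.m) (s := I.m) (fun x y => e (if x = y then (1 : F) else 0)) hM
      (by decide) (by decide) (by decide) hF.m hF.m hB hBV ?_ ?_
      (fun _ _ _ _ => hF.code e _)) ?_ le_rfl
  · intro M' ho
    have h := hI.congr ho
    simp only [eval, h.eval_m hD]
  · intro x hx y hy M' _ ho _ hx' hy' _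
    have h := hI.congr ho
    simp only [eval_selEq, eval, eval_var, h.eval_m hD, hx', hy', h.eval_one, h.eval_zero]
    split_ifs <;> rfl
  intro M₁ ok₁ off₁ post₁
  have off₁' : M₁.EqOff [25, 37] M := off₁.mono (by decide)
  have hI₁ := hI.congr off₁'
  have hw₁ := hw.congr off₁'
  refine runs_forLoop (t := equationProg.tm B) (cnt := I.N)
    (fun J M' => ∃ Z, HasGens e I Z M' ∧ IsKernel I.m J (I.coef u w) Z) ok₁ (by decide)
    (by decide) hB (by omega) ?_ ?_ ?_ ?_
  · intro M' ho
    exact (hI₁.congr (ho.mono (l' := [25, 26, 27, 28, 29, 37, 38, 39]) (by decide))).eval_N (by omega)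
  · intro M' ho
    exact ⟨_, fun i hi l hl => by rw [ho.cell 25, post₁ i hi l hl], IsKernel.one _ _⟩
  · intro j hj M' ok' ho hjv ⟨Z, hZ, hK⟩
    have ho' : M'.EqOff [25, 26, 27, 28, 29, 37, 38, 39] M₁ := ho.mono (by decide)
    refine (runs_equationProg ok' (hI₁.congr ho') (hw₁.congr ho') hF hD hj hjv hZ hK).mono le_rfl ?_
    rintro M₂ _ _ ⟨Z', hZ', hK'⟩ M₃ h₃
    exact ⟨Z', fun i hi l hl => by rw [h₃.cell 25, hZ' i hi l hl], hK'⟩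
  · have := Nat.mul_le_mul_right ((Expr.lt (var 26) N).cost + 1 + (equationProg.tm B + 6)) hNB
    simp only [forLoop, Prog.tm, Expr.cost, Expr.var, Nat.reduceAdd] at this ⊢
    omega

end

end TensorCPD

/-! ### Growing a basis of solution vectors by exchange. -/

namespace TensorCPD
open TensorCPD.Expr

/-! ### Exchanging a row of an invertible matrix -/

section

variable {F : Type*} [Field F]

/-- The transpose of the `n × n` matrix `K` is inverse to `V`. -/
def IsDual (n : ℕ) (K V : ℕ → ℕ → F) : Prop :=
  ∀ i < n, ∀ l < n, ∑ p ∈ Finset.range n, K p i * V p l = if i = l then 1 else 0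

theorem IsDual.one (n : ℕ) :
    IsDual n (fun p l => if p = l then (1 : F) else 0) fun p l => if p = l then 1 else 0 := by
  intro i hi l hl
  simp [hl, eq_comm]

/-- A one-sided inverse of a square matrix is two-sided. -/
theorem IsDual.comm {n : ℕ} {K V : ℕ → ℕ → F} (h : IsDual n K V) {p p' : ℕ} (hp : p < n)
    (hp' : p' < n) : ∑ l ∈ Finset.range n, K p l * V p' l = if p = p' then 1 else 0 := by
  let A : Matrix (Fin n) (Fin n) F := fun i p => K p i
  let C : Matrix (Fin n) (Fin n) F := fun p l => V p l
  have h1 : A * C = 1 := by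
    ext i l
    rw [Matrix.mul_apply, Matrix.one_apply]
    have := h i i.2 l l.2
    rw [Finset.sum_range] at this
    rw [this]
    simp [Fin.ext_iff]
  have h2 : (C * A) ⟨p', hp'⟩ ⟨p, hp⟩ = (1 : Matrix (Fin n) (Fin n) F) ⟨p', hp'⟩ ⟨p, hp⟩ := by
    rw [mul_eq_one_comm.1 h1]
  rw [Matrix.mul_apply, Matrix.one_apply] at h2
  rw [Finset.sum_range]
  simp only [Fin.mk.injEq] at h2
  rw [← if_congr (eq_comm (a := p') (b := p)) rfl rfl, ← h2]
  exact Finset.sum_congr rfl fun l _ => mul_comm _ _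

/-- The matrix `K` after row `P` of its dual has been replaced by a vector with coordinates `s`. -/
def exchange (K : ℕ → ℕ → F) (s : ℕ → F) (P p l : ℕ) : F :=
  if p = P then K P l * (s P)⁻¹ else K p l + -(s p * (K P l * (s P)⁻¹))

/-- By duality the `s p` are the coordinates of `v` in the basis of rows of `V`. As `s P ≠ 0`, row
`P` can be solved for, and eliminating it changes `K` by a rank one update. -/
theorem IsDual.exchange {n : ℕ} {K V : ℕ → ℕ → F} (h : IsDual n K V) {s v : ℕ → F}
    (hs : ∀ p < n, s p = ∑ l ∈ Finset.range n, K p l * v l) {P : ℕ} (hP : P < n) (hsP : s P ≠ 0) :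
    IsDual n (exchange K s P) (Function.update V P v) := by
  intro i hi l hl
  have hv : v l = ∑ p ∈ Finset.range n, s p * V p l := by
    calc v l = ∑ i ∈ Finset.range n, v i * if i = l then 1 else 0 := by simp [hl]
      _ = ∑ i ∈ Finset.range n, ∑ p ∈ Finset.range n, v i * (K p i * V p l) := by
        refine Finset.sum_congr rfl fun i hi => ?_
        rw [← h i (by simpa using hi) l hl, Finset.mul_sum]
      _ = _ := by
        rw [Finset.sum_comm]
        refine Finset.sum_congr rfl fun p hp => ?_
        rw [hs p (by simpa using hp), Finset.sum_mul]
        exact Finset.sum_congr rfl fun l _ => by ring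
  have hP' : P ∈ Finset.range n := by simpa using hP
  rw [← h i hi l hl, ← Finset.add_sum_erase _ _ hP', ← Finset.add_sum_erase _ _ hP']
  rw [← Finset.add_sum_erase _ _ hP'] at hv
  have h2 : ∑ p ∈ (Finset.range n).erase P,
      TensorCPD.exchange K s P p i * Function.update V P v p l
      = ∑ p ∈ (Finset.range n).erase P, K p i * V p l
        - K P i * (s P)⁻¹ * ∑ p ∈ (Finset.range n).erase P, s p * V p l := by
    rw [Finset.mul_sum, ← Finset.sum_sub_distrib]
    refine Finset.sum_congr rfl fun p hp => ?_
    have := Finset.ne_of_mem_erase hp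
    rw [TensorCPD.exchange, if_neg this, Function.update_of_ne this]
    ring
  rw [h2, TensorCPD.exchange, if_pos rfl, Function.update_self, hv]
  field_simp
  ring

/-- The unflagged rows of `K` annihilate `z`. -/
def Killed (n : ℕ) (K : ℕ → ℕ → F) (fil : ℕ → ℕ) (z : ℕ → F) : Prop :=
  ∀ p < n, fil p = 0 → ∑ l ∈ Finset.range n, K p l * z l = 0

theorem sum_exchange (n : ℕ) (K : ℕ → ℕ → F) (s z : ℕ → F) {P p : ℕ} (h : p ≠ P) :
    ∑ l ∈ Finset.range n, exchange K s P p l * z l = ∑ l ∈ Finset.range n, K p l * z l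
      - s p * (s P)⁻¹ * ∑ l ∈ Finset.range n, K P l * z l := by
  rw [Finset.mul_sum, ← Finset.sum_sub_distrib]
  refine Finset.sum_congr rfl fun l _ => ?_
  rw [exchange, if_neg h]
  ring

/-- When `K` has a dual, `Killed` means membership in the span of the flagged rows of the dual, and
this span only grows. Row `P` was unflagged, so `K P` annihilates `z` and the multiple of it that is
subtracted contributes nothing. -/
theorem Killed.exchange {n : ℕ} {K : ℕ → ℕ → F} {fil : ℕ → ℕ} {s z : ℕ → F} {P : ℕ}
    (h : Killed n K fil z) (hP : P < n) (hf : fil P = 0) :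
    Killed n (exchange K s P) (Function.update fil P 1) z := by
  intro p hp hfp
  have hne : p ≠ P := by rintro rfl; simp at hfp
  rw [Function.update_of_ne hne] at hfp
  rw [sum_exchange _ _ _ _ hne, h p hp hfp, h P hP hf]
  simp

/-- The coordinate at `p ≠ P` becomes `s p - s p / s P * s P = 0`: the vector just inserted lies in
the new span. -/
theorem Killed.of_exchange {n : ℕ} {K : ℕ → ℕ → F} {fil : ℕ → ℕ} {s z : ℕ → F} {P : ℕ}
    (hs : ∀ p < n, s p = ∑ l ∈ Finset.range n, K p l * z l) (hP : P < n) (hsP : s P ≠ 0) :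
    Killed n (TensorCPD.exchange K s P) (Function.update fil P 1) z := by
  intro p hp hfp
  have hne : p ≠ P := by rintro rfl; simp at hfp
  rw [sum_exchange _ _ _ _ hne, ← hs p hp, ← hs P hP]
  field_simp
  ring

theorem Killed.linear {n m : ℕ} {K : ℕ → ℕ → F} {fil : ℕ → ℕ} {z c : ℕ → F} {Z : ℕ → ℕ → F}
    (h : ∀ i < m, Killed n K fil (Z i)) (hz : ∀ l < n, z l = ∑ i ∈ Finset.range m, c i * Z i l) :
    Killed n K fil z := by
  intro p hp hf
  calc ∑ l ∈ Finset.range n, K p l * z l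
      = ∑ l ∈ Finset.range n, ∑ i ∈ Finset.range m, c i * (K p l * Z i l) := by
        refine Finset.sum_congr rfl fun l hl => ?_
        rw [hz l (by simpa using hl), Finset.mul_sum]
        exact Finset.sum_congr rfl fun i _ => by ring
    _ = ∑ i ∈ Finset.range m, c i * ∑ l ∈ Finset.range n, K p l * Z i l := by
        rw [Finset.sum_comm]
        exact Finset.sum_congr rfl fun i _ => (Finset.mul_sum _ _ _).symm
    _ = 0 := Finset.sum_eq_zero fun i hi => by rw [h i (by simpa using hi) p hp hf, mul_zero]

theorem Killed.neg {n : ℕ} {K : ℕ → ℕ → F} {fil : ℕ → ℕ} {z : ℕ → F}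
    (h : Killed n K fil fun l => -z l) : Killed n K fil z := by
  intro p hp hf
  have := h p hp hf
  simpa using this

open Classical in
/-- One more than the last unflagged index below `y` with nonzero value, or `0`. -/
noncomputable def pivot (s : ℕ → F) (fil : ℕ → ℕ) : ℕ → ℕ
  | 0 => 0
  | y + 1 => if s y = 0 then pivot s fil y else if fil y = 0 then y + 1 else pivot s fil y

/-- In the first case the vector with coordinates `s` is already in the span of the flagged rows; in
the second it can replace the unflagged row `p`. -/
theorem pivot_spec (s : ℕ → F) (fil : ℕ → ℕ) (y : ℕ) :
    (pivot s fil y = 0 ∧ ∀ p < y, fil p = 0 → s p = 0) ∨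
      ∃ p < y, pivot s fil y = p + 1 ∧ s p ≠ 0 ∧ fil p = 0 := by
  induction y with
  | zero => exact Or.inl ⟨rfl, by simp⟩
  | succ y ih =>
    have aux : (fil y = 0 → s y = 0) → pivot s fil (y + 1) = pivot s fil y := by
      intro h
      rw [pivot]
      split_ifs with h1 h2
      · rfl
      · exact absurd (h h2) h1
      · rfl
    by_cases h : fil y = 0 → s y = 0
    · rw [aux h]
      rcases ih with ⟨h1, h2⟩ | ⟨p, h1, h2⟩
      · refine Or.inl ⟨h1, fun p hp => ?_⟩
        rcases Nat.lt_succ_iff_lt_or_eq.1 hp with hp | rfl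
        · exact h2 p hp
        · exact h
      · exact Or.inr ⟨p, by omega, h2⟩
    · push Not at h
      exact Or.inr ⟨y, by omega, by rw [pivot, if_neg h.2, if_pos h.1], h.2, h.1⟩

theorem pivot_le (s : ℕ → F) (fil : ℕ → ℕ) (y : ℕ) : pivot s fil y ≤ y := by
  rcases pivot_spec s fil y with ⟨h, _⟩ | ⟨p, hp, h, _⟩ <;> omega

end

/-! ### Inserting a solution -/

variable {F : Type*} [Field F] {qq : ℕ}

/-- The flagged rows of the dual of `K` are solutions with coefficients `X` and factors `W`. -/
def Valid (I : Inst F) (u K : ℕ → ℕ → F) (fil : ℕ → ℕ) (X W : ℕ → ℕ → F) : Prop :=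
  (∀ p, fil p ≤ 1) ∧ ∃ V : ℕ → ℕ → F, IsDual (I.n 0) K V ∧
    ∀ p < I.n 0, fil p ≠ 0 → ∀ j < I.N, ∑ l ∈ Finset.range (I.n 0), V p l * I.T l j =
      ∑ r ∈ Finset.range I.k, X p r * I.base u j (I.n 0 + r) + I.prodFrom 1 (W p) j

/-- The packed column of the rank one tensor given by a solution `z` for the candidate `w`. -/
def solutionCol (I : Inst F) (w z : ℕ → F) (ℓ : ℕ) : F :=
  if ℓ < I.off 2 then z (I.R + (ℓ - I.n 0)) else w ℓ

theorem Inst.prodFrom_one (I : Inst F) (hD : 1 < I.D) (col : ℕ → F) (j : ℕ) :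
    I.prodFrom 1 col j = col (I.n 0 + I.dig 1 j) * I.prodFrom 2 col j := by
  rw [prodFrom, show I.D - 1 = I.D - 2 + 1 by omega, Finset.prod_range_succ', mul_comm, add_zero,
    off_one, prodFrom]
  refine congrArg _ (Finset.prod_congr rfl fun x _ => ?_)
  rw [show 1 + (x + 1) = 2 + x by omega]

/-- The rows of axis `1` come from the last `n 1` unknowns and the rows of later axes from the
candidate. The values at rows of axis `0` are meaningless, but `prodFrom 1` never reads them. -/
theorem Inst.prodFrom_solutionCol (I : Inst F) (hN : 0 < I.N) (hD : 1 < I.D) (w z : ℕ → F) (j : ℕ) :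
    I.prodFrom 1 (solutionCol I w z) j = z (I.R + I.dig 1 j) * I.prodFrom 2 w j := by
  have h1 := I.dig_lt hN hD j
  rw [I.prodFrom_one hD, solutionCol, if_pos (by rw [off_two]; omega), Nat.add_sub_cancel_left]
  refine congrArg _ (Finset.prod_congr rfl fun x _ => ?_)
  have := I.off_mono (d := 2) (d' := 2 + x) (by omega)
  rw [solutionCol, if_neg (by omega)]

/-- The three groups of unknowns are the weights of the slices, the coefficients of the guessed
tensors and the factor along axis `1`. Of the last group, equation `j` involves only the entry at
`dig 1 j`. -/
theorem Inst.sum_coef (I : Inst F) (hN : 0 < I.N) (hD : 1 < I.D) (hR : I.n 0 ≤ I.R)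
    (u : ℕ → ℕ → F) (w z : ℕ → F) (j : ℕ) :
    ∑ l ∈ Finset.range I.m, I.coef u w j l * z l = ∑ l ∈ Finset.range (I.n 0), I.T l j * z l
      + ∑ r ∈ Finset.range I.k, I.base u j (I.n 0 + r) * z (I.n 0 + r)
      + I.prodFrom 2 w j * z (I.R + I.dig 1 j) := by
  have h1 := I.dig_lt hN hD j
  rw [m, Finset.sum_range_add]
  congr 1
  · conv_lhs => rw [show I.R = I.n 0 + I.k by unfold k; omega]
    rw [Finset.sum_range_add]
    congr 1
    · refine Finset.sum_congr rfl fun l hl => ?_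
      have hl : l < I.n 0 := by simpa using hl
      rw [coef, if_pos (by omega), base, if_pos hl]
    · refine Finset.sum_congr rfl fun r hr => ?_
      have hr : r < I.k := by simpa using hr
      unfold k at hr
      rw [coef, if_pos (by omega)]
  · rw [Finset.sum_eq_single (I.dig 1 j)]
    · rw [coef, if_neg (by omega), if_pos (by omega)]
    · intro y _ hy
      rw [coef, if_neg (by omega), if_neg (by omega), zero_mul]
    · intro h
      exact absurd (Finset.mem_range.2 h1) h

/-- In the linear system all unknowns stand on one side, so the row entering the dual is `-z`, while
the coefficients and the factor along axis `1` are read off from `z` with their own sign. -/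
theorem Valid.exchange {I : Inst F} {u K X W : ℕ → ℕ → F} {fil : ℕ → ℕ}
    (h : Valid I u K fil X W) (hD : 1 < I.D) (hR : I.n 0 ≤ I.R) {w z s : ℕ → F}
    (hz : ∀ j < I.N, ∑ l ∈ Finset.range I.m, I.coef u w j l * z l = 0)
    (hs : ∀ p < I.n 0, s p = ∑ l ∈ Finset.range (I.n 0), K p l * -z l) {P : ℕ} (hP : P < I.n 0)
    (hsP : s P ≠ 0) :
    Valid I u (exchange K s P) (Function.update fil P 1)
      (Function.update X P fun r => z (I.n 0 + r)) (Function.update W P (solutionCol I w z)) := by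
  obtain ⟨h0, V, h1, h2⟩ := h
  refine ⟨fun p => ?_, _, h1.exchange hs hP hsP, fun p hp hf j hj => ?_⟩
  · by_cases hp : p = P
    · simp [hp]
    · rw [Function.update_of_ne hp]; exact h0 p
  · by_cases hpP : p = P
    · subst hpP
      have := hz j hj
      have hN : 0 < I.N := by omega
      rw [I.sum_coef hN hD hR] at this
      simp only [Function.update_self, I.prodFrom_solutionCol hN hD]
      have h3 : ∑ l ∈ Finset.range (I.n 0), -z l * I.T l j
          = -∑ l ∈ Finset.range (I.n 0), I.T l j * z l := by
        rw [← Finset.sum_neg_distrib]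
        exact Finset.sum_congr rfl fun l _ => by ring
      have h4 : ∑ r ∈ Finset.range I.k, z (I.n 0 + r) * I.base u j (I.n 0 + r)
          = ∑ r ∈ Finset.range I.k, I.base u j (I.n 0 + r) * z (I.n 0 + r) :=
        Finset.sum_congr rfl fun l _ => mul_comm _ _
      rw [h3, h4]
      linear_combination -this
    · simp only [Function.update_of_ne hpP] at hf ⊢
      exact h2 p hp hf j hj

/-- The index of the row that is exchanged. -/
def pivotExpr : Expr := sub (var 33) (lit 1)

/-- Recording the solution whose number is in array 30. -/
def exchangeProg : Prog :=
  .seq (.assign 17 pivotExpr (lit 1))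
  (.seq (mapLoop 18 37 (mul n₀ k) (selEq (div (var 37) k) pivotExpr
      (load 25 (add (mul (var 30) m) (add n₀ (mod (var 37) k)))) (load 18 (var 37))))
  (.seq (mapLoop 19 37 (mul n₀ L) (selEq (div (var 37) L) pivotExpr
      (selLt (mod (var 37) L) (load 10 (lit 2))
        (load 25 (add (mul (var 30) m) (add R (sub (mod (var 37) L) n₀))))
        (load 23 (mod (var 37) L)))
      (load 19 (var 37))))
  (.seq (mapLoop 34 37 n₀
      (fmul (load 16 (add (mul pivotExpr n₀) (var 37))) (finv (load 32 pivotExpr))))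
    (mapLoop 16 37 (mul n₀ n₀) (selEq (div (var 37) n₀) pivotExpr (load 34 (mod (var 37) n₀))
      (fadd (load 16 (var 37))
        (fneg (fmul (load 32 (div (var 37) n₀)) (load 34 (mod (var 37) n₀))))))))))

/-- Inserting the solution whose number is in array 30. -/
def insertProg : Prog :=
  .seq (mapLoop 31 37 n₀ (fneg (load 25 (add (mul (var 30) m) (var 37)))))
  (.seq (foldLoop 32 37 38 39 n₀ n₀ zero
    (fadd (var 39) (fmul (load 16 (add (mul (var 37) n₀) (var 38))) (load 31 (var 38)))))
  (.seq (foldLoop 33 37 38 39 (lit 1) n₀ (lit 0) (selEq (load 32 (var 38)) zero (var 39)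
      (selEq (load 17 (var 38)) (lit 0) (add (var 38) (lit 1)) (var 39))))
    (.cond (var 33) exchangeProg .skip)))

section

variable {e : F ≃ Fin qq} {I : Inst F} {B V : ℕ} {M : Mem} {u K X W : ℕ → ℕ → F} {w : ℕ → F}
  {fil : ℕ → ℕ} {Z : ℕ → ℕ → F}

theorem HasGens.congr {M' : Mem} (h : HasGens e I Z M) {l : List ℕ} (ho : M'.EqOff l M)
    (hl : 25 ∉ l := by decide) : HasGens e I Z M' := fun i hi y hy => by
  rw [ho 25 hl, h i hi y hy]

theorem runs_exchangeProg (hM : M.Ok B V) (hI : Guessed e I u M) (hw : HasCand e I w M)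
    (hZ : HasGens e I Z M) (hb : HasBasis e I K fil X W M) (hF : Fits qq I B V) (hD : 1 < I.D)
    (hR : I.n 0 ≤ I.R) {i P : ℕ} (hi : i < I.m) (hiv : M 30 0 = i) (hP : P < I.n 0)
    (hPv : M 33 0 = P + 1) {s : ℕ → F} (hs : ∀ p < I.n 0, M 32 p = e (s p)) :
    Runs B V exchangeProg (exchangeProg.tm B) M (HasBasis e I (exchange K s P)
      (Function.update fil P 1) (Function.update X P fun r => Z i (I.n 0 + r))
      (Function.update W P (solutionCol I w (Z i)))) := by
  have hB := hF.pos
  have hBV := hF.BV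
  have hV0 : 0 < V := by omega
  have hD0 : 0 < I.D := by omega
  have hn0 : I.n 0 ≤ B := by have := hF.n0; nlinarith
  have hnL : I.n 0 * I.L ≤ B := by have := hF.nL; nlinarith
  have hn0L : I.n 0 ≤ I.L := I.n_zero_le_off (by omega)
  have hk : I.k ≤ I.R := Nat.sub_le _ _
  have hnk : I.n 0 * I.k ≤ B := by rw [mul_comm]; exact (hF.exponent hk hn0L).2
  have hpiv : pivotExpr.eval M = P := by simp [pivotExpr, eval, hPv]
  refine Runs.seq (t := Prog.tm B (.assign _ _ _)) (t' := Prog.tm B _)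
    (Runs.assign hM (by decide) (by rw [hpiv]; omega) (by simp only [eval]; omega) ?_ le_rfl) le_rfl
  rw [hpiv]
  set M₁ := M.set 17 P ((lit 1).eval M) with hM₁
  have ok₁ : M₁.Ok B V := hM.set (by decide) (by omega) (by simp only [eval]; omega)
  have off₁ : M₁.EqOff [17] M := fun a ha => Mem.set_of_ne _ (by simpa using ha) _ _
  have hI₁ := hI.congr off₁
  have hw₁ := hw.congr off₁
  have hZ₁ := hZ.congr off₁
  have hpiv' : ∀ (M' : Mem) (l : List ℕ), M'.EqOff l M₁ → 33 ∉ l → pivotExpr.eval M' = P := by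
    intro M' l ho hl
    simp [pivotExpr, eval, ho 33 hl, off₁.cell 33, hPv]
  refine Runs.andThen (t := Prog.tm B _) (t' := Prog.tm B _)
    (runs_mapMat (r := I.n 0) (s := I.k) (fun p r => if p = P then M₁ 25 (i * I.m + (I.n 0 + r))
      else M₁ 18 (p * I.k + r)) ok₁ (by decide) (by decide) (by decide) hnk hnk hB hBV ?_ ?_
      (fun p _ r _ => by split_ifs <;> exact ok₁.lt hV0 _ _)) ?_ le_rfl
  · intro M' ho
    have h := hI₁.congr ho
    simp only [eval, h.eval_n₀ hD0, h.eval_k hD0]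
  · intro p hp r hr M' _ ho hv hdiv hmod hself
    have h := hI₁.congr ho
    simp only [eval_selEq, eval, eval_var, h.eval_k hD0, hdiv, hmod, hpiv' M' _ ho (by decide),
      h.eval_m hD, h.eval_n₀ hD0, ho.cell 30, off₁.cell 30, hiv, ho.cell 25]
    rw [hv, hself]
  intro M₂ ok₂ off₂ post₂
  have off₂' : M₂.EqOff [18, 37] M₁ := off₂.mono (by decide)
  have off₂₁ : M₂.EqOff [17, 18, 37] M := off₂'.trans off₁ (by simp) (by simp)
  have hI₂ := hI₁.congr off₂'
  refine Runs.andThen (t := Prog.tm B _) (t' := Prog.tm B _)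
    (runs_mapMat (r := I.n 0) (s := I.L) (fun p ℓ => if p = P then
      if ℓ < I.off 2 then M₂ 25 (i * I.m + (I.R + (ℓ - I.n 0))) else M₂ 23 ℓ
      else M₂ 19 (p * I.L + ℓ)) ok₂ (by decide) (by decide) (by decide) hnL hnL hB hBV ?_ ?_
      (fun p _ r _ => by split_ifs <;> exact ok₂.lt hV0 _ _)) ?_ le_rfl
  · intro M' ho
    have h := hI₂.congr ho
    simp only [eval, h.eval_n₀ hD0, h.eval_L]
  · intro p hp r hr M' _ ho hv hdiv hmod hself
    have h := hI₂.congr ho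
    simp only [eval_selEq, eval_selLt, eval, eval_var, h.eval_L, hdiv, hmod,
      hpiv' M' _ (ho.trans off₂' (l'' := [18, 19, 37]) (by simp) (by simp)) (by decide),
      h.eval_m hD, h.eval_n₀ hD0, h.eval_R, h.off 2 hD, ho.cell 30, off₂₁.cell 30, hiv,
      ho.cell 25, ho.cell 23]
    rw [hv, hself]
  intro M₃ ok₃ off₃ post₃
  have off₃' : M₃.EqOff [19, 37] M₂ := off₃.mono (by decide)
  have off₃₁ : M₃.EqOff [17, 18, 19, 37] M := off₃'.trans off₂₁ (by simp) (by simp)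
  have off₃₂ : M₃.EqOff [18, 19, 37] M₁ := off₃'.trans off₂' (by simp) (by simp)
  have hI₃ := hI₂.congr off₃'
  -- The scaled row `P` is saved before array 16 is updated in place.
  refine Runs.andThen (t := Prog.tm B _) (t' := Prog.tm B _)
    (runs_mapLoop (cnt := I.n 0) (fun l => e (K P l * (s P)⁻¹)) ok₃ (by decide)
    (by decide) (by decide) hn0 hn0 hB hBV ?_ ?_ (fun _ _ => hF.code e _)) ?_ le_rfl
  · intro M' ho
    exact (hI₃.congr ho).eval_n₀ hD0
  · intro l hl M' _ ho hlv _
    have h := hI₃.congr ho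
    have hp := hpiv' M' _ (ho.trans off₃₂ (l'' := [18, 19, 34, 37]) (by simp) (by simp)) (by decide)
    refine h.eval_fmul ?_ (h.eval_finv ?_)
    · simp only [eval, eval_var, hlv, hp, h.eval_n₀ hD0, ho.cell 16, off₃₁.cell 16, hb.rows P hP l hl]
    · simp only [eval, hp, ho.cell 32, off₃₁.cell 32, hs P hP]
  intro M₄ ok₄ off₄ post₄
  have off₄' : M₄.EqOff [34, 37] M₃ := off₄.mono (by decide)
  have off₄₁ : M₄.EqOff [17, 18, 19, 34, 37] M := off₄'.trans off₃₁ (by simp) (by simp)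
  have off₄₂ : M₄.EqOff [18, 19, 34, 37] M₁ := off₄'.trans off₃₂ (by simp) (by simp)
  have hI₄ := hI₃.congr off₄'
  refine (runs_mapMat (r := I.n 0) (s := I.n 0)
      (fun p l => e (exchange K s P p l)) ok₄ (by decide)
    (by decide) (by decide) hF.n0 hF.n0 hB hBV ?_ ?_ (fun _ _ _ _ => hF.code e _)).mono le_rfl ?_
  · intro M' ho
    have h := hI₄.congr ho
    simp only [eval, h.eval_n₀ hD0]
  · intro p hp l hl M' _ ho hv hdiv hmod hself
    have h := hI₄.congr ho
    have hp' := hpiv' M' _ (ho.trans off₄₂ (l'' := [16, 18, 19, 34, 37]) (by simp) (by simp))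
      (by decide)
    have h34 : (load 34 (mod (var 37) n₀)).eval M' = e (K P l * (s P)⁻¹) := by
      simp only [eval, eval_var, h.eval_n₀ hD0, hmod, ho.cell 34, post₄.1 l hl]
    rw [eval_selEq, hp', exchange]
    have hdv : (div (var 37) n₀).eval M' = p := by
      simp only [eval, eval_var, h.eval_n₀ hD0, hdiv]
    rw [hdv]
    split_ifs with hpP
    · exact h34
    · refine h.eval_fadd ?_ (h.eval_fneg (h.eval_fmul ?_ h34))
      · simp only [eval, eval_var, hv, hself, off₄₁.cell 16, hb.rows p hp l hl]
      · rw [eval, hdv, ho.cell 32, off₄₁.cell 32, hs p hp]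
  · intro M₅ ok₅ off₅ post₅
    have off₅' : M₅.EqOff [16, 37] M₄ := off₅.mono (by decide)
    refine ⟨post₅, fun p hp => ?_, fun p hp hf r hr => ?_, fun p hp hf ℓ hℓ hℓ' => ?_⟩
    · rw [off₅'.cell 17, off₄₂.cell 17]
      by_cases hpP : p = P
      · rw [hpP, hM₁, Mem.set_self, Function.update_self]; rfl
      · rw [hM₁, Mem.set_cell_of_ne _ _ hpP, hb.flag p hp, Function.update_of_ne hpP]
    · rw [off₅'.cell 18, off₄'.cell 18, off₃'.cell 18, post₂ p hp r hr]
      split_ifs with hpP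
      · rw [hpP, Function.update_self]
        exact hZ₁ i hi _ (by unfold Inst.m; unfold Inst.k at hr; omega)
      · rw [Function.update_of_ne hpP] at hf ⊢
        rw [off₁.cell 18, hb.coeff p hp hf r hr]
    · rw [off₅'.cell 19, off₄'.cell 19, post₃ p hp ℓ hℓ]
      split_ifs with hpP h2
      · rw [hpP, Function.update_self, solutionCol, if_pos h2, off₂'.cell 25]
        refine hZ₁ i hi _ ?_
        rw [I.off_two] at h2; unfold Inst.m; omega
      · rw [hpP, Function.update_self, solutionCol, if_neg h2, off₂'.cell 23, hw₁.entry ℓ hℓ]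
      · rw [Function.update_of_ne hpP] at hf ⊢
        rw [off₂₁.cell 19, hb.cols p hp hf ℓ hℓ hℓ']

/-- The coordinates of `-Z i` decide: a nonzero one at an unflagged row triggers an exchange there,
and otherwise `Z i` is already killed. -/
theorem runs_insertProg (hM : M.Ok B V) (hI : Guessed e I u M) (hw : HasCand e I w M)
    (hZ : HasGens e I Z M) (hb : HasBasis e I K fil X W M) (hv : Valid I u K fil X W)
    (hF : Fits qq I B V) (hD : 1 < I.D) (hR : I.n 0 ≤ I.R) {i : ℕ} (hi : i < I.m)
    (hiv : M 30 0 = i)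
    (hz : ∀ j < I.N, ∑ l ∈ Finset.range I.m, I.coef u w j l * Z i l = 0) :
    Runs B V insertProg (insertProg.tm B) M fun M' => ∃ K' fil' X' W',
      HasBasis e I K' fil' X' W' M' ∧ Valid I u K' fil' X' W' ∧ Killed (I.n 0) K' fil' (Z i) ∧
      ∀ z, Killed (I.n 0) K fil z → Killed (I.n 0) K' fil' z := by
  have hB := hF.pos
  have hBV := hF.BV
  have hD0 : 0 < I.D := by omega
  have hn0 : I.n 0 ≤ B := by have := hF.n0; nlinarith
  refine Runs.andThen (t := Prog.tm B _) (t' := Prog.tm B _)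
    (runs_mapLoop (cnt := I.n 0) (fun l => e (-Z i l)) hM (by decide)
    (by decide) (by decide) hn0 hn0 hB hBV ?_ ?_ (fun _ _ => hF.code e _)) ?_ le_rfl
  · intro M' ho
    exact (hI.congr ho).eval_n₀ hD0
  · intro l hl M' _ ho hlv _
    have h := hI.congr ho
    refine h.eval_fneg ?_
    simp only [eval, eval_var, hlv, h.eval_m hD, ho.cell 30, hiv, ho.cell 25]
    exact hZ i hi l (by unfold Inst.m; omega)
  intro M₁ ok₁ off₁ post₁
  have off₁' : M₁.EqOff [31, 37] M := off₁.mono (by decide)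
  have hI₁ := hI.congr off₁'
  have hb₁ := hb.congr off₁'
  set s : ℕ → F := fun p => ∑ l ∈ Finset.range (I.n 0), K p l * -Z i l with hs
  refine Runs.andThen (t := Prog.tm B _) (t' := Prog.tm B _)
    (runs_foldLoop (cnt := I.n 0) (fun _ => I.n 0)
      (fun p y => e (∑ l ∈ Finset.range y, K p l * -Z i l)) ok₁ (by decide)
    (by decide) (by decide) (by decide) (by decide) hn0 hn0 hB hBV
    (fun _ _ => hn0) (fun _ _ => hn0) ?_ ?_ ?_ ?_ (fun _ _ _ _ => hF.code e _)) ?_ le_rfl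
  · intro M' ho
    exact (hI₁.congr ho).eval_n₀ hD0
  · intro p _ M' ho _
    exact (hI₁.congr ho).eval_n₀ hD0
  · intro p _ M' ho _
    simpa using (hI₁.congr ho).eval_zero
  · intro p hp y hy M' _ ho hpv hyv hac
    have h := hI₁.congr ho
    rw [Finset.sum_range_succ]
    refine h.eval_fadd hac (h.eval_fmul ?_ ?_)
    · simp only [eval, eval_var, hpv, hyv, h.eval_n₀ hD0, ho.cell 16, hb₁.rows p hp y hy]
    · simp only [eval, eval_var, hyv, ho.cell 31, post₁.1 y hy]
  intro M₂ ok₂ off₂ post₂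
  have off₂' : M₂.EqOff [32, 37, 38, 39] M₁ := off₂.mono (by decide)
  have hI₂ := hI₁.congr off₂'
  have hb₂ := hb₁.congr off₂'
  refine Runs.andThen (t := Prog.tm B _) (t' := Prog.tm B (.cond _ _ _))
    (runs_foldLoop (cnt := 1) (fun _ => I.n 0)
      (fun _ y => pivot s fil y) ok₂ (by decide)
    (by decide) (by decide) (by decide) (by decide) hB hB hB hBV
    (fun _ _ => hn0) (fun _ _ => hn0) (fun _ _ => rfl) ?_ (fun _ _ _ _ _ => rfl) ?_
    (fun _ _ y hy => by have := pivot_le s fil y; omega)) ?_ le_rfl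
  · intro p _ M' ho _
    exact (hI₂.congr ho).eval_n₀ hD0
  · intro _ _ y hy M' _ ho _ hyv hac
    have h := hI₂.congr ho
    have hiff : (load 32 (var 38)).eval M' = zero.eval M' ↔ s y = 0 := by
      rw [h.eval_zero, ← code_eq_code_iff e]
      simp only [eval, eval_var, hyv, ho.cell 32, post₂ y hy, hs]
    have hfil : (load 17 (var 38)).eval M' = fil y := by
      simp only [eval, eval_var, hyv, ho.cell 17, hb₂.flag y hy]
    rw [eval_selEq, eval_selEq, eval_var, hac, hfil, pivot]
    simp only [eval, eval_var, hyv] at hiff ⊢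
    by_cases hsy : s y = 0
    · rw [if_pos (hiff.2 hsy), if_pos hsy]
    · rw [if_neg (mt hiff.1 hsy), if_neg hsy]
  intro M₃ ok₃ off₃ post₃
  have off₃' : M₃.EqOff [33, 37, 38, 39] M₂ := off₃.mono (by decide)
  have off₃₁ : M₃.EqOff [31, 32, 33, 37, 38, 39] M :=
    off₃'.trans (off₂'.trans off₁' (l'' := [31, 32, 37, 38, 39]) (by simp) (by simp))
      (by simp) (by simp)
  have hb₃ := hb₂.congr off₃'
  have hpv : (var 33).eval M₃ = pivot s fil (I.n 0) := post₃ 0 (by omega)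
  refine Runs.cond (t := exchangeProg.tm B) (t' := Prog.tm B .skip) ?_ ?_
    (by simp only [Prog.tm]; omega) (by simp only [Prog.tm]; omega)
  · intro h0
    rw [hpv] at h0
    rcases pivot_spec s fil (I.n 0) with ⟨h1, _⟩ | ⟨P, hP, h1, hsP, hfP⟩
    · exact absurd h1 h0
    · refine (runs_exchangeProg ok₃ (hI.congr off₃₁) (hw.congr off₃₁) (hZ.congr off₃₁) hb₃ hF hD hR
        hi (by rw [off₃₁.cell 30, hiv]) hP (by rw [← h1, ← hpv]; rfl) (s := s)
        fun p hp => by rw [off₃'.cell 32, post₂ p hp]).mono le_rfl ?_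
      intro M₄ _ _ h4
      have hs' : ∀ p < I.n 0, s p = ∑ l ∈ Finset.range (I.n 0), K p l * -Z i l := fun _ _ => rfl
      exact ⟨_, _, _, _, h4, hv.exchange hD hR hz hs' hP hsP,
        (Killed.of_exchange hs' hP hsP).neg, fun z hz => hz.exchange hP hfP⟩
  · intro h0
    rw [hpv] at h0
    rcases pivot_spec s fil (I.n 0) with ⟨_, h1⟩ | ⟨P, hP, h1, _⟩
    · exact Runs.skip ok₃ ⟨K, fil, X, W, hb₃, hv, Killed.neg h1, fun z hz => hz⟩ le_rfl
    · omega

end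

end TensorCPD

/-! ### Soundness and completeness of the search. -/

namespace TensorCPD

/-! ### Decompositions in packed form -/

variable {F : Type*} [Field F] {qq : ℕ}

/-- The columns of `A` are the packed factor columns of a decomposition. -/
def Inst.IsCPD (I : Inst F) (A : ℕ → ℕ → F) : Prop :=
  ∀ i < I.n 0, ∀ j < I.N,
    I.T i j = ∑ r ∈ Finset.range I.R, A i r * I.prodFrom 1 (fun ℓ => A ℓ r) j

theorem Inst.prodFrom_congr (I : Inst F) (hN : 0 < I.N) {s : ℕ} {col col' : ℕ → F}
    (h : ∀ d < I.D, s ≤ d → ∀ i < I.n d, col (I.off d + i) = col' (I.off d + i)) (j : ℕ) :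
    I.prodFrom s col j = I.prodFrom s col' j := by
  refine Finset.prod_congr rfl fun x hx => ?_
  have hx : s + x < I.D := by have := Finset.mem_range.1 hx; omega
  exact h _ hx (by omega) _ (I.dig_lt hN hx j)

theorem Inst.prodFrom_one_congr (I : Inst F) (hN : 0 < I.N) {col col' : ℕ → F}
    (h : ∀ ℓ, I.n 0 ≤ ℓ → col ℓ = col' ℓ) (j : ℕ) :
    I.prodFrom 1 col j = I.prodFrom 1 col' j :=
  I.prodFrom_congr hN (fun d _ hd i _ => h _ ((I.n_zero_le_off hd).trans (by omega))) j

theorem Inst.base_add (I : Inst F) (u : ℕ → ℕ → F) (j r : ℕ) :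
    I.base u j (I.n 0 + r) = I.prodFrom 1 (fun ℓ => u ℓ r) j := by
  rw [base, if_neg (by omega), Nat.add_sub_cancel_left]

/-- The factor matrices in packed form that are computed from a successful search. -/
def solution (I : Inst F) (u K X W : ℕ → ℕ → F) (ℓ c : ℕ) : F :=
  if ℓ < I.n 0 then
    if c < I.n 0 then K c ℓ else ∑ p ∈ Finset.range (I.n 0), K p ℓ * X p (c - I.n 0)
  else if c < I.n 0 then W c ℓ else u ℓ (c - I.n 0)

/-- By duality slice `i` of the tensor is `∑ p, K p i * (∑ l, V p l * T l)`. Substituting the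
expression of each flagged row, the product tensor of row `p` gets the weights `K p i`, and the
guessed tensor `r` gets `∑ p, K p i * X p r`. -/
theorem Valid.isCPD {I : Inst F} {u K X W : ℕ → ℕ → F} {fil : ℕ → ℕ} (h : Valid I u K fil X W)
    (hR : I.n 0 ≤ I.R) (hf : ∀ p < I.n 0, fil p ≠ 0) : I.IsCPD (solution I u K X W) := by
  obtain ⟨-, V, h1, h2⟩ := h
  intro i hi j hj
  have hN : 0 < I.N := by omega
  have e1 : I.T i j = ∑ p ∈ Finset.range (I.n 0), K p i *
      ∑ l ∈ Finset.range (I.n 0), V p l * I.T l j := by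
    calc I.T i j = ∑ l ∈ Finset.range (I.n 0), (if i = l then 1 else 0) * I.T l j := by simp [hi]
      _ = ∑ l ∈ Finset.range (I.n 0), ∑ p ∈ Finset.range (I.n 0), K p i * (V p l * I.T l j) := by
        refine Finset.sum_congr rfl fun l hl => ?_
        rw [← h1 i hi l (by simpa using hl), Finset.sum_mul]
        exact Finset.sum_congr rfl fun p _ => by ring
      _ = _ := by
        rw [Finset.sum_comm]
        exact Finset.sum_congr rfl fun p _ => (Finset.mul_sum _ _ _).symm
  rw [e1, show I.R = I.n 0 + I.k by unfold Inst.k; omega, Finset.sum_range_add]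
  have e2 : ∀ c ∈ Finset.range (I.n 0), solution I u K X W i c *
      I.prodFrom 1 (fun ℓ => solution I u K X W ℓ c) j = K c i * I.prodFrom 1 (W c) j := by
    intro c hc
    have hc : c < I.n 0 := by simpa using hc
    rw [solution, if_pos hi, if_pos hc, I.prodFrom_one_congr hN (col' := W c)]
    intro ℓ hℓ
    rw [solution, if_neg (by omega), if_pos hc]
  have e3 : ∀ r ∈ Finset.range I.k, solution I u K X W i (I.n 0 + r) *
      I.prodFrom 1 (fun ℓ => solution I u K X W ℓ (I.n 0 + r)) j
      = ∑ p ∈ Finset.range (I.n 0), K p i * (X p r * I.base u j (I.n 0 + r)) := by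
    intro r _
    rw [solution, if_pos hi, if_neg (by omega), Nat.add_sub_cancel_left, I.base_add,
      I.prodFrom_one_congr hN (col' := fun ℓ => u ℓ r), Finset.sum_mul]
    · exact Finset.sum_congr rfl fun p _ => by ring
    · intro ℓ hℓ
      rw [solution, if_neg (by omega), if_neg (by omega), Nat.add_sub_cancel_left]
  rw [Finset.sum_congr rfl e2, Finset.sum_congr rfl e3, Finset.sum_comm, ← Finset.sum_add_distrib]
  refine Finset.sum_congr rfl fun p hp => ?_
  have hp : p < I.n 0 := by simpa using hp
  rw [h2 p hp (hf p hp) j hj, mul_add, Finset.mul_sum, add_comm]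

/-! ### Encoding -/

theorem exists_digits (e : F ≃ Fin qq) (f : ℕ → F) (len : ℕ) :
    ∃ g < qq ^ len, ∀ t < len, digit e g t = f t := by
  -- With the constant shape `qq`, base `qq` expansions become a case of the mixed radix lemmas.
  let J : Inst F := ⟨0, 0, fun _ => qq, fun _ _ => 0⟩
  have hstr : ∀ d, J.str d = qq ^ d := fun d => by simp [J, Inst.str]
  have h : ∀ d < len, (e (f d) : ℕ) < J.n d := fun d _ => (e (f d)).2
  refine ⟨∑ d ∈ Finset.range len, (e (f d) : ℕ) * J.str d, ?_, fun t ht => ?_⟩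
  · rw [← hstr]
    exact J.sum_mul_str_lt h
  · apply e.injective
    apply Fin.ext
    rw [code_digit, ← hstr]
    exact J.sum_mul_str_div_mod h ht

theorem exists_guess (e : F ≃ Fin qq) (I : Inst F) (u : ℕ → ℕ → F) :
    ∃ g < qq ^ (I.k * I.S₁), ∀ ℓ < I.L, I.n 0 ≤ ℓ → ∀ r < I.k, guess e I g ℓ r = u ℓ r := by
  obtain ⟨g, hg, h⟩ := exists_digits e (fun t => u (t / I.k + I.n 0) (t % I.k)) (I.k * I.S₁)
  refine ⟨g, hg, fun ℓ hℓ hℓ' r hr => ?_⟩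
  rw [guess, h, mul_add_div_right' hr, mul_add_mod_right' hr, Nat.sub_add_cancel hℓ']
  rw [mul_comm I.k]
  exact mul_add_lt_mul (by unfold Inst.S₁; omega) hr

/-! ### Completeness of the search -/

theorem Inst.prodFrom_mul (I : Inst F) (hN : 0 < I.N) {s : ℕ} {col col' : ℕ → F} {β : ℕ → F}
    (h : ∀ d < I.D, s ≤ d → ∀ i < I.n d, col' (I.off d + i) = β d * col (I.off d + i)) (j : ℕ) :
    I.prodFrom s col' j = (∏ x ∈ Finset.range (I.D - s), β (s + x)) * I.prodFrom s col j := by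
  rw [prodFrom, prodFrom, ← Finset.prod_mul_distrib]
  refine Finset.prod_congr rfl fun x hx => ?_
  have hx : s + x < I.D := by have := Finset.mem_range.1 hx; omega
  exact h _ hx (by omega) _ (I.dig_lt hN hx j)

/-- Every rank one tensor in the affine space given by `v` has, up to scaling, the factors of a
candidate. -/
theorem exists_candidate (e : F ≃ Fin qq) (I : Inst F) (u : ℕ → ℕ → F) (hN : 0 < I.N)
    (hD : 1 < I.D) (hR : I.n 0 ≤ I.R) {v x col : ℕ → F}
    (h : ∀ j < I.N, ∑ l ∈ Finset.range (I.n 0), v l * I.T l j =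
      ∑ r ∈ Finset.range I.k, x r * I.base u j (I.n 0 + r) + I.prodFrom 1 col j) :
    ∃ c < candCount qq I, ∃ y : ℕ → F, ∀ j < I.N,
      I.prodFrom 2 (cand e I u c) j * y (I.dig 1 j) = I.prodFrom 1 col j := by
  by_cases hmode : I.S₂ < I.R
  -- First mode: the digits of `c` spell out the factors themselves, and no scaling is needed.
  · obtain ⟨c, hc, hd⟩ := exists_digits e (fun t => col (I.off 2 + t)) I.S₂
    refine ⟨c, by rwa [candCount, if_pos hmode], fun i => col (I.n 0 + i), fun j _ => ?_⟩
    rw [I.prodFrom_one hD, mul_comm]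
    refine congrArg _ (I.prodFrom_congr hN (fun d hd1 hd2 i hi => ?_) j)
    have h1 := I.off_mono hd2
    have h2 := I.off_add_lt_L hd1 hi
    rw [cand, if_pos hmode, if_neg (by omega), hd _ (by unfold Inst.S₂; omega)]
    congr 1; omega
  -- Second mode: with these coefficients the combination of slices and guessed tensors is the
  -- product tensor itself.
  · set a : ℕ → F := fun l => if l < I.n 0 then v l else -x (l - I.n 0) with ha
    obtain ⟨c, hc, hd⟩ := exists_digits e a I.R
    have key : ∀ j < I.N, ∑ l ∈ Finset.range I.R, digit e c l * I.base u j l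
        = I.prodFrom 1 col j := by
      intro j hj
      have hP : I.prodFrom 1 col j = ∑ l ∈ Finset.range (I.n 0), v l * I.T l j
          - ∑ r ∈ Finset.range I.k, x r * I.base u j (I.n 0 + r) := by
        rw [h j hj]; ring
      rw [hP, show I.R = I.n 0 + I.k by unfold Inst.k; omega, Finset.sum_range_add,
        sub_eq_add_neg, ← Finset.sum_neg_distrib]
      congr 1
      · refine Finset.sum_congr rfl fun l hl => ?_
        have hl : l < I.n 0 := by simpa using hl
        rw [hd l (by omega), ha, Inst.base, if_pos hl]
        simp only [if_pos hl]
      · refine Finset.sum_congr rfl fun r hr => ?_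
        have hr : r < I.k := by simpa using hr
        unfold Inst.k at hr
        rw [hd _ (by omega), ha]
        simp only [if_neg (show ¬ I.n 0 + r < I.n 0 by omega), Nat.add_sub_cancel_left]
        ring
    have hcand : ∀ j < I.N, ∃ c' < candCount qq I, ∀ ℓ < I.L,
        cand e I u c' ℓ = I.prodFrom 1 col (I.move ℓ j) := by
      intro j hj
      refine ⟨c * I.N + j, ?_, fun ℓ hℓ => ?_⟩
      · rw [candCount, if_neg hmode]
        exact mul_add_lt_mul hc hj
      · rw [cand, if_neg hmode, mul_add_div_right' hj, mul_add_mod_right' hj,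
          key _ (I.move_lt hℓ hj)]
    -- If the product tensor is zero, any candidate works with the zero factor along axis `1`;
    -- otherwise there is a nonzero entry to take fibers through.
    by_cases hz : ∀ j < I.N, I.prodFrom 1 col j = 0
    · obtain ⟨c', hc', -⟩ := hcand 0 hN
      exact ⟨c', hc', 0, fun j hj => by simp [hz j hj]⟩
    · push Not at hz
      obtain ⟨j₀, hj₀, hne⟩ := hz
      obtain ⟨c', hc', hw⟩ := hcand j₀ hj₀
      -- The fiber along axis `d` through `j₀` is the factor of that axis times the other factors at
      -- `j₀`; this scalar is the whole entry divided by its factor along axis `d`.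
      set β : ℕ → F := fun d => I.prodFrom 1 col j₀ * (col (I.off d + I.dig d j₀))⁻¹ with hβ
      have hfac : ∀ d < I.D, 1 ≤ d → col (I.off d + I.dig d j₀) ≠ 0 := by
        intro d hd hd1
        have := Finset.prod_ne_zero_iff.1 hne (d - 1) (by simp; omega)
        rwa [show 1 + (d - 1) = d by omega] at this
      have hscale : ∀ d < I.D, 2 ≤ d → ∀ i < I.n d,
          cand e I u c' (I.off d + i) = β d * col (I.off d + i) := by
        intro d hd hd2 i hi
        rw [hw _ (I.off_add_lt_L hd hi)]
        obtain ⟨-, hm⟩ := I.move_spec hd (by omega) hi hj₀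
        have hmem : d - 1 ∈ Finset.range (I.D - 1) := by simp; omega
        have hd' : 1 + (d - 1) = d := by omega
        rw [hβ]
        simp only
        rw [Inst.prodFrom, Inst.prodFrom, ← Finset.mul_prod_erase _ _ hmem,
          ← Finset.mul_prod_erase _ _ hmem, hd', hm d hd, if_pos rfl]
        have hrest : ∏ y ∈ (Finset.range (I.D - 1)).erase (d - 1),
            col (I.off (1 + y) + I.dig (1 + y) (I.move (I.off d + i) j₀))
            = ∏ y ∈ (Finset.range (I.D - 1)).erase (d - 1),
              col (I.off (1 + y) + I.dig (1 + y) j₀) := by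
          refine Finset.prod_congr rfl fun y hy => ?_
          obtain ⟨hy1, hy2⟩ := Finset.mem_erase.1 hy
          have hy2 := Finset.mem_range.1 hy2
          rw [hm (1 + y) (by omega), if_neg (by omega)]
        rw [hrest]
        have := hfac d hd (by omega)
        field_simp
      have hβ0 : ∏ y ∈ Finset.range (I.D - 2), β (2 + y) ≠ 0 := by
        refine Finset.prod_ne_zero_iff.2 fun y hy => ?_
        have hy := Finset.mem_range.1 hy
        exact mul_ne_zero hne (inv_ne_zero (hfac _ (by omega) (by omega)))
      -- The unknown factor along axis `1` absorbs the scalars of all the later axes.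
      refine ⟨c', hc', fun i => (∏ y ∈ Finset.range (I.D - 2), β (2 + y))⁻¹ * col (I.n 0 + i),
        fun j _ => ?_⟩
      rw [I.prodFrom_mul hN hscale, I.prodFrom_one hD]
      field_simp

/-- The solution is assembled from `-v`, `x` and the factor `y` along axis `1` supplied by
`exists_candidate`. -/
theorem exists_solution (e : F ≃ Fin qq) (I : Inst F) (u : ℕ → ℕ → F) (hN : 0 < I.N)
    (hD : 1 < I.D) (hR : I.n 0 ≤ I.R) {v x col : ℕ → F}
    (h : ∀ j < I.N, ∑ l ∈ Finset.range (I.n 0), v l * I.T l j =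
      ∑ r ∈ Finset.range I.k, x r * I.base u j (I.n 0 + r) + I.prodFrom 1 col j) :
    ∃ c < candCount qq I, ∃ z : ℕ → F, (∀ l < I.n 0, z l = -v l) ∧
      ∀ j < I.N, ∑ l ∈ Finset.range I.m, I.coef u (cand e I u c) j l * z l = 0 := by
  obtain ⟨c, hc, y, hy⟩ := exists_candidate e I u hN hD hR h
  refine ⟨c, hc, fun l => if l < I.n 0 then -v l else if l < I.R then x (l - I.n 0)
    else y (l - I.R), fun l hl => if_pos hl, fun j hj => ?_⟩
  rw [I.sum_coef hN hD hR]
  have e1 : ∀ l ∈ Finset.range (I.n 0), I.T l j * (if l < I.n 0 then -v l else if l < I.R then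
      x (l - I.n 0) else y (l - I.R)) = -(v l * I.T l j) := by
    intro l hl
    rw [if_pos (by simpa using hl)]; ring
  have e2 : ∀ r ∈ Finset.range I.k, I.base u j (I.n 0 + r) * (if I.n 0 + r < I.n 0 then
      -v (I.n 0 + r) else if I.n 0 + r < I.R then x (I.n 0 + r - I.n 0) else y (I.n 0 + r - I.R))
      = x r * I.base u j (I.n 0 + r) := by
    intro r hr
    have hr : r < I.k := by simpa using hr
    unfold Inst.k at hr
    rw [if_neg (by omega), if_pos (by omega), Nat.add_sub_cancel_left, mul_comm]
  rw [Finset.sum_congr rfl e1, Finset.sum_congr rfl e2, if_neg (by omega), if_neg (by omega),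
    Nat.add_sub_cancel_left, hy j hj, Finset.sum_neg_distrib, h j hj]
  ring

/-- The search for the guess `u` succeeds, whatever choices are made. -/
def Succeeds (e : F ≃ Fin qq) (I : Inst F) (u : ℕ → ℕ → F) : Prop :=
  ∀ (K : ℕ → ℕ → F) (fil : ℕ → ℕ) (X W : ℕ → ℕ → F), Valid I u K fil X W →
    (∀ c < candCount qq I, ∀ z : ℕ → F,
      (∀ j < I.N, ∑ l ∈ Finset.range I.m, I.coef u (cand e I u c) j l * z l = 0) →
      Killed (I.n 0) K fil z) → ∀ p < I.n 0, fil p ≠ 0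

/-- A matrix with linearly independent rows has an invertible submatrix. -/
theorem exists_columns {n R : ℕ} (A : Matrix (Fin n) (Fin R) F)
    (hA : LinearIndependent F A.row) :
    ∃ f : Fin n → Fin R, Function.Injective f ∧ ∃ V : Matrix (Fin n) (Fin n) F,
      V * A.submatrix id f = 1 := by
  -- Select columns that form a basis of the column space; there are `n` of them because the row
  -- rank is `n`.
  obtain ⟨κ, a, ha, hspan, hli⟩ := exists_linearIndependent' F A.col
  have hfin : Finite κ := Finite.of_injective a ha
  have := Fintype.ofFinite κ
  have hrank : A.rank = n := by simpa using hA.rank_matrix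
  have hcard : Fintype.card κ = n := by
    rw [← hrank, Matrix.rank_eq_finrank_span_cols, ← hspan,
      finrank_span_eq_card hli]
  let ε : Fin n ≃ κ := (Fintype.equivFinOfCardEq hcard).symm
  refine ⟨a ∘ ε, ha.comp ε.injective, ?_⟩
  have hunit : IsUnit (A.submatrix id (a ∘ ε)) := by
    rw [← Matrix.linearIndependent_cols_iff_isUnit]
    exact hli.comp ε ε.injective
  obtain ⟨V, hV⟩ := hunit.exists_left_inv
  exact ⟨V, hV⟩

/-- The right guess consists of the columns outside an invertible submatrix of the first factor.
Every row of the inverse `V` then occurs, up to sign, in a solution for some candidate and is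
killed. If row `p` were unflagged, `K p` would be orthogonal to all rows of `V`, hence zero,
contrary to duality. -/
theorem exists_succeeds (e : F ≃ Fin qq) (I : Inst F) (hD : 1 < I.D) (hR : I.n 0 ≤ I.R)
    (hN : 0 < I.n 0 → 0 < I.N) {A : ℕ → ℕ → F} (hA : I.IsCPD A)
    (hrows : LinearIndependent F (fun (i : Fin (I.n 0)) (r : Fin I.R) => A i r)) :
    ∃ g < qq ^ (I.k * I.S₁), Succeeds e I (guess e I g) := by
  obtain ⟨f, hf, V, hV⟩ := exists_columns (Matrix.of fun (i : Fin (I.n 0)) (r : Fin I.R) => A i r)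
    hrows
  have hcompl : Fintype.card {r : Fin I.R // r ∉ Set.range f} = I.k := by
    classical
    rw [Fintype.card_subtype_compl, Fintype.card_fin]
    have : Fintype.card {r // r ∈ Set.range f} = I.n 0 := by
      rw [show Fintype.card {r // r ∈ Set.range f} = Fintype.card (Set.range f) from rfl,
        Set.card_range_of_injective hf, Fintype.card_fin]
    rw [this, Inst.k]
  -- `η` numbers the columns outside the submatrix, whose factors along the axes `d ≠ 0` are
  -- guessed.
  let η : Fin I.k ≃ {r : Fin I.R // r ∉ Set.range f} :=
    (Fintype.equivFinOfCardEq hcompl).symm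
  obtain ⟨g, hg, hu⟩ := exists_guess e I fun ℓ r => if h : r < I.k then A ℓ (η ⟨r, h⟩).1 else 0
  refine ⟨g, hg, fun K fil X W hval hkill p hp hfp => ?_⟩
  have hN := hN (by omega)
  set u := guess e I g
  -- the row combinations given by the inverse of the submatrix are found
  have hfound : ∀ p' : Fin (I.n 0), ∑ l : Fin (I.n 0), K p l * V p' l = 0 := by
    intro p'
    let v : ℕ → F := fun l => if h : l < I.n 0 then V p' ⟨l, h⟩ else 0
    let x : ℕ → F := fun r => if h : r < I.k then
      ∑ l : Fin (I.n 0), V p' l * A l (η ⟨r, h⟩).1 else 0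
    have hcomb : ∀ j < I.N, ∑ l ∈ Finset.range (I.n 0), v l * I.T l j =
        ∑ r ∈ Finset.range I.k, x r * I.base u j (I.n 0 + r)
          + I.prodFrom 1 (fun ℓ => A ℓ (f p')) j := by
      intro j hj
      have e1 : ∑ l ∈ Finset.range (I.n 0), v l * I.T l j = ∑ r : Fin I.R,
          (∑ l : Fin (I.n 0), V p' l * A l r) * I.prodFrom 1 (fun ℓ => A ℓ r) j := by
        rw [Finset.sum_range]
        simp_rw [Finset.sum_mul]
        rw [Finset.sum_comm]
        refine Finset.sum_congr rfl fun l _ => ?_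
        rw [hA l l.2 j hj, Finset.sum_range, Finset.mul_sum]
        refine Finset.sum_congr rfl fun r _ => ?_
        simp only [v, dif_pos l.2]
        ring
      -- Row `p'` of the inverse turns the selected columns into a unit vector, so just one selected
      -- rank one term survives.
      have e2 : ∀ p'' : Fin (I.n 0), ∑ l : Fin (I.n 0), V p' l * A l (f p'')
          = if p' = p'' then 1 else 0 := by
        intro p''
        have := congrFun (congrFun hV p') p''
        rwa [Matrix.mul_apply, Matrix.one_apply] at this
      classical
      rw [e1, ← Fintype.sum_subtype_add_sum_subtype (fun r : Fin I.R => r ∈ Set.range f), add_comm]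
      congr 1
      · rw [Finset.sum_range, ← Equiv.sum_comp η]
        refine Finset.sum_congr rfl fun r _ => ?_
        simp only [x, dif_pos r.2, I.base_add]
        refine congrArg _ (I.prodFrom_congr hN (fun d hd hd1 i hi => ?_) j)
        rw [hu _ (I.off_add_lt_L hd hi) ((I.n_zero_le_off hd1).trans (by omega)) _ r.2,
          dif_pos r.2]
      · let ζ : Fin (I.n 0) ≃ {r : Fin I.R // r ∈ Set.range f} := Equiv.ofInjective f hf
        refine (Finset.sum_equiv (s := Finset.univ) (f := fun p'' =>
          (∑ l : Fin (I.n 0), V p' l * A l (f p'')) * I.prodFrom 1 (fun ℓ => A ℓ (f p'')) j) ζ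
          (by simp) fun _ _ => ?_).symm.trans ?_
        · rfl
        rw [Finset.sum_eq_single p']
        · simp [e2]
        · intro p'' _ hne
          simp [e2, Ne.symm hne]
        · simp
    obtain ⟨c, hc, z, hz, hsol⟩ := exists_solution e I u hN hD hR hcomb
    have h1 := hkill c hc z hsol p hp hfp
    rw [Finset.sum_range] at h1
    rw [← neg_eq_zero, ← Finset.sum_neg_distrib, ← h1]
    refine Finset.sum_congr rfl fun l _ => ?_
    rw [hz l l.2]
    simp only [v, dif_pos l.2]
    ring
  have hK : ∀ l : Fin (I.n 0), K p l = 0 := by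
    have h1 : V.mulVec (fun l => K p l) = 0 := by
      ext p'
      change ∑ l : Fin (I.n 0), V p' l * K p l = 0
      rw [← hfound p']
      exact Finset.sum_congr rfl fun l _ => mul_comm _ _
    have h2 := congrArg (Matrix.mulVec
      ((Matrix.of fun (i : Fin (I.n 0)) (r : Fin I.R) => A i r).submatrix id f)) h1
    rw [Matrix.mulVec_mulVec, mul_eq_one_comm.1 hV, Matrix.one_mulVec, Matrix.mulVec_zero] at h2
    exact fun l => congrFun h2 l
  obtain ⟨-, V', hdual, -⟩ := hval
  have := hdual.comm hp hp
  rw [Finset.sum_range, if_pos rfl] at this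
  simp [hK] at this

end TensorCPD

/-! ### The loops over candidates and guesses, and the total running time. -/

namespace TensorCPD
open TensorCPD.Expr

/-! ### Processing a candidate -/

variable {F : Type*} [Field F] {qq : ℕ}

/-- Computing the candidate whose number is in array 20 and inserting its solutions. -/
def tryProg : Prog := .seq candProg (.seq kernelProg (forLoop 30 m insertProg))

/-- The time of a loop that makes `cnt` iterations. -/
theorem forLoop_time {cnt Q Q' B t : ℕ} {i : ℕ} {N : Expr} {p : Prog} (hcnt : cnt ≤ B * Q)
    (hQ : 0 < Q) (ht : t ≤ Q' * p.tm B) (hQ' : 0 < Q') :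
    3 + (Expr.lt (var i) N).cost + 1 + cnt * ((Expr.lt (var i) N).cost + 1 + (t + 6)) ≤
      Q * Q' * (forLoop i N p).tm B := by
  -- `Q` is the factor by which the number of iterations may exceed `B`, and `Q'` the factor by
  -- which the time of the body may exceed `p.tm B`.
  simp only [forLoop, Prog.tm, Expr.cost, Expr.var, Nat.reduceAdd]
  set c := ((load i (lit 0)).lt N).cost
  have h1 : cnt * (c + 1 + (t + 6)) ≤ B * Q * (Q' * (c + 1 + (p.tm B + 6))) := by
    refine Nat.mul_le_mul hcnt ?_
    have : c + 1 + 6 ≤ Q' * (c + 1 + 6) := Nat.le_mul_of_pos_left _ hQ'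
    nlinarith
  have h2 : 3 + c + 1 ≤ Q * Q' * (3 + c + 1) := Nat.le_mul_of_pos_left _ (Nat.mul_pos hQ hQ')
  calc _ ≤ Q * Q' * (3 + c + 1) + B * Q * (Q' * (c + 1 + (p.tm B + 6))) := Nat.add_le_add h2 h1
    _ = _ := by ring

section

variable {e : F ≃ Fin qq} {I : Inst F} {B V : ℕ} {M : Mem} {u K X W : ℕ → ℕ → F} {fil : ℕ → ℕ}

/-- Inserting the generators is enough: `Killed` is a linear condition, so all their combinations,
which are all solutions for the candidate, are killed as well. -/
theorem runs_tryProg (hM : M.Ok B V) (hI : Guessed e I u M) (hb : HasBasis e I K fil X W M)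
    (hv : Valid I u K fil X W) (hF : Fits qq I B V) (hD : 1 < I.D) (hR : I.n 0 ≤ I.R) {c : ℕ}
    (hc : c < candCount qq I) (hcv : M 20 0 = c) :
    Runs B V tryProg (tryProg.tm B) M fun M' => ∃ K' fil' X' W',
      HasBasis e I K' fil' X' W' M' ∧ Valid I u K' fil' X' W' ∧
      (∀ z : ℕ → F,
        (∀ j < I.N, ∑ l ∈ Finset.range I.m, I.coef u (cand e I u c) j l * z l = 0) →
        Killed (I.n 0) K' fil' z) ∧
      ∀ z, Killed (I.n 0) K fil z → Killed (I.n 0) K' fil' z := by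
  have hB := hF.pos
  have hBV := hF.BV
  have hm := hF.m_le
  refine Runs.andThen (t := Prog.tm B _) (t' := Prog.tm B _)
    (runs_candProg hM hI hF hD hcv hc) ?_ le_rfl
  intro M₁ ok₁ off₁ hw₁
  have off₁' : M₁.EqOff [21, 22, 23, 24, 37, 38, 39] M := off₁.mono (by decide)
  have hI₁ := hI.congr off₁'
  have hb₁ := hb.congr off₁'
  refine Runs.andThen (t := Prog.tm B _) (t' := Prog.tm B _)
    (runs_kernelProg ok₁ hI₁ hw₁ hF hD) ?_ le_rfl
  rintro M₂ ok₂ off₂ ⟨Z, hZ₂, hker⟩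
  have off₂' : M₂.EqOff [25, 26, 27, 28, 29, 37, 38, 39] M₁ := off₂.mono (by decide)
  have hI₂ := hI₁.congr off₂'
  have hw₂ := hw₁.congr off₂'
  have hb₂ := hb₁.congr off₂'
  refine (runs_forLoop (t := insertProg.tm B) (T := Prog.tm B _) (cnt := I.m)
    (fun i M' => ∃ K' fil' X' W',
      HasBasis e I K' fil' X' W' M' ∧ Valid I u K' fil' X' W' ∧
      (∀ i' < i, Killed (I.n 0) K' fil' (Z i')) ∧
      ∀ z, Killed (I.n 0) K fil z → Killed (I.n 0) K' fil' z) ok₂ (by decide)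
    (by decide) hB (by omega) ?_ ?_ ?_ ?_).mono le_rfl ?_
  · intro M' ho
    exact (hI₂.congr (ho.mono (l' := [16, 17, 18, 19, 30, 31, 32, 33, 34, 37, 38, 39])
      (by decide))).eval_m hD
  · intro M' ho
    exact ⟨K, fil, X, W, hb₂.congr ho, hv, fun _ h => absurd h (by omega), fun _ h => h⟩
  · rintro i hi M' ok' ho hiv ⟨K', fil', X', W', hb', hv', hk', hmono⟩
    have ho' : M'.EqOff [16, 17, 18, 19, 30, 31, 32, 33, 34, 37, 38, 39] M₂ := ho.mono (by decide)
    refine (runs_insertProg ok' (hI₂.congr ho') (hw₂.congr ho') (hZ₂.congr ho') hb' hv' hF hD hR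
      hi hiv (hker.sound i hi)).mono le_rfl ?_
    rintro M₃ _ _ ⟨K'', fil'', X'', W'', hb'', hv'', hk'', hmono''⟩ M₄ h₄
    refine ⟨K'', fil'', X'', W'', hb''.congr h₄, hv'', fun i' hi' => ?_,
      fun z hz => hmono'' z (hmono z hz)⟩
    rcases Nat.lt_succ_iff_lt_or_eq.1 hi' with h | rfl
    · exact hmono'' _ (hk' i' h)
    · exact hk''
  · simpa using forLoop_time (i := 30) (N := m) (p := insertProg) (cnt := I.m) (Q := 1) (Q' := 1)
      (B := B) (by omega) one_pos (by simp) one_pos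
  · rintro M₃ _ _ ⟨K', fil', X', W', hb', hv', hk', hmono⟩
    refine ⟨K', fil', X', W', hb', hv', fun z hz => ?_, hmono⟩
    obtain ⟨a, ha⟩ := hker.complete z hz
    exact Killed.linear hk' fun l hl => ha l (by unfold Inst.m; omega)

/-! ### Processing a guess -/

/-- The number of candidates. -/
def candCountExpr : Expr := selLt S₂ R (load 12 S₂) (mul (load 12 R) N)

/-- Processing all candidates. -/
def searchProg : Prog := forLoop 20 candCountExpr tryProg

theorem eval_candCountExpr (hI : Ready e I M) (hD : 1 < I.D) :
    candCountExpr.eval M = candCount qq I := by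
  have h1 : I.S₂ < (I.R + 1) * (I.L + 1) := by
    have : I.S₂ ≤ I.L := Nat.sub_le _ _
    nlinarith
  have h2 : I.R < (I.R + 1) * (I.L + 1) := by nlinarith
  simp only [candCountExpr, eval_selLt, eval, hI.eval_S₂ hD, hI.eval_R, hI.pow _ h1, hI.pow _ h2,
    hI.eval_N (by omega : 0 < I.D), candCount]

/-- The exponent in the number of candidates. -/
def Inst.candExp (I : Inst F) : ℕ := min I.R I.S₂

theorem Fits.candCount_lt (h : Fits qq I B V) : candCount qq I < V := by
  unfold candCount
  split_ifs
  · refine h.pow _ ?_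
    have : I.S₂ ≤ I.L := Nat.sub_le _ _
    nlinarith
  · exact h.cand

/-- The number of columns is absorbed into `B`; only the smaller of the two exponents remains. -/
theorem Fits.candCount_le (h : Fits qq I B V) : candCount qq I ≤ B * qq ^ I.candExp := by
  have hNB : I.N ≤ B := by have := h.N; nlinarith
  unfold candCount Inst.candExp
  split_ifs with h1
  · rw [min_eq_right h1.le]
    exact Nat.le_mul_of_pos_left _ h.pos
  · rw [min_eq_left (by omega), mul_comm]
    exact Nat.mul_le_mul_right _ hNB

theorem runs_searchProg (hM : M.Ok B V) (hI : Guessed e I u M) (hb : HasBasis e I K fil X W M)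
    (hv : Valid I u K fil X W) (hF : Fits qq I B V) (hD : 1 < I.D) (hR : I.n 0 ≤ I.R) :
    Runs B V searchProg (qq ^ I.candExp * searchProg.tm B) M fun M' => ∃ K' fil' X' W',
      HasBasis e I K' fil' X' W' M' ∧ Valid I u K' fil' X' W' ∧
      ∀ c < candCount qq I, ∀ z : ℕ → F,
        (∀ j < I.N, ∑ l ∈ Finset.range I.m, I.coef u (cand e I u c) j l * z l = 0) →
        Killed (I.n 0) K' fil' z := by
  have hB := hF.pos
  refine runs_forLoop (t := tryProg.tm B) (cnt := candCount qq I) (fun c M' => ∃ K' fil' X' W',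
      HasBasis e I K' fil' X' W' M' ∧ Valid I u K' fil' X' W' ∧
      ∀ c' < c, ∀ z : ℕ → F,
        (∀ j < I.N, ∑ l ∈ Finset.range I.m, I.coef u (cand e I u c') j l * z l = 0) →
        Killed (I.n 0) K' fil' z) hM (by decide) (by decide) hB hF.candCount_lt ?_ ?_ ?_ ?_
  · intro M' ho
    exact eval_candCountExpr (hI.congr (ho.mono (l' := List.range' 16 24) (by decide))).toReady hD
  · intro M' ho
    exact ⟨K, fil, X, W, hb.congr ho, hv, fun _ h => absurd h (by omega)⟩
  · rintro c hc M' ok' ho hcv ⟨K', fil', X', W', hb', hv', hk'⟩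
    refine (runs_tryProg ok' (hI.congr (ho.mono (l' := List.range' 16 24) (by decide))) hb' hv'
      hF hD hR hc hcv).mono le_rfl ?_
    rintro M₃ _ _ ⟨K'', fil'', X'', W'', hb'', hv'', hk'', hmono''⟩ M₄ h₄
    refine ⟨K'', fil'', X'', W'', hb''.congr h₄, hv'', fun c' hc' => ?_⟩
    rcases Nat.lt_succ_iff_lt_or_eq.1 hc' with h | rfl
    · exact fun z hz => hmono'' z (hk' c' h z hz)
    · exact hk''
  · simpa [searchProg] using forLoop_time (i := 20) (N := candCountExpr) (p := tryProg) (Q' := 1)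
      hF.candCount_le (pow_pos (card_pos e) _) (by simp) one_pos

/-- The output is a decomposition of `I`. -/
def Returns (e : F ≃ Fin qq) (I : Inst F) (M : Mem) : Prop :=
  M 7 0 = 1 ∧ ∃ A : ℕ → ℕ → F, I.IsCPD A ∧
    ∀ ℓ < I.L, ∀ r < I.R, M 8 (ℓ * I.R + r) = e (A ℓ r)

theorem Returns.congr {M' : Mem} (h : Returns e I M) {l : List ℕ} (ho : M'.EqOff l M)
    (hl : ∀ a ∈ [7, 8], a ∉ l := by decide) : Returns e I M' := by
  unfold Returns
  rw [ho 7 (hl 7 (by simp)), ho 8 (hl 8 (by simp))]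
  exact h

/-- Writing the decomposition found by the search. -/
def outputProg : Prog :=
  .seq (foldLoop 36 37 38 39 (mul n₀ k) n₀ zero
    (fadd (var 39) (fmul (load 16 (add (mul (var 38) n₀) (div (var 37) k)))
      (load 18 (add (mul (var 38) k) (mod (var 37) k))))))
  (.seq (mapLoop 8 37 (mul L R) (selLt (div (var 37) R) n₀
      (selLt (mod (var 37) R) n₀ (load 16 (add (mul (mod (var 37) R) n₀) (div (var 37) R)))
        (load 36 (add (mul (div (var 37) R) k) (sub (mod (var 37) R) n₀))))
      (selLt (mod (var 37) R) n₀ (load 19 (add (mul (mod (var 37) R) L) (div (var 37) R)))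
        (load 14 (add (mul (sub (div (var 37) R) n₀) k) (sub (mod (var 37) R) n₀))))))
    (.assign 7 (lit 0) (lit 1)))

theorem runs_outputProg (hM : M.Ok B V) (hI : Guessed e I u M) (hb : HasBasis e I K fil X W M)
    (hv : Valid I u K fil X W) (hF : Fits qq I B V) (hD : 1 < I.D) (hR : I.n 0 ≤ I.R)
    (hf : ∀ p < I.n 0, fil p ≠ 0) :
    Runs B V outputProg (outputProg.tm B) M (Returns e I) := by
  have hB := hF.pos
  have hBV := hF.BV
  have hD0 : 0 < I.D := by omega
  have hn0 : I.n 0 ≤ B := by have := hF.n0; nlinarith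
  have hn0L : I.n 0 ≤ I.L := I.n_zero_le_off (by omega)
  have hk : I.k ≤ I.R := Nat.sub_le _ _
  have hnk : I.n 0 * I.k ≤ B := by rw [mul_comm]; exact (hF.exponent hk hn0L).2
  have hLR : I.L * I.R ≤ B := by rw [mul_comm]; exact (hF.exponent le_rfl le_rfl).2
  -- Array 36 receives the columns of the first factor that belong to the guessed terms.
  refine Runs.andThen (t := Prog.tm B _) (t' := Prog.tm B _)
    (runs_foldMat (r := I.n 0) (s := I.k) (I.n 0) (fun i r y => e (∑ p ∈ Finset.range y,
      K p i * X p r)) hM (by decide) (by decide) (by decide) (by decide) (by decide) hnk hnk hB hBV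
      hn0 hn0 ?_ ?_ ?_ ?_ (fun _ _ _ _ _ _ => hF.code e _)) ?_ le_rfl
  · intro M' ho
    have h := hI.congr ho
    simp only [eval, h.eval_n₀ hD0, h.eval_k hD0]
  · intro M' ho
    exact (hI.congr ho).eval_n₀ hD0
  · intro _ _ _ _ M' ho _ _
    simpa using (hI.congr ho).eval_zero
  · intro i hi r hr p hp M' _ ho hdiv hmod hpv hac
    have h := hI.congr ho
    rw [Finset.sum_range_succ]
    refine h.eval_fadd hac (h.eval_fmul ?_ ?_)
    · simp only [eval, eval_var, h.eval_k hD0, h.eval_n₀ hD0, hdiv, hpv, ho.cell 16,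
        hb.rows p hp i hi]
    · simp only [eval, eval_var, h.eval_k hD0, hmod, hpv, ho.cell 18, hb.coeff p hp (hf p hp) r hr]
  intro M₁ ok₁ off₁ post₁
  have off₁' : M₁.EqOff [36, 37, 38, 39] M := off₁.mono (by decide)
  have hI₁ := hI.congr off₁'
  have hb₁ := hb.congr off₁'
  refine Runs.andThen (t := Prog.tm B _) (t' := Prog.tm B _)
    (runs_mapMat (r := I.L) (s := I.R) (fun ℓ c => e (solution I u K X W ℓ c)) ok₁
      (by decide) (by decide) (by decide) hLR hLR hB hBV ?_ ?_
      (fun _ _ _ _ => hF.code e _)) ?_ le_rfl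
  · intro M' ho
    have h := hI₁.congr ho
    simp only [eval, h.eval_L, h.eval_R]
  · intro ℓ hℓ c hc M' _ ho _ hdiv hmod _
    have h := hI₁.congr ho
    simp only [eval_selLt, eval, eval_var, h.eval_R, h.eval_n₀ hD0, h.eval_k hD0, h.eval_L, hdiv,
      hmod, solution, ho.cell 16, ho.cell 36, ho.cell 19, ho.cell 14]
    split_ifs with h1 h2 h2
    · exact hb₁.rows c h2 ℓ h1
    · exact post₁ ℓ h1 _ (by unfold Inst.k; omega)
    · exact hb₁.cols c h2 (hf c h2) ℓ hℓ (by omega)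
    · exact hI₁.guess ℓ hℓ (by omega) _ (by unfold Inst.k; omega)
  intro M₂ ok₂ off₂ post₂
  refine Runs.assign ok₂ (by decide) hB (by simp only [eval]; omega) ?_ le_rfl
  refine ⟨by simp [eval], _, hv.isCPD hR hf, fun ℓ hℓ r hr => ?_⟩
  rw [Mem.set_of_ne _ (by decide), post₂ ℓ hℓ r hr]

/-- Writing the decomposition if the search was successful. -/
def finishProg : Prog :=
  .seq (foldLoop 35 37 38 39 (lit 1) n₀ (lit 1) (mul (var 39) (load 17 (var 38))))
    (.cond (var 35) outputProg .skip)

theorem runs_finishProg (hM : M.Ok B V) (hI : Guessed e I u M) (hb : HasBasis e I K fil X W M)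
    (hv : Valid I u K fil X W) (hF : Fits qq I B V) (hD : 1 < I.D) (hR : I.n 0 ≤ I.R) :
    Runs B V finishProg (finishProg.tm B) M fun M' =>
      Returns e I M' ∨ ((¬ ∀ p < I.n 0, fil p ≠ 0) ∧ M' 7 = M 7 ∧ M' 8 = M 8) := by
  have hB := hF.pos
  have hBV := hF.BV
  have hD0 : 0 < I.D := by omega
  have hn0 : I.n 0 ≤ B := by have := hF.n0; nlinarith
  refine Runs.andThen (t := Prog.tm B _) (t' := Prog.tm B (.cond _ _ _))
    (runs_foldLoop (cnt := 1) (fun _ => I.n 0)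
      (fun _ y => ∏ p ∈ Finset.range y, fil p) hM (by decide)
    (by decide) (by decide) (by decide) (by decide) hB hB hB hBV
    (fun _ _ => hn0) (fun _ _ => hn0) (fun _ _ => rfl) ?_ (fun _ _ _ _ _ => rfl) ?_ ?_) ?_ le_rfl
  · intro _ _ M' ho _
    exact (hI.congr ho).eval_n₀ hD0
  · intro _ _ y hy M' _ ho _ hyv hac
    simp only [eval, eval_var, hyv, hac, ho.cell 17, hb.flag y hy, Finset.prod_range_succ]
  · intro _ _ y _
    -- Flags are `0` or `1`, so their product stays below `V` and is nonzero exactly when all are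
    -- set.
    have : ∏ p ∈ Finset.range y, fil p ≤ 1 := Finset.prod_le_one' fun p _ => hv.1 p
    omega
  intro M₁ ok₁ off₁ post₁
  have off₁' : M₁.EqOff [35, 37, 38, 39] M := off₁.mono (by decide)
  have hdone : (var 35).eval M₁ = ∏ p ∈ Finset.range (I.n 0), fil p := post₁ 0 (by omega)
  refine Runs.cond (t := outputProg.tm B) (t' := Prog.tm B .skip) ?_ ?_
    (by simp only [Prog.tm]; omega) (by simp only [Prog.tm]; omega)
  · intro h0
    rw [hdone, Finset.prod_ne_zero_iff] at h0
    exact (runs_outputProg ok₁ (hI.congr off₁') (hb.congr off₁') hv hF hD hR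
      fun p hp => h0 p (by simpa using hp)).mono le_rfl fun _ _ _ h => Or.inl h
  · intro h0
    rw [hdone, Finset.prod_eq_zero_iff] at h0
    obtain ⟨p, hp, hp0⟩ := h0
    exact Runs.skip ok₁ (Or.inr ⟨fun h => h p (by simpa using hp) hp0, off₁' 7 (by decide),
      off₁' 8 (by decide)⟩) le_rfl

/-! ### The algorithm -/

/-- Processing the guess whose number is in array 13. -/
def guessStepProg : Prog := .seq guessProg (.seq searchProg finishProg)

/-- Processing all guesses. -/
def mainProg : Prog := forLoop 13 (load 12 (mul k S₁)) guessStepProg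

theorem Inst.valid_init (I : Inst F) (u : ℕ → ℕ → F) :
    Valid I u (fun p l => if p = l then 1 else 0) (fun _ => 0) 0 0 :=
  ⟨by simp, _, IsDual.one _, fun _ _ h => absurd rfl h⟩

theorem runs_guessStepProg (hM : M.Ok B V) (hI : Ready e I M) (hF : Fits qq I B V) (hD : 1 < I.D)
    (hR : I.n 0 ≤ I.R) {g : ℕ} (hg : M 13 0 = g) :
    Runs B V guessStepProg (qq ^ I.candExp * guessStepProg.tm B) M fun M' =>
      Returns e I M' ∨ (¬ Succeeds e I (guess e I g) ∧ M' 7 = M 7 ∧ M' 8 = M 8) := by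
  have hQ : 0 < qq ^ I.candExp := pow_pos (card_pos e) _
  have h1 := Nat.le_mul_of_pos_left (guessProg.tm B) hQ
  have h2 := Nat.le_mul_of_pos_left (finishProg.tm B) hQ
  refine Runs.andThen (t := Prog.tm B _) (t' := qq ^ I.candExp * searchProg.tm B
    + finishProg.tm B) (runs_guessProg hM hI hF hD hg) ?_
    (by simp only [guessStepProg, Prog.tm, mul_add] at *; omega)
  rintro M₁ ok₁ off₁ ⟨hI₁, hb₁⟩
  have off₁' : M₁.EqOff [14, 15, 16, 17, 37, 38, 39] M := off₁.mono (by decide)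
  refine Runs.andThen (t := qq ^ I.candExp * searchProg.tm B) (t' := finishProg.tm B)
    (runs_searchProg ok₁ hI₁ hb₁ (I.valid_init _) hF hD hR) ?_ le_rfl
  rintro M₂ ok₂ off₂ ⟨K, fil, X, W, hb₂, hv₂, hk₂⟩
  have off₂' : M₂.EqOff (List.range' 16 24) M₁ := off₂.mono (by decide)
  refine (runs_finishProg ok₂ (hI₁.congr off₂') hb₂ hv₂ hF hD hR).mono le_rfl ?_
  rintro M₃ _ _ (h | ⟨h, h7, h8⟩)
  · exact Or.inl h
  · exact Or.inr ⟨fun hs => h (hs K fil X W hv₂ hk₂),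
      by rw [h7, off₂' 7 (by decide), off₁' 7 (by decide)],
      by rw [h8, off₂' 8 (by decide), off₁' 8 (by decide)]⟩

-- The loop does not stop at a success. A failing guess leaves arrays 7 and 8 alone, and a further
-- success replaces one decomposition by another.
set_option maxRecDepth 10000 in
theorem runs_mainProg (hM : M.Ok B V) (hI : Ready e I M) (hF : Fits qq I B V) (hD : 1 < I.D)
    (hR : I.n 0 ≤ I.R) (h7 : M 7 0 = 0) :
    Runs B V mainProg (qq ^ (I.candExp + I.k * I.S₁) * mainProg.tm B) M fun M' =>
      Returns e I M' ∨
        ((∀ g < qq ^ (I.k * I.S₁), ¬ Succeeds e I (guess e I g)) ∧ M' 7 0 = 0) := by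
  have hB := hF.pos
  have hk : I.k ≤ I.R := Nat.sub_le _ _
  have hS₁ : I.S₁ ≤ I.L := Nat.sub_le _ _
  have hexp := (hF.exponent hk hS₁).1
  refine runs_forLoop (t := qq ^ I.candExp * guessStepProg.tm B) (cnt := qq ^ (I.k * I.S₁))
    (fun g M' => Returns e I M' ∨
      ((∀ g' < g, ¬ Succeeds e I (guess e I g')) ∧ M' 7 0 = 0)) hM (by decide)
    (by decide) hB (hF.pow _ hexp) ?_ ?_ ?_ ?_
  · intro M' ho
    have h := hI.congr (ho.mono (l' := [7, 8] ++ List.range' 13 27) (by decide))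
    simp only [eval, h.eval_k (by omega : 0 < I.D), h.eval_S₁ (by omega : 0 < I.D), h.pow _ hexp]
  · intro M' ho
    exact Or.inr ⟨fun _ h => absurd h (by omega), by rw [ho.cell 7, h7]⟩
  · intro g hg M' ok' ho hgv hinv
    refine (runs_guessStepProg ok' (hI.congr (ho.mono (l' := [7, 8] ++ List.range' 13 27)
      (by decide))) hF hD hR hgv).mono le_rfl ?_
    rintro M₃ _ _ h M₄ h₄
    rcases h with h | ⟨h, h7', h8'⟩
    · exact Or.inl (h.congr h₄)
    · rcases hinv with hinv | ⟨hinv, h0⟩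
      · left
        unfold Returns
        rw [h₄ 7 (by decide), h₄ 8 (by decide), h7', h8']
        exact hinv
      · refine Or.inr ⟨fun g' hg' => ?_, by rw [h₄ 7 (by decide), h7', h0]⟩
        rcases Nat.lt_succ_iff_lt_or_eq.1 hg' with h | rfl
        · exact hinv g' h
        · assumption
  · rw [add_comm I.candExp, pow_add]
    exact forLoop_time (Q := qq ^ (I.k * I.S₁)) (Nat.le_mul_of_pos_left _ hB) (pow_pos (card_pos e) _) le_rfl
      (pow_pos (card_pos e) _)

/-- The decomposition of a tensor of order one. -/
def orderOneProg : Prog :=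
  .seq (mapLoop 8 37 R zero) (.seq (.assign 8 (lit 0) (load 6 (lit 0))) (.assign 7 (lit 0) (lit 1)))

/-- There is at most one entry, and it is placed in the first column, followed by zeros. If there is
none, nothing is required of the entries. -/
theorem runs_orderOneProg (hM : M.Ok B V) (hI : Input e I M) (hF : Fits qq I B V) (hD : I.D = 1)
    (hR : I.n 0 ≤ I.R) (hn : I.n 0 ≤ 1) :
    Runs B V orderOneProg (orderOneProg.tm B) M (Returns e I) := by
  have hB := hF.pos
  have hBV := hF.BV
  have hRB : I.R ≤ B := by have := hF.RL; nlinarith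
  have hstr : I.str I.D = I.n 0 := by rw [hD, I.str_one]
  have hoff : I.L = I.n 0 := by rw [Inst.L, hD, I.off_one]
  refine Runs.andThen (t := Prog.tm B _) (t' := Prog.tm B _)
    (runs_mapLoop (cnt := I.R) (fun _ => e (0 : F)) hM (by decide) (by decide) (by decide) hRB hRB
      hB hBV ?_ ?_ (fun _ _ => hF.code e _)) ?_ le_rfl
  · intro M' ho
    exact (hI.congr ho).eval_R
  · intro t ht M' _ ho hv _
    exact (hI.congr ho).eval_zero
  intro M₁ ok₁ off₁ post₁
  have off₁' : M₁.EqOff [8, 37] M := off₁.mono (by decide)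
  refine Runs.seq (t := Prog.tm B (.assign _ _ _)) (t' := Prog.tm B (.assign _ _ _))
    (Runs.assign ok₁ (by decide) hB (ok₁.lt (by omega) _ _) ?_ le_rfl) le_rfl
  refine Runs.assign (ok₁.set (by decide) hB (ok₁.lt (by omega) _ _)) (by decide) hB
    (by simp only [eval]; omega) ?_ le_rfl
  simp only [eval]
  refine ⟨by simp, fun ℓ r => if r = 0 then I.T 0 0 else 0, ?_, fun ℓ hℓ r hr => ?_⟩
  · intro i hi j hj
    have hN : I.N ≤ 1 := by
      rw [Inst.N, hstr]; exact Nat.div_le_of_le_mul (by omega)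
    obtain rfl : i = 0 := by omega
    obtain rfl : j = 0 := by omega
    rw [Finset.sum_eq_single 0]
    · simp [Inst.prodFrom, hD]
    · intro r _ hr; simp [hr]
    · intro h; simp at h; omega
  · obtain rfl : ℓ = 0 := by omega
    have h0 : 0 < I.n 0 := by omega
    rw [Mem.set_of_ne _ (by decide), zero_mul, zero_add]
    by_cases hr0 : r = 0
    · subst hr0
      have hN : 0 < I.N := by
        rw [Inst.N, hstr, Nat.div_self h0]; exact one_pos
      have := hI.T 0 h0 0 hN
      rw [Mem.set_self, off₁'.cell 6]
      simpa using this
    · rw [Mem.set_cell_of_ne _ _ hr0, post₁.1 r hr]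
      simp only [if_neg hr0]

/-- The algorithm. -/
def program : Prog :=
  .cond (Expr.lt R n₀) .skip (.cond (Expr.lt D (lit 2)) orderOneProg (.seq tablesProg mainProg))

/-- `hrows` is what conciseness contributes: it refutes decompositions when `R < n 0` and provides
the right guess otherwise. Order one is treated apart because the linear systems need an axis `1`.
-/
theorem runs_program (hM : M.Ok B V) (hI : Input e I M) (hF : Fits qq I B V) (hD : 0 < I.D)
    (h7 : M 7 0 = 0) (hN : 0 < I.n 0 → 0 < I.N) (hone : I.D = 1 → I.n 0 ≤ 1)
    (hrows : ∀ A : ℕ → ℕ → F, I.IsCPD A →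
      LinearIndependent F (fun (i : Fin (I.n 0)) (r : Fin I.R) => A i r)) :
    Runs B V program (qq ^ (I.candExp + I.k * I.S₁) * program.tm B) M fun M' =>
      Returns e I M' ∨ ((¬ ∃ A, I.IsCPD A) ∧ M' 7 0 = 0) := by
  set Q := qq ^ (I.candExp + I.k * I.S₁) with hQdef
  have hQ : 0 < Q := pow_pos (card_pos e) _
  have hb : (Expr.lt R n₀).eval M = if I.R < I.n 0 then 1 else 0 := by
    rw [eval_lt, hI.eval_R, hI.eval_n₀ hD]
  have hb' : (Expr.lt Expr.D (lit 2)).eval M = if I.D < 2 then 1 else 0 := by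
    rw [eval_lt, hI.eval_D]; rfl
  have hc := Nat.le_mul_of_pos_left ((Expr.lt R n₀).cost + 1) hQ
  have hc' := Nat.le_mul_of_pos_left ((Expr.lt Expr.D (lit 2)).cost + 1) hQ
  have ht := Nat.le_mul_of_pos_left (tablesProg.tm B) hQ
  have ho := Nat.le_mul_of_pos_left (orderOneProg.tm B) hQ
  refine Runs.cond (t := 1) (t' := Q * Prog.tm B (.cond (Expr.lt Expr.D (lit 2)) orderOneProg
    (.seq tablesProg mainProg))) ?_ ?_ ?_ ?_
  · intro h
    rw [hb] at h
    have hlt : I.R < I.n 0 := by by_contra hn; simp [hn] at h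
    refine Runs.skip hM (Or.inr ⟨?_, h7⟩) le_rfl
    rintro ⟨A, hA⟩
    have := (hrows A hA).fintype_card_le_finrank
    simp at this
    omega
  · intro h
    rw [hb] at h
    have hR : I.n 0 ≤ I.R := by by_contra hn; simp [not_le.1 hn] at h
    refine Runs.cond (t := orderOneProg.tm B) (t' := Q * (tablesProg.tm B + mainProg.tm B))
      ?_ ?_ ?_ ?_
    · intro h
      rw [hb'] at h
      have hD1 : I.D = 1 := by
        have : I.D < 2 := by by_contra hn; simp [hn] at h
        omega
      exact (runs_orderOneProg hM hI hF hD1 hR (hone hD1)).mono le_rfl fun _ _ _ h => Or.inl h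
    · intro h
      rw [hb'] at h
      have hD2 : 1 < I.D := by
        by_contra hn
        rw [if_pos (by omega)] at h
        exact one_ne_zero h
      refine Runs.andThen (t := tablesProg.tm B) (t' := Q * mainProg.tm B)
        (runs_tablesProg hM hI hF) ?_ (by rw [mul_add]; omega)
      intro M₁ ok₁ off₁ hI₁
      have off₁' : M₁.EqOff [9, 10, 11, 12, 37, 38, 39] M := off₁.mono (by decide)
      refine (runs_mainProg ok₁ hI₁ hF hD2 hR (by rw [off₁'.cell 7, h7])).mono le_rfl ?_
      rintro M₂ _ _ (h | ⟨h, h0⟩)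
      · exact Or.inl h
      · refine Or.inr ⟨?_, h0⟩
        rintro ⟨A, hA⟩
        obtain ⟨g, hg, hs⟩ := exists_succeeds e I hD2 hR hN hA (hrows A hA)
        exact h g hg hs
    · simp only [Prog.tm, mul_add] at *; omega
    · simp only [Prog.tm, mul_add] at *; omega
  · simp only [program, Prog.tm, mul_add] at *; omega
  · simp only [program, Prog.tm, mul_add] at *; omega

end

end TensorCPD

/-! ### Transfer to tensors, size bounds and the exponent. -/

namespace TensorCPD

/-! ### Tensors as instances -/

section

variable {F : Type*} {m : ℕ} {n : Fin (m + 1) → ℕ}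

/-- The shape as a function on `ℕ`. -/
def extendShape (n : Fin (m + 1) → ℕ) (x : ℕ) : ℕ := if h : x < m + 1 then n ⟨x, h⟩ else 0

theorem extendShape_val (n : Fin (m + 1) → ℕ) (d : Fin (m + 1)) : extendShape n d = n d :=
  dif_pos d.2

theorem extendShape_zero (n : Fin (m + 1) → ℕ) : extendShape n 0 = n 0 := extendShape_val n 0

/-- The instance given by a tensor. -/
def toInst [Zero F] (T : Tensor F n) (R : ℕ) : Inst F where
  D := m + 1
  R := R
  n := extendShape n
  T l j := if h : l + n 0 * j < ∏ d, n d then T (finPiFinEquiv.symm ⟨l + n 0 * j, h⟩) else 0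

theorem str_toInst [Zero F] (T : Tensor F n) (R : ℕ) : (toInst T R).str (m + 1) = ∏ d, n d := by
  rw [Inst.str, Finset.prod_range]
  exact Finset.prod_congr rfl fun d _ => extendShape_val n d

theorem L_toInst [Zero F] (T : Tensor F n) (R : ℕ) : (toInst T R).L = ∑ d, n d := by
  rw [Inst.L, Inst.off, toInst, Finset.sum_range]
  exact Finset.sum_congr rfl fun d _ => extendShape_val n d

theorem finPiFinEquiv_toInst [Zero F] (T : Tensor F n) (R : ℕ) (ι : ∀ d, Fin (n d)) :
    (finPiFinEquiv ι : ℕ) = ∑ d : Fin (m + 1), (ι d : ℕ) * (toInst T R).str d := by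
  rw [finPiFinEquiv_apply]
  refine Finset.sum_congr rfl fun d _ => ?_
  rw [Inst.str, Finset.prod_range]
  refine congrArg _ (Finset.prod_congr rfl fun x _ => ?_)
  exact (extendShape_val n (Fin.castLE d.is_lt.le x)).symm

/-- The column of the unfolding containing an entry of the tensor. -/
theorem exists_column_of_index [Zero F] (T : Tensor F n) (R : ℕ) (ι : ∀ d, Fin (n d)) :
    ∃ j < (toInst T R).N, ∀ d : Fin (m + 1), 1 ≤ (d : ℕ) → (toInst T R).dig d j = ι d := by
  set I := toInst T R
  have hpos : ∀ d : Fin (m + 1), 0 < n d := fun d => (ι d).pos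
  have hN : 0 < I.N := by
    have h1 : I.n 0 * I.N = I.str I.D := I.mul_N (Nat.succ_pos m)
    rw [show I.str I.D = ∏ d, n d from str_toInst T R] at h1
    have h2 : 0 < ∏ d, n d := Finset.prod_pos fun d _ => hpos d
    exact Nat.pos_of_ne_zero fun h => by simp [h] at h1; omega
  obtain ⟨j, hj, -, h⟩ := I.exists_column hN (Nat.succ_pos m)
    (a := fun x => if x = 0 then 0 else if h : x < m + 1 then (ι ⟨x, h⟩ : ℕ) else 0)
    (fun d hd => by
      have hd : d < m + 1 := hd
      have hd' : I.n d = n ⟨d, hd⟩ := extendShape_val n ⟨d, hd⟩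
      rw [hd']
      split_ifs
      · exact hpos _
      · exact (ι ⟨d, hd⟩).2) (if_pos rfl)
  refine ⟨j, hj, fun d hd => ?_⟩
  rw [h d d.2, if_neg (by omega), dif_pos d.2]

/-- `finPiFinEquiv` lets the index along axis `0` vary fastest, and `n 0 * j` collects the
contributions of all other axes. -/
theorem flatten_index [Zero F] (T : Tensor F n) (R : ℕ) (ι : ∀ d, Fin (n d)) {j : ℕ}
    (hj : j < (toInst T R).N)
    (h : ∀ d : Fin (m + 1), 1 ≤ (d : ℕ) → (toInst T R).dig d j = ι d) :
    (ι 0 : ℕ) + n 0 * j = finPiFinEquiv ι := by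
  set I := toInst T R
  have h1 : ∑ d ∈ Finset.range (m + 1), I.dig d j * I.str d = I.n 0 * j :=
    I.sum_dig hj (Nat.succ_pos m)
  rw [finPiFinEquiv_toInst T R, Fin.sum_univ_succ]
  rw [Finset.sum_range, Fin.sum_univ_succ] at h1
  have h2 : I.n 0 = n 0 := extendShape_zero n
  rw [h2] at h1
  rw [← h1]
  have h3 : I.dig ((0 : Fin (m + 1)) : ℕ) j = 0 := I.dig_zero j
  rw [h3, zero_mul, zero_add]
  have h4 : (toInst T R).str ((0 : Fin (m + 1)) : ℕ) = 1 := rfl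
  rw [h4, mul_one]
  refine congrArg _ (Finset.sum_congr rfl fun d _ => ?_)
  rw [h d.succ (by simp)]

theorem T_toInst [Zero F] (T : Tensor F n) (R : ℕ) (ι : ∀ d, Fin (n d)) {j : ℕ}
    (hj : j < (toInst T R).N)
    (h : ∀ d : Fin (m + 1), 1 ≤ (d : ℕ) → (toInst T R).dig d j = ι d) :
    (toInst T R).T (ι 0) j = T ι := by
  have h1 := flatten_index T R ι hj h
  have h2 : (ι 0 : ℕ) + n 0 * j < ∏ d, n d := by rw [h1]; exact Fin.is_lt _
  have h3 : (⟨(ι 0 : ℕ) + n 0 * j, h2⟩ : Fin (∏ d, n d)) = finPiFinEquiv ι := Fin.ext h1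
  rw [toInst]
  simp only [dif_pos h2]
  rw [h3, Equiv.symm_apply_apply]

end

section

variable {F : Type*} [Field F] {m : ℕ} {n : Fin (m + 1) → ℕ}

/-- The factor matrices given by packed columns. -/
def unpack (n : Fin (m + 1) → ℕ) (R : ℕ) (A : ℕ → ℕ → F) (d : Fin (m + 1)) :
    Matrix (Fin (n d)) (Fin R) F :=
  fun i r => A ((finSigmaFinEquiv ⟨d, i⟩ : Fin (∑ d, n d)) : ℕ) r

/-- The packed columns of factor matrices. -/
def pack {R : ℕ} (A : ∀ d : Fin (m + 1), Matrix (Fin (n d)) (Fin R) F) (ℓ r : ℕ) : F :=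
  if h : ℓ < ∑ d, n d ∧ r < R then
    A (finSigmaFinEquiv.symm ⟨ℓ, h.1⟩).1 (finSigmaFinEquiv.symm ⟨ℓ, h.1⟩).2 ⟨r, h.2⟩ else 0

theorem unpack_pack {R : ℕ} (A : ∀ d : Fin (m + 1), Matrix (Fin (n d)) (Fin R) F) :
    unpack n R (pack A) = A := by
  funext d i r
  have h : ((finSigmaFinEquiv ⟨d, i⟩ : Fin (∑ d, n d)) : ℕ) < ∑ d, n d ∧ (r : ℕ) < R :=
    ⟨Fin.is_lt _, r.2⟩
  rw [unpack, pack, dif_pos h]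
  -- The row type depends on the axis, so the equality of axis and row is used as one equality of
  -- pairs.
  have key : ∀ s : (d : Fin (m + 1)) × Fin (n d), s = ⟨d, i⟩ → A s.1 s.2 r = A d i r := by
    rintro _ rfl; rfl
  exact key _ (Equiv.symm_apply_apply _ _)

theorem finSigmaFinEquiv_toInst (T : Tensor F n) (R : ℕ) (d : Fin (m + 1)) (i : Fin (n d)) :
    ((finSigmaFinEquiv ⟨d, i⟩ : Fin (∑ d, n d)) : ℕ) = (toInst T R).off d + i := by
  rw [finSigmaFinEquiv_apply, Inst.off, Finset.sum_range]
  refine congrArg (· + (i : ℕ)) (Finset.sum_congr rfl fun x _ => ?_)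
  exact (extendShape_val n (Fin.castLE d.is_lt.le x)).symm

theorem cpdEval_unpack (T : Tensor F n) (R : ℕ) (A : ℕ → ℕ → F) (ι : ∀ d, Fin (n d)) {j : ℕ}
    (h : ∀ d : Fin (m + 1), 1 ≤ (d : ℕ) → (toInst T R).dig d j = ι d) :
    cpdEval (unpack n R A) ι = ∑ r ∈ Finset.range R, A (ι 0) r *
      (toInst T R).prodFrom 1 (fun ℓ => A ℓ r) j := by
  rw [cpdEval, Finset.sum_range]
  refine Finset.sum_congr rfl fun r _ => ?_
  rw [Fin.prod_univ_succ, Inst.prodFrom]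
  congr 1
  · rw [unpack, finSigmaFinEquiv_toInst T R]
    have : (toInst T R).off ((0 : Fin (m + 1)) : ℕ) = 0 := rfl
    rw [this, zero_add]
  · rw [show (toInst T R).D - 1 = m from rfl, Finset.prod_range]
    refine Finset.prod_congr rfl fun d _ => ?_
    rw [unpack, finSigmaFinEquiv_toInst T R, ← h d.succ (by simp), Fin.val_succ,
      add_comm 1 (d : ℕ)]

theorem isCPD_iff (T : Tensor F n) (R : ℕ) (A : ℕ → ℕ → F) :
    (toInst T R).IsCPD A ↔ T = cpdEval (unpack n R A) := by
  constructor
  · intro hA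
    funext ι
    obtain ⟨j, hj, h⟩ := exists_column_of_index T R ι
    rw [cpdEval_unpack T R A ι h, ← T_toInst T R ι hj h]
    exact hA (ι 0) (by rw [show (toInst T R).n 0 = n 0 from extendShape_zero n]; exact (ι 0).2) j hj
  · intro hT i hi j hj
    set I := toInst T R
    have hi' : i < n 0 := by rwa [show I.n 0 = n 0 from extendShape_zero n] at hi
    let ι : ∀ d, Fin (n d) := fun d => if hd : d = 0 then ⟨i, hd ▸ hi'⟩ else
      ⟨I.dig d j, by
        have := I.dig_lt (by omega) d.2 j
        rwa [show I.n d = n d from extendShape_val n d] at this⟩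
    have h0 : (ι 0 : ℕ) = i := by simp [ι]
    have h : ∀ d : Fin (m + 1), 1 ≤ (d : ℕ) → I.dig d j = ι d := by
      intro d hd
      have : d ≠ 0 := by rintro rfl; simp at hd
      simp [ι, this]
    have h1 := T_toInst T R ι hj h
    rw [h0] at h1
    rw [h1]
    conv_lhs => rw [hT]
    rw [cpdEval_unpack T R A ι h, h0]
    rfl

/-! ### Concise tensors -/

/-- The linear map `f` weights the rank one tensors of the other axes by a vector in `F^R` and sends
row `i` to slice `i`. Vectors with independent images are independent. -/
theorem Concise.linearIndependent_rows {T : Tensor F n} (hT : Concise T) {R : ℕ}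
    (A : ∀ d : Fin (m + 1), Matrix (Fin (n d)) (Fin R) F) (hA : T = cpdEval A) :
    LinearIndependent F fun i => A 0 i := by
  let f : (Fin R → F) →ₗ[F] Tensor F (fun k : Fin m => n ((0 : Fin (m + 1)).succAbove k)) :=
    { toFun := fun v ι => ∑ r, v r * ∏ d : Fin m, A ((0 : Fin (m + 1)).succAbove d) (ι d) r
      map_add' := fun v w => by
        funext ι
        change _ = (∑ r : Fin R, v r * ∏ d : Fin m, A ((0 : Fin (m + 1)).succAbove d) (ι d) r) +
          ∑ r : Fin R, w r * ∏ d : Fin m, A ((0 : Fin (m + 1)).succAbove d) (ι d) r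
        simp only [Pi.add_apply, add_mul, Finset.sum_add_distrib]
      map_smul' := fun c v => by
        funext ι
        change _ = c * ∑ r, _
        simp only [Pi.smul_apply, smul_eq_mul, mul_assoc, Finset.mul_sum] }
  refine LinearIndependent.of_comp f ?_
  have h : f ∘ (fun i => A 0 i) = slice T 0 := by
    funext i ι
    simp only [Function.comp, slice, hA, cpdEval, f, LinearMap.coe_mk, AddHom.coe_mk]
    refine Finset.sum_congr rfl fun r _ => ?_
    rw [Fin.prod_univ_succAbove _ 0]
    simp only [Fin.insertNth_apply_same, Fin.insertNth_apply_succAbove]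
  rw [h]
  exact hT 0

/-- If another dimension were zero, a slice along axis `0` would be a function on an empty set,
hence zero and not part of an independent family. -/
theorem Concise.pos {T : Tensor F n} (hT : Concise T) (h0 : 0 < n 0) (d : Fin (m + 1)) :
    0 < n d := by
  rcases Fin.eq_zero_or_eq_succ d with rfl | ⟨d, rfl⟩
  · exact h0
  · by_contra hd
    have hd : n d.succ = 0 := by omega
    refine (hT 0).ne_zero ⟨0, h0⟩ (funext fun ι => ?_)
    have : Fin (n ((0 : Fin (m + 1)).succAbove d)) := ι d
    rw [Fin.zero_succAbove, hd] at this
    exact this.elim0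

/-- The slices of a tensor of order one live in a one-dimensional space. -/
theorem Concise.le_one {n : Fin (0 + 1) → ℕ} {T : Tensor F n} (hT : Concise T) : n 0 ≤ 1 := by
  have h := (hT 0).fintype_card_le_finrank
  rw [Module.finrank_fintype_fun_eq_card, Fintype.card_fin] at h
  exact h.trans (le_of_eq Fintype.card_unique)

/-! ### Bounds -/

variable {qq : ℕ}

/-- The size of the input. -/
def inputSize (n : Fin (m + 1) → ℕ) (R qq : ℕ) : ℕ := (∏ d, n d) + (m + 1) + R + qq

/-- If `n 0 = 0`, monotonicity makes every dimension zero; otherwise all dimensions are positive and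
divide the product. -/
theorem Concise.n_le {T : Tensor F n} (hT : Concise T) (hn : Antitone n) (d : Fin (m + 1)) :
    n d ≤ ∏ d, n d := by
  rcases Nat.eq_zero_or_pos (n 0) with h0 | h0
  · have := hn (Fin.zero_le d)
    omega
  · exact Nat.le_of_dvd (Finset.prod_pos fun d _ => hT.pos h0 d)
      (Finset.dvd_prod_of_mem n (Finset.mem_univ d))

theorem Concise.n_toInst_le {T : Tensor F n} (hT : Concise T) (hn : Antitone n) (R d : ℕ) :
    (toInst T R).n d ≤ ∏ d, n d := by
  change extendShape n d ≤ _
  unfold extendShape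
  split_ifs with h
  · exact hT.n_le hn _
  · exact Nat.zero_le _

theorem Concise.N_pos {T : Tensor F n} (hT : Concise T) (R : ℕ) (h0 : 0 < (toInst T R).n 0) :
    0 < (toInst T R).N := by
  have h1 : (toInst T R).n 0 = n 0 := extendShape_zero n
  have h2 := (toInst T R).mul_N (Nat.succ_pos m)
  rw [show (toInst T R).str (toInst T R).D = ∏ d, n d from str_toInst T R] at h2
  have h3 : 0 < ∏ d, n d := Finset.prod_pos fun d _ => hT.pos (h1 ▸ h0) d
  exact Nat.pos_of_ne_zero fun h => by rw [h, mul_zero] at h2; omega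

/-- The largest arrays have size cubic in `X`, for the table of powers, or `(2 * X) ^ 2`, for the
generators; both are below `(X + 2) ^ 4`. The powers `qq ^ t` have base and exponent below this
bound `B`, so they stay below `2 ^ (B * B)`. -/
theorem Concise.fits {T : Tensor F n} (hT : Concise T) (hn : Antitone n) (R : ℕ) {X : ℕ}
    (hX : inputSize n R qq = X) :
    Fits qq (toInst T R) ((X + 2) ^ 4) (2 ^ ((X + 2) ^ 4 * (X + 2) ^ 4)) := by
  generalize hI : toInst T R = I
  unfold inputSize at hX
  have hBexp : (X + 2) ^ 4 = (X * X + 4 * X + 4) * (X * X + 4 * X + 4) := by ring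
  have hBpos : 0 < (X + 2) ^ 4 := by positivity
  generalize (X + 2) ^ 4 = B at *
  have hX2 : X * X * X ≤ X * X * (X * X) + 0 ∨ X = 0 := by
    rcases Nat.eq_zero_or_pos X with h | h
    · exact Or.inr h
    · exact Or.inl (by simpa using Nat.mul_le_mul_left (X * X) (Nat.le_mul_of_pos_left X h))
  have hR : I.R = R := by rw [← hI]; rfl
  have hD : I.D = m + 1 := by rw [← hI]; rfl
  have hstr : I.str I.D = ∏ d, n d := by rw [hD, ← hI, str_toInst]
  have hNpos : 0 < I.n 0 → 0 < I.N := by rw [← hI]; exact hT.N_pos R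
  have hnd : ∀ d, I.n d ≤ X := fun d => by
    rw [← hI]; exact (hT.n_toInst_le hn R d).trans (by omega)
  have hoff : ∀ d ≤ I.D, I.off d ≤ X * X := by
    intro d hd
    refine (Finset.sum_le_card_nsmul _ _ X fun x _ => hnd x).trans ?_
    rw [Finset.card_range, smul_eq_mul]
    exact Nat.mul_le_mul_right _ (by omega)
  have hL : I.L ≤ X * X := hoff _ le_rfl
  have hNX : I.N ≤ X := by
    refine (Nat.div_le_self _ _).trans ?_
    rw [hstr]
    omega
  have hRX : R ≤ X := by omega
  have hmX : I.m ≤ 2 * X := by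
    have := hnd 1
    unfold Inst.m
    omega
  have hB1 : B ≤ B * B := Nat.le_mul_of_pos_left _ hBpos
  have hBV : B < 2 ^ (B * B) := hB1.trans_lt Nat.lt_two_pow_self
  have hXB : X * X + X + 4 ≤ B := by rw [hBexp]; nlinarith
  have hX3 : X * X * X + X * X + X + 1 ≤ B := by
    rw [hBexp]
    rcases hX2 with h | h
    · nlinarith
    · simp [h]
  have hqpow : ∀ t, qq ^ t ≤ 2 ^ (qq * t) := fun t => by
    rw [pow_mul]
    exact Nat.pow_le_pow_left Nat.lt_two_pow_self.le t
  have hqB : qq < B := by omega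
  have hRL : (I.R + 1) * (I.L + 1) ≤ B := by
    calc (I.R + 1) * (I.L + 1) ≤ (X + 1) * (X * X + 1) := Nat.mul_le_mul (by omega) (by omega)
      _ = X * X * X + X * X + X + 1 := by ring
      _ ≤ B := hX3
  refine ⟨hBV, hqB.le, by omega, ?_, hRL, ?_, ?_, ?_, ?_, ?_, ?_, ?_⟩
  · have := Nat.mul_le_mul (hnd 0) (hnd 0); omega
  · have := Nat.mul_le_mul hNX (show I.R + 1 ≤ X + 1 by omega)
    rw [show X * (X + 1) = X * X + X by ring] at this; omega
  · have := Nat.mul_le_mul hmX hmX; rw [hBexp]; nlinarith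
  · have := Nat.mul_le_mul (hnd 0) (show I.L + 1 ≤ X * X + 1 by omega)
    rw [show X * (X * X + 1) = X * X * X + X by ring] at this; omega
  · intro d hd
    refine lt_of_le_of_lt ?_ hBV
    rcases Nat.eq_zero_or_pos d with rfl | hd0
    · rw [Inst.str_zero]; omega
    · rcases Nat.eq_zero_or_pos (I.n 0) with h0 | h0
      · have : I.str d = 0 := Finset.prod_eq_zero (Finset.mem_range.2 hd0) h0
        omega
      · have h1 : 0 < I.str I.D := by
          rw [← I.mul_N (by omega)]
          exact Nat.mul_pos h0 (hNpos h0)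
        have h2 := Nat.le_of_dvd h1 (I.str_dvd hd)
        rw [hstr] at h2
        omega
  · intro d hd
    have := hoff d hd
    omega
  · intro t ht
    refine (hqpow t).trans_lt (Nat.pow_lt_pow_right one_lt_two ?_)
    exact (Nat.mul_le_mul_left _ (ht.le.trans hRL)).trans_lt
      (Nat.mul_lt_mul_of_pos_right hqB (by omega))
  · calc qq ^ I.R * I.N ≤ 2 ^ (qq * R) * 2 ^ I.N := by
          rw [hR]; exact Nat.mul_le_mul (hqpow _) Nat.lt_two_pow_self.le
      _ = 2 ^ (qq * R + I.N) := (pow_add _ _ _).symm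
      _ < _ := by
        refine Nat.pow_lt_pow_right one_lt_two ?_
        have := Nat.mul_le_mul (show qq ≤ X by omega) hRX
        omega

theorem space_le {B : ℕ} : space B (2 ^ (B * B)) ≤ 40 * B * (2 + B + B * B) := by
  unfold space
  refine Nat.mul_le_mul_left _ ?_
  rw [Nat.size_pow]
  have : B.size ≤ B := Nat.size_le.2 Nat.lt_two_pow_self
  omega

/-! ### The input -/

theorem table_apply {N : ℕ} (f : Fin N → ℕ) (k : Fin N) : table f k = f k := by
  simp [table]

theorem table_of_eq {N : ℕ} (f : Fin N → ℕ) (k : Fin N) {x : ℕ} (h : x = k) :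
    table f x = f k := by rw [h, table_apply]

section Arrays

variable (e : F ≃ Fin qq) (T : Tensor F n) (R : ℕ)

theorem inputMem_two : inputMem e T R 2 = table fun k : Fin (qq * qq) =>
    (e (e.symm (finProdFinEquiv.symm k).1 + e.symm (finProdFinEquiv.symm k).2) : ℕ) := rfl

theorem inputMem_three : inputMem e T R 3 = table fun k : Fin (qq * qq) =>
    (e (e.symm (finProdFinEquiv.symm k).1 * e.symm (finProdFinEquiv.symm k).2) : ℕ) := rfl

theorem inputMem_four : inputMem e T R 4 = table fun k : Fin qq => (e (-e.symm k) : ℕ) := rfl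

theorem inputMem_five : inputMem e T R 5 = table fun k : Fin qq => (e (e.symm k)⁻¹ : ℕ) := rfl

theorem inputMem_six : inputMem e T R 6 =
    table fun k : Fin (∏ d, n d) => (e (T (finPiFinEquiv.symm k)) : ℕ) := rfl

end Arrays

theorem input_inputMem (e : F ≃ Fin qq) (T : Tensor F n) (R : ℕ) :
    Input e (toInst T R) (inputMem e T R) where
  D := rfl
  R := rfl
  q := rfl
  zero := rfl
  one := rfl
  n d hd := rfl
  add a b := by
    rw [inputMem_two, table_of_eq _ (finProdFinEquiv (e a, e b)) (by simp [mul_comm, add_comm])]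
    simp
  mul a b := by
    rw [inputMem_three, table_of_eq _ (finProdFinEquiv (e a, e b)) (by simp [mul_comm, add_comm])]
    simp
  neg a := by
    rw [inputMem_four, table_apply]
    simp
  inv a := by
    rw [inputMem_five, table_apply]
    simp
  T l hl j hj := by
    have h0 : (toInst T R).n 0 = n 0 := extendShape_zero n
    have hlt : l + n 0 * j < ∏ d, n d := by
      rw [← str_toInst T R, show (toInst T R).str (m + 1) = _ from
        ((toInst T R).mul_N (Nat.succ_pos m)).symm, h0, mul_comm, mul_comm (n 0), add_comm]
      exact mul_add_lt_mul hj (h0 ▸ hl)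
    rw [h0, inputMem_six, table_of_eq _ ⟨l + n 0 * j, hlt⟩ rfl]
    rw [toInst]
    simp only [dif_pos hlt]

theorem table_ne_zero {N : ℕ} {f : Fin N → ℕ} {x B V : ℕ} (hN : N ≤ B) (hf : ∀ k, f k < V)
    (h : table f x ≠ 0) : x < B ∧ table f x < V := by
  unfold table at h ⊢
  split_ifs at h ⊢ with hx
  · exact ⟨by omega, hf _⟩
  · exact absurd rfl h

theorem ok_inputMem (e : F ≃ Fin qq) {T : Tensor F n} (hT : Concise T) (hn : Antitone n) (R : ℕ)
    {B V X : ℕ} (hX : inputSize n R qq = X) (hB : X * X + X + 4 ≤ B) (hBV : B < V) :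
    (inputMem e T R).Ok B V := by
  unfold inputSize at hX
  have hq : qq ≤ X := by omega
  have hq0 : 0 < qq := card_pos e
  have hqq := Nat.mul_le_mul hq hq
  have hcode : ∀ x : Fin qq, (x : ℕ) < V := fun x => by have := x.2; omega
  intro a i hai
  match a, hai with
  | 0, hai =>
    refine ⟨by norm_num, table_ne_zero (by omega) (fun k => ?_) hai⟩
    have h1 := (e 0).2
    have h2 := (e 1).2
    fin_cases k <;> simp <;> omega
  | 1, hai =>
    exact ⟨by norm_num, table_ne_zero (by omega) (fun k => by have := hT.n_le hn k; omega) hai⟩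
  | 2, hai =>
    rw [inputMem_two] at hai ⊢
    exact ⟨by norm_num, table_ne_zero (by omega) (fun k => hcode _) hai⟩
  | 3, hai =>
    rw [inputMem_three] at hai ⊢
    exact ⟨by norm_num, table_ne_zero (by omega) (fun k => hcode _) hai⟩
  | 4, hai =>
    rw [inputMem_four] at hai ⊢
    exact ⟨by norm_num, table_ne_zero (by omega) (fun k => hcode _) hai⟩
  | 5, hai =>
    rw [inputMem_five] at hai ⊢
    exact ⟨by norm_num, table_ne_zero (by omega) (fun k => hcode _) hai⟩
  | 6, hai =>
    rw [inputMem_six] at hai ⊢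
    exact ⟨by norm_num, table_ne_zero (by omega) (fun k => hcode _) hai⟩
  | _ + 7, hai => exact absurd rfl hai

/-! ### The exponent -/

theorem S₂_toInst (T : Tensor F n) (R : ℕ) :
    (toInst T R).S₂ = ∑ d : Fin (m + 1) with 2 ≤ d.val, n d := by
  have h : (toInst T R).L = (toInst T R).off 2 + ∑ d : Fin (m + 1) with 2 ≤ d.val, n d := by
    rw [L_toInst, ← Finset.sum_filter_add_sum_filter_not Finset.univ (fun d : Fin (m + 1) =>
      2 ≤ d.val), add_comm]
    congr 1
    rw [Inst.off_two, show (toInst T R).n 0 = n 0 from extendShape_zero n, Finset.sum_filter,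
      show (toInst T R).n 1 = extendShape n 1 from rfl]
    -- For order one there is no axis `1`, and `extendShape` supplies the dimension `0`.
    match m, n with
    | 0, n => simp [extendShape]
    | m + 1, n => simp [Fin.sum_univ_succ, extendShape]
  rw [Inst.S₂, h, Nat.add_sub_cancel_left]

theorem S₁_toInst (T : Tensor F n) (R : ℕ) :
    (toInst T R).S₁ = ∑ d : Fin (m + 1) with d ≠ 0, n d := by
  have h : (toInst T R).L = (toInst T R).n 0 + ∑ d : Fin (m + 1) with d ≠ 0, n d := by
    rw [L_toInst, show (toInst T R).n 0 = n 0 from extendShape_zero n, Finset.sum_filter,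
      Fin.sum_univ_succ, Fin.sum_univ_succ]
    simp
  rw [Inst.S₁, h, Nat.add_sub_cancel_left]

end

/-- A polynomial bound for the numbers of iterations, in terms of the size of the input. -/
noncomputable def iterPoly : Polynomial ℕ := (Polynomial.X + 2) ^ 4

end TensorCPD

theorem theorem1 :
    -- one program and one polynomial bound for all finite fields, orders, shapes, tensors, ranks
    ∃ (prog : TensorCPD.Prog) (P : Polynomial ℕ),
      ∀ (F : Type*) [Field F] [Fintype F] (e : F ≃ Fin (Fintype.card F))
        (m : ℕ) (n : Fin (m + 1) → ℕ) (T : TensorCPD.Tensor F n) (R : ℕ),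
        Antitone n → TensorCPD.Concise T →
        ∃ (M : TensorCPD.Mem) (time space : ℕ),
          TensorCPD.Exec space prog (TensorCPD.inputMem e T R) M time ∧
          ((∃ A : ∀ d : Fin (m + 1), Matrix (Fin (n d)) (Fin R) F,
              T = TensorCPD.cpdEval A ∧ TensorCPD.OutputsCPD e A M) ∨
            ((¬ ∃ A : ∀ d : Fin (m + 1), Matrix (Fin (n d)) (Fin R) F,
              T = TensorCPD.cpdEval A) ∧ TensorCPD.OutputsNone M)) ∧
          time ≤ P.eval ((∏ d, n d) + (m + 1) + R + Fintype.card F) *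
            Fintype.card F ^ (min R (∑ d : Fin (m + 1) with 2 ≤ d.val, n d) +
              (R - n 0) * ∑ d : Fin (m + 1) with d ≠ 0, n d) ∧
          space ≤ P.eval ((∏ d, n d) + (m + 1) + R + Fintype.card F) := by
  -- The first summand is the polynomial factor of the running time, the second one bounds the
  -- space.
  refine ⟨TensorCPD.program, TensorCPD.program.tmPoly.comp TensorCPD.iterPoly +
    40 * TensorCPD.iterPoly * (2 + TensorCPD.iterPoly + TensorCPD.iterPoly * TensorCPD.iterPoly),
    ?_⟩
  intro F _ _ e m n T R hn hT
  obtain ⟨X, hX⟩ : ∃ X, TensorCPD.inputSize n R (Fintype.card F) = X := ⟨_, rfl⟩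
  have hX' : (∏ d, n d) + (m + 1) + R + Fintype.card F = X := hX
  rw [hX']
  have hiter : TensorCPD.iterPoly.eval X = (X + 2) ^ 4 := by simp [TensorCPD.iterPoly]
  have hF := hT.fits hn R hX
  have hB : X * X + X + 4 ≤ (X + 2) ^ 4 := by
    have : (X + 2) ^ 4 = (X * X + 4 * X + 4) * (X * X + 4 * X + 4) := by ring
    rw [this]; nlinarith
  generalize (X + 2) ^ 4 = B at *
  set I := TensorCPD.toInst T R with hI
  have hn0 : I.n 0 = n 0 := TensorCPD.extendShape_zero n
  obtain ⟨M, t, hexec, ht, -, -, hpost⟩ := TensorCPD.runs_program (e := e) (I := I)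
    (TensorCPD.ok_inputMem e hT hn R hX hB hF.BV) (TensorCPD.input_inputMem e T R) hF
    (Nat.succ_pos m) rfl (hT.N_pos R) (fun h => by
      obtain rfl : m = 0 := Nat.succ.inj h
      rw [hn0]; exact hT.le_one) (fun A hA => by
      have hA' := (TensorCPD.isCPD_iff T R A).1 hA
      have h := hT.linearIndependent_rows _ hA'
      have h' := h.comp (Fin.cast hn0) (Fin.cast_injective hn0)
      have hrow : (fun (i : Fin (I.n 0)) (r : Fin I.R) => A i r) =
          (fun i => TensorCPD.unpack n R A 0 i) ∘ Fin.cast hn0 := by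
        funext i r
        change A i r = A _ r
        rw [TensorCPD.finSigmaFinEquiv_toInst T R]
        exact congrArg (A · r) (zero_add (i : ℕ)).symm
      rw [hrow]
      exact h')
  refine ⟨M, t, _, hexec, ?_, ?_, ?_⟩
  · rcases hpost with ⟨h7, A, hA, h8⟩ | ⟨hno, h7⟩
    · refine Or.inl ⟨TensorCPD.unpack n R A, (TensorCPD.isCPD_iff T R A).1 hA, h7, fun d i r => ?_⟩
      refine h8 _ ?_ r r.2
      rw [hI, TensorCPD.L_toInst]
      exact Fin.is_lt _
    · refine Or.inr ⟨?_, h7⟩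
      rintro ⟨A, hA⟩
      exact hno ⟨TensorCPD.pack A, (TensorCPD.isCPD_iff T R _).2
        (by rw [TensorCPD.unpack_pack]; exact hA)⟩
  · have hexp : min R (∑ d : Fin (m + 1) with 2 ≤ d.val, n d) +
        (R - n 0) * ∑ d : Fin (m + 1) with d ≠ 0, n d = I.candExp + I.k * I.S₁ := by
      rw [TensorCPD.Inst.candExp, TensorCPD.Inst.k, hI, TensorCPD.S₂_toInst, TensorCPD.S₁_toInst,
        ← hI, hn0]
      rfl
    rw [hexp, mul_comm]
    refine ht.trans (Nat.mul_le_mul_left _ ?_)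
    rw [Polynomial.eval_add, Polynomial.eval_comp, hiter, TensorCPD.Prog.eval_tmPoly]
    exact Nat.le_add_right _ _
  · refine TensorCPD.space_le.trans ?_
    simp only [Polynomial.eval_add, Polynomial.eval_mul, hiter, Polynomial.eval_ofNat]
    exact Nat.le_add_left _ _
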